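/- Let $\mathfrak a\subset\mathbf C[x]=\mathbf C[x_1,\dots,x_n]$ be a nonzero ideal generated by monomials. **The $b$-function.** Let $f_1,\dots,f_r$ be any finite system of nonzero generators of $\mathfrak a$. Let $\mathcal D=\mathbf C[x]\langle\partial_1,\dots,\partial_n\rangle$ act on $\mathbf C[x]\bigl[\tfrac1{f_1\cdots f_r}\bigr][s_1,\dots,s_r]\prod_jf_j^{s_j}$ in the usual way, so that $$\partial_i\Bigl(g\prod_jf_j^{s_j}\Bigr)=\Bigl(\partial_ig+g\sum_js_j\frac{\partial_if_j}{f_j}\Bigr)\prod_jf_j^{s_j}.$$ Let $t_j$ act by replacing $s_j$ with $s_j+1$ (in $g$ and in $f_j^{s_j}$), and put $s_{i,j}=s_it_i^{-1}t_j$ and $s=\sum_js_j$. The $b$-function $b_{\mathfrak a}(s)=b_f(s)$ is the monic polynomial of least degree in $\mathbf C[s]$ such that $$b_f(s)\prod_jf_j^{s_j}=\sum_{k=1}^rP_kt_k\prod_jf_j^{s_j}$$ for some $P_1,\dots,P_r$ in the ring generated by $\mathcal D$ and the $s_{i,j}$. Put $R_{\mathfrak a}=\{\alpha\in\mathbf C\mid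 b_{\mathfrak a}(-\alpha)=0\}$. **The combinatorial data.** Let $\Gamma_{\mathfrak a}=\{u\in\mathbf N^n\mid x^u\in\mathfrak a\}$, let $P_{\mathfrak a}\subset\mathbf R^n$ be the convex hull of $\Gamma_{\mathfrak a}$, and let $e=(1,\dots,1)$. For a nonempty face $Q$ of $P_{\mathfrak a}$ not contained in any coordinate hyperplane $\{x_i=0\}$, let - $M_Q\subset\mathbf Z^n$ be the subsemigroup generated by the differences $u-v$ with $u\in\Gamma_{\mathfrak a}$, $v\in\Gamma_{\mathfrak a}\cap Q$; - $M_Q'=v_0+M_Q$ for $v_0\in\Gamma_{\mathfrak a}\cap Q$ (this does not depend on $v_0$); - $V_Q$ be the linear subspace of $\mathbf R^n$ spanned by $Q$; - $L_Q:\mathbf R^n\to\mathbf R$ be a linear function with rational coefficients whose restriction to $Q$ is $1$ (its restriction to $V_Q$ does not depend on the choice); - $R_Q=\{L_Q(u)\mid u\in(e+(M_Q\setminus M_Q'))\cap V_Q\}$. For $Q=P_{\mathfrak a}$ no function $L_Q$ exists, and one sets $R_{P_{\mathfrak a}}=\emptyset$. **Theorem** (Budur, Mustaţă, Saito). The polynomial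 $b_{\mathfrak a}(s)$ exists, and $$R_{\mathfrak a}=\bigcup_QR_Q,$$ where $Q$ runs over the nonempty faces of $P_{\mathfrak a}$ not contained in any coordinate hyperplane. -/

import Mathlib

noncomputable section

namespace BernsteinSato

open MvPolynomial

/-! ### Bernstein–Sato polynomials of ideals in `ℂ[x₁,…,xₙ]` -/

/-- The coordinate ring `ℂ[x₁,…,xₙ]`. -/
abbrev Poly (n : ℕ) : Type := MvPolynomial (Fin n) ℂ

variable {n r : ℕ}

/-- The ring `ℂ[x][1/(f₁⋯f_r)]`. -/
abbrev Loc (f : Fin r → Poly n) : Type := Localization.Away (∏ j, f j)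

/-- The ring homomorphism `p ↦ p + ε ∂ᵢp` from `ℂ[x]` to the dual numbers over `ℂ[x][1/(f₁⋯f_r)]`. -/
def dualHom (f : Fin r → Poly n) (i : Fin n) : Poly n →ₐ[ℂ] DualNumber (Loc f) where
  toFun p := TrivSqZeroExt.inl (algebraMap (Poly n) (Loc f) p) +
    TrivSqZeroExt.inr (algebraMap (Poly n) (Loc f) (pderiv i p))
  map_one' := by ext <;> simp
  map_zero' := by ext <;> simp
  map_add' p q := by
    ext
    · simp
    · simp only [TrivSqZeroExt.snd_add, TrivSqZeroExt.snd_inl, TrivSqZeroExt.snd_inr, map_add,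
        zero_add]
  map_mul' p q := by
    ext
    · simp
    · simp only [TrivSqZeroExt.snd_add, TrivSqZeroExt.snd_inl, TrivSqZeroExt.snd_inr,
        TrivSqZeroExt.snd_mul, TrivSqZeroExt.fst_add, TrivSqZeroExt.fst_inl,
        TrivSqZeroExt.fst_inr, zero_add, add_zero, Derivation.leibniz, map_add, smul_eq_mul,
        map_mul, MulOpposite.smul_eq_mul_unop, MulOpposite.unop_op]
      ring
  commutes' c := by
    ext
    · simp [TrivSqZeroExt.algebraMap_eq_inl', IsScalarTower.algebraMap_apply ℂ (Poly n) (Loc f)]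
    · simp [TrivSqZeroExt.algebraMap_eq_inl']

theorem isUnit_dualHom (f : Fin r → Poly n) (i : Fin n)
    (y : Submonoid.powers (∏ j, f j)) : IsUnit (dualHom f i y) := by
  rw [TrivSqZeroExt.isUnit_iff_isUnit_fst]
  have : (dualHom f i y).fst = algebraMap (Poly n) (Loc f) y := by simp [dualHom]
  rw [this]
  exact IsLocalization.map_units (Loc f) y

/-- The extension of `p ↦ p + ε ∂ᵢp` to `ℂ[x][1/(f₁⋯f_r)]`. -/
def locDualHom (f : Fin r → Poly n) (i : Fin n) : Loc f →ₐ[ℂ] DualNumber (Loc f) :=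
  IsLocalization.liftAlgHom (M := Submonoid.powers (∏ j, f j)) (f := dualHom f i)
    (isUnit_dualHom f i)

theorem locDualHom_algebraMap (f : Fin r → Poly n) (i : Fin n) (p : Poly n) :
    locDualHom f i (algebraMap (Poly n) (Loc f) p) = dualHom f i p :=
  IsLocalization.lift_eq _ p

theorem fst_locDualHom (f : Fin r → Poly n) (i : Fin n) (a : Loc f) :
    (locDualHom f i a).fst = a := by
  have h : (TrivSqZeroExt.fstHom ℂ (Loc f) (Loc f)).comp (locDualHom f i) = AlgHom.id ℂ _ := by
    apply IsLocalization.algHom_ext (Submonoid.powers (∏ j, f j))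
    ext p
    simp [Algebra.algHom, locDualHom_algebraMap, dualHom]
  exact congrArg (fun φ : Loc f →ₐ[ℂ] Loc f => φ a) h

/-- The partial derivative `∂ᵢ` on `ℂ[x][1/(f₁⋯f_r)]`: the derivation extending
`MvPolynomial.pderiv i` (see `locPderiv_algebraMap`). -/
def locPderiv (f : Fin r → Poly n) (i : Fin n) : Derivation ℂ (Loc f) (Loc f) where
  toFun a := (locDualHom f i a).snd
  map_add' a b := by simp
  map_smul' c a := by simp
  map_one_eq_zero' := by simp
  leibniz' a b := by
    simp [fst_locDualHom, mul_comm]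

theorem locPderiv_algebraMap (f : Fin r → Poly n) (i : Fin n) (p : Poly n) :
    locPderiv f i (algebraMap (Poly n) (Loc f) p) = algebraMap (Poly n) (Loc f) (pderiv i p) := by
  change (locDualHom f i (algebraMap (Poly n) (Loc f) p)).snd = _
  rw [locDualHom_algebraMap]
  change (TrivSqZeroExt.inl _ + TrivSqZeroExt.inr _ : DualNumber (Loc f)).snd = _
  rw [TrivSqZeroExt.snd_add, TrivSqZeroExt.snd_inl, TrivSqZeroExt.snd_inr, zero_add]

/-- The element `f_j` of `ℂ[x][1/(f₁⋯f_r)]`. -/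
def gen (f : Fin r → Poly n) (j : Fin r) : Loc f := algebraMap (Poly n) (Loc f) (f j)

theorem isUnit_gen (f : Fin r → Poly n) (j : Fin r) : IsUnit (gen f j) :=
  isUnit_of_dvd_unit
    (map_dvd (algebraMap (Poly n) (Loc f)) (Finset.dvd_prod_of_mem f (Finset.mem_univ j)))
    (IsLocalization.Away.algebraMap_isUnit (∏ j, f j))

/-- The element `1 / f_j` of `ℂ[x][1/(f₁⋯f_r)]`. -/
def genInv (f : Fin r → Poly n) (j : Fin r) : Loc f := Ring.inverse (gen f j)

theorem gen_mul_genInv (f : Fin r → Poly n) (j : Fin r) : gen f j * genInv f j = 1 :=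
  Ring.mul_inverse_cancel _ (isUnit_gen f j)

/-- The module `ℂ[x][1/(f₁⋯f_r)][s₁,…,s_r] ∏ⱼ f_j^{s_j}`, free of rank one over
`ℂ[x][1/(f₁⋯f_r)][s₁,…,s_r]`: the polynomial `g` stands for `g ∏ⱼ f_j^{s_j}`, so that `1` stands
for `∏ⱼ f_j^{s_j}`. -/
abbrev PowModule (f : Fin r → Poly n) : Type := MvPolynomial (Fin r) (Loc f)

theorem coeff_sum_locPderiv (f : Fin r → Poly n) (i : Fin n) (g : PowModule f)
    (μ : Fin r →₀ ℕ) :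
    coeff μ (∑ ν ∈ g.support, (monomial ν (locPderiv f i (coeff ν g)) : PowModule f)) =
      locPderiv f i (coeff μ g) := by
  simp only [coeff_sum, coeff_monomial]
  rw [Finset.sum_ite_eq']
  split_ifs with hμ
  · rfl
  · rw [notMem_support_iff.mp hμ, map_zero]

/-- Coefficientwise application of `∂ᵢ` (that is, `∂ᵢ s_j = 0`), see `coeff_coeffPderiv`. -/
def coeffPderiv (f : Fin r → Poly n) (i : Fin n) : PowModule f →ₗ[ℂ] PowModule f where
  toFun g := ∑ ν ∈ g.support, monomial ν (locPderiv f i (coeff ν g))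
  map_add' g h := by
    apply MvPolynomial.ext
    intro μ
    rw [coeff_add, coeff_sum_locPderiv, coeff_sum_locPderiv, coeff_sum_locPderiv, coeff_add,
      map_add]
  map_smul' c g := by
    apply MvPolynomial.ext
    intro μ
    rw [RingHom.id_apply, coeff_smul, coeff_sum_locPderiv, coeff_sum_locPderiv, coeff_smul,
      Derivation.map_smul]

theorem coeff_coeffPderiv (f : Fin r → Poly n) (i : Fin n) (g : PowModule f) (μ : Fin r →₀ ℕ) :
    coeff μ (coeffPderiv f i g) = locPderiv f i (coeff μ g) :=
  coeff_sum_locPderiv f i g μ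

/-- Multiplication by the function `p ∈ ℂ[x]`. -/
def mulOp (f : Fin r → Poly n) (p : Poly n) : Module.End ℂ (PowModule f) :=
  LinearMap.mulLeft ℂ (C (algebraMap (Poly n) (Loc f) p))

/-- The vector field `∂ᵢ`:
`∂ᵢ (g ∏ f_j^{s_j}) = (∂ᵢ g + g ∑ⱼ s_j (∂ᵢ f_j) / f_j) ∏ f_j^{s_j}`. -/
def derivOp (f : Fin r → Poly n) (i : Fin n) : Module.End ℂ (PowModule f) :=
  coeffPderiv f i +
    LinearMap.mulLeft ℂ (∑ j, X j * C (locPderiv f i (gen f j) * genInv f j))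

/-- Multiplication by the variable `s_j`. -/
def sOp (f : Fin r → Poly n) (j : Fin r) : Module.End ℂ (PowModule f) :=
  LinearMap.mulLeft ℂ (X j)

/-- The action of `t_j`, which replaces `s_j` by `s_j + 1`:
`g(s) ∏ f_k^{s_k} ↦ g(…, s_j + 1, …) f_j ∏ f_k^{s_k}`. -/
def tOp (f : Fin r → Poly n) (j : Fin r) : Module.End ℂ (PowModule f) :=
  LinearMap.mulLeft ℂ (C (gen f j)) ∘ₗ
    ((aeval fun k => X k + Pi.single (M := fun _ => PowModule f) j 1 k :
      PowModule f →ₐ[Loc f] PowModule f).toLinearMap.restrictScalars ℂ)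

/-- The action of `t_j⁻¹`, which replaces `s_j` by `s_j - 1`. -/
def tInvOp (f : Fin r → Poly n) (j : Fin r) : Module.End ℂ (PowModule f) :=
  LinearMap.mulLeft ℂ (C (genInv f j)) ∘ₗ
    ((aeval fun k => X k - Pi.single (M := fun _ => PowModule f) j 1 k :
      PowModule f →ₐ[Loc f] PowModule f).toLinearMap.restrictScalars ℂ)

/-- The ring generated by `𝒟 = ℂ[x]⟨∂₁,…,∂ₙ⟩` and the operators `s_{i,j} = s_i t_i⁻¹ t_j`. -/
def operatorRing (f : Fin r → Poly n) : Subalgebra ℂ (Module.End ℂ (PowModule f)) :=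
  Algebra.adjoin ℂ (Set.range (mulOp f) ∪ Set.range (derivOp f) ∪
    Set.range fun ij : Fin r × Fin r => sOp f ij.1 * tInvOp f ij.1 * tOp f ij.2)

/-- `b(s₁ + ⋯ + s_r) ∏ f_j^{s_j} = ∑ₖ P_k t_k ∏ f_j^{s_j}` for some `P_k` in the ring generated by
`𝒟` and the `s_{i,j}`. -/
def FunctionalEquation (f : Fin r → Poly n) (b : Polynomial ℂ) : Prop :=
  ∃ P : Fin r → Module.End ℂ (PowModule f), (∀ k, P k ∈ operatorRing f) ∧
    Polynomial.aeval (∑ j, X j : PowModule f) b = ∑ k, P k (tOp f k 1)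

/-- `b` is the `b`-function (Bernstein–Sato polynomial) `b_f(s)` of `f = (f₁,…,f_r)`: the monic
polynomial of least degree satisfying the functional equation. -/
def IsBFunction (f : Fin r → Poly n) (b : Polynomial ℂ) : Prop :=
  b.Monic ∧ FunctionalEquation f b ∧
    ∀ c : Polynomial ℂ, c.Monic → FunctionalEquation f c → b.natDegree ≤ c.natDegree

/-! ### The combinatorics of a monomial ideal -/

/-- An ideal of `ℂ[x₁,…,xₙ]` generated by monomials. -/
def IsMonomialIdeal (a : Ideal (Poly n)) : Prop :=
  ∃ S : Set (Fin n →₀ ℕ), a = Ideal.span ((fun u => (monomial u 1 : Poly n)) '' S)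

/-- The semigroup `Γ_a = {u ∈ ℕⁿ ∣ x^u ∈ a}`. -/
def expSet (a : Ideal (Poly n)) : Set (Fin n →₀ ℕ) := {u | (monomial u 1 : Poly n) ∈ a}

/-- An integer vector as a point of `ℝⁿ`. -/
def toReal (u : Fin n → ℤ) : Fin n → ℝ := fun i => (u i : ℝ)

/-- `Γ_a` as a subset of `ℤⁿ`. -/
def lattExpSet (a : Ideal (Poly n)) : Set (Fin n → ℤ) :=
  (fun (u : Fin n →₀ ℕ) (i : Fin n) => (u i : ℤ)) '' expSet a

/-- The Newton polyhedron `P_a`, the convex hull of `Γ_a` in `ℝⁿ`. -/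
def newtonPolyhedron (a : Ideal (Poly n)) : Set (Fin n → ℝ) :=
  convexHull ℝ (toReal '' lattExpSet a)

/-- The nonempty faces of `P_a` (loci where a linear form attains its maximum over `P_a`) that are
not contained in any coordinate hyperplane `{x_i = 0}`. -/
def faces (a : Ideal (Poly n)) : Set (Set (Fin n → ℝ)) :=
  {Q | Q.Nonempty ∧ IsExposed ℝ (newtonPolyhedron a) Q ∧ ∀ i, ¬ Q ⊆ {x | x i = 0}}

/-- `Γ_a ∩ Q`. -/
def facePoints (a : Ideal (Poly n)) (Q : Set (Fin n → ℝ)) : Set (Fin n → ℤ) :=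
  {v | v ∈ lattExpSet a ∧ toReal v ∈ Q}

/-- `M_Q`: the subsemigroup of `ℤⁿ` generated by `u - v` with `u ∈ Γ_a`, `v ∈ Γ_a ∩ Q`. -/
def faceSemigroup (a : Ideal (Poly n)) (Q : Set (Fin n → ℝ)) : AddSubsemigroup (Fin n → ℤ) :=
  AddSubsemigroup.closure {w | ∃ u ∈ lattExpSet a, ∃ v ∈ facePoints a Q, w = u - v}

/-- `M'_Q = v₀ + M_Q` with `v₀ ∈ Γ_a ∩ Q` (independent of `v₀`, see `shiftedFaceSemigroup_eq`). -/
def shiftedFaceSemigroup (a : Ideal (Poly n)) (Q : Set (Fin n → ℝ)) : Set (Fin n → ℤ) :=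
  {w | ∃ v₀ ∈ facePoints a Q, ∃ m ∈ faceSemigroup a Q, w = v₀ + m}

theorem shiftedFaceSemigroup_eq (a : Ideal (Poly n)) (Q : Set (Fin n → ℝ)) (v₀ : Fin n → ℤ)
    (hv₀ : v₀ ∈ facePoints a Q) :
    shiftedFaceSemigroup a Q = {w | ∃ m ∈ faceSemigroup a Q, w = v₀ + m} := by
  ext w
  constructor
  · rintro ⟨v, hv, m, hm, rfl⟩
    refine ⟨(v - v₀) + m, add_mem (AddSubsemigroup.subset_closure ⟨v, hv.1, v₀, hv₀, rfl⟩) hm, ?_⟩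
    abel
  · rintro ⟨m, hm, rfl⟩
    exact ⟨v₀, hv₀, m, hm, rfl⟩

/-- `L` is a linear function on `ℝⁿ` with rational coefficients whose restriction to `Q` is `1`. -/
def IsFaceFunction (Q : Set (Fin n → ℝ)) (L : (Fin n → ℝ) →ₗ[ℝ] ℝ) : Prop :=
  (∀ i, ∃ q : ℚ, L (Pi.single i 1) = q) ∧ ∀ x ∈ Q, L x = 1

/-- `R_Q = {L_Q(u) ∣ u ∈ (e + (M_Q \ M'_Q)) ∩ V_Q}` with `e = (1,…,1)` and `V_Q` the linear span of
`Q`. Any two functions `L_Q` agree on `V_Q`, so the choice of `L_Q` is immaterial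
(see `faceRoots_eq`). -/
def faceRoots (a : Ideal (Poly n)) (Q : Set (Fin n → ℝ)) : Set ℝ :=
  {α | ∃ L : (Fin n → ℝ) →ₗ[ℝ] ℝ, IsFaceFunction Q L ∧
    ∃ w : Fin n → ℤ, w ∈ faceSemigroup a Q ∧ w ∉ shiftedFaceSemigroup a Q ∧
      toReal (1 + w) ∈ Submodule.span ℝ Q ∧ α = L (toReal (1 + w))}

theorem faceRoots_eq (a : Ideal (Poly n)) (Q : Set (Fin n → ℝ)) (L : (Fin n → ℝ) →ₗ[ℝ] ℝ)
    (hL : IsFaceFunction Q L) :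
    faceRoots a Q = {α | ∃ w : Fin n → ℤ, w ∈ faceSemigroup a Q ∧ w ∉ shiftedFaceSemigroup a Q ∧
      toReal (1 + w) ∈ Submodule.span ℝ Q ∧ α = L (toReal (1 + w))} := by
  ext α
  constructor
  · rintro ⟨L', hL', w, h1, h2, h3, rfl⟩
    refine ⟨w, h1, h2, h3, ?_⟩
    exact LinearMap.eqOn_span (fun x hx => (hL'.2 x hx).trans (hL.2 x hx).symm) h3
  · rintro ⟨w, h1, h2, h3, rfl⟩
    exact ⟨L, hL, w, h1, h2, h3, rfl⟩

end BernsteinSato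

end

noncomputable section
namespace BernsteinSato
open MvPolynomial

/-! ### The module of distributions along the graph -/

variable {n : ℕ} {σ τ : Type*}

/-! The functional equation is first moved to a place where only the ideal matters. In `PowModule f`
let `y_j` act as `-s_j t_j⁻¹`. Then `ℂ[x][y]`, twisted by `e^{-F}` with `F = ∑ f_j y_j`, embeds by
`graphEmb`, with `t_j` becoming `-∂/∂y_j` and `∑ s_j` the Euler operator. The elements `∑ P_k t_k ∏
f_j^{s_j}` form the image of `reesModule`, the `𝒟`-module generated by the pieces `a^{m+1} ⊗ Sym^m`
(`map_graphEmb_reesModule`). Changing generators of `a` amounts to a linear change of the `y_j` over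
`ℂ[x]` followed by setting some of them to zero (`GraphEquation.of_span_eq`), so the generators may
be taken to be monomials `x^{A_k}`.

For monomials put `ℓ_i(s) = ∑ A_{k,i} s_k`. Applying `∂^β` to `x^β (x^{∑ν_k A_k} y^ν)` multiplies `∏
f_j^{s_j}` by `risePoly A β * fallPoly ν`. These products, over pairs with `x^{β + ∑ν_k A_k} ∈
a^{|ν|+1}`, generate `testIdeal`; if `b(∑ s_k)` lies in it, `b` satisfies the functional equation.
Conversely the functionals `mellin` show that every such `b` vanishes at `∑ s_k` for each common
zero `s` of the test ideal (`GraphEquation.eval_eq_zero`). There are only finitely many sums `∑ s_k`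
(`finite_image_testZeros`), so the Nullstellensatz gives existence of the `b`-function and
identifies its roots with these sums (`exists_isBFunction`).

It remains to match test zeros with faces. A point `s` is a test zero iff no integer vector `c` of
sum `1` keeps every `s_k ∈ ℕ` in `ℕ` and every `ℓ_i(s) ∈ ℤ_{<0}` in `ℤ_{<0}`
(`mem_testZeros_iff_not_isFeasible`). Linear duality turns this into weights `q ≥ 0` with `q · A_k ≥
1`, hence a face `Q = {q · x = 1}`. Strict complementarity gives an integer direction that relaxes
every constraint of weight zero, and the constraints that remain are those defining `M_Q` and
`M'_Q`. The integers `s_k` off `Q` and `-1 - ℓ_i(s)` off the free coordinates then assemble into `w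
∈ M_Q \ M'_Q` with `e + w ∈ V_Q` and `L_Q(e + w) = -∑ s_k` (`exists_face_of_mem_testZeros`). Reading
the construction backwards gives the other inclusion (`IsMaxLocus.exists_mem_testZeros`). -/

/-- The polynomial ring `ℂ[x₁,…,xₙ][y_j ∣ j ∈ σ]`, with `y_j` indexed by `Sum.inl j` and `x_i` by
`Sum.inr i`. The element `g` stands for `g e^{-F}` with `F = ∑ f_j y_j`, see `connection`. -/
abbrev GraphRing (σ : Type*) (n : ℕ) : Type _ := MvPolynomial (σ ⊕ Fin n) ℂ

/-- The inclusion `ℂ[x] → ℂ[x][y]`. -/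
def baseIncl (σ : Type*) (n : ℕ) : Poly n →ₐ[ℂ] GraphRing σ n := rename Sum.inr

theorem baseIncl_X (i : Fin n) : baseIncl σ n (X i) = X (Sum.inr i) := rename_X _ _

theorem pderiv_inl_baseIncl (j : σ) (p : Poly n) : pderiv (Sum.inl j) (baseIncl σ n p) = 0 := by
  induction p using MvPolynomial.induction_on with
  | C c => simp [baseIncl]
  | add p q hp hq => simp [hp, hq]
  | mul_X p i hp => simp [hp, baseIncl_X, pderiv_X_of_ne]

theorem pderiv_inr_baseIncl (i : Fin n) (p : Poly n) :
    pderiv (Sum.inr i) (baseIncl σ n p) = baseIncl σ n (pderiv i p) :=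
  pderiv_rename Sum.inr_injective _ _

theorem pderiv_comm {ι : Type*} (a b : ι) (g : MvPolynomial ι ℂ) :
    pderiv a (pderiv b g) = pderiv b (pderiv a g) := by
  classical
  have h : ⁅(pderiv a : Derivation ℂ (MvPolynomial ι ℂ) (MvPolynomial ι ℂ)),
      (pderiv b : Derivation ℂ (MvPolynomial ι ℂ) (MvPolynomial ι ℂ))⁆ = 0 := by
    apply MvPolynomial.derivation_ext
    intro c
    rw [Derivation.commutator_apply, pderiv_X, pderiv_X]
    by_cases h1 : a = c <;> by_cases h2 : b = c <;> simp [h1, h2]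
  have := congrArg (fun D : Derivation ℂ _ _ => D g) h
  rw [Derivation.commutator_apply, Derivation.zero_apply, sub_eq_zero] at this
  exact this

/-- The function `F = ∑ f_j y_j`. -/
def phase [Fintype σ] (f : σ → Poly n) : GraphRing σ n :=
  ∑ j, baseIncl σ n (f j) * X (Sum.inl j)

theorem pderiv_inl_phase [Fintype σ] (f : σ → Poly n) (j : σ) :
    pderiv (Sum.inl j) (phase f) = baseIncl σ n (f j) := by
  classical
  simp only [phase, map_sum, Derivation.leibniz, pderiv_inl_baseIncl, pderiv_X, smul_eq_mul,
    Pi.single_apply, Sum.inl.injEq]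
  simp

theorem pderiv_inr_phase [Fintype σ] (f : σ → Poly n) (i : Fin n) :
    pderiv (Sum.inr i) (phase f) = ∑ j, baseIncl σ n (pderiv i (f j)) * X (Sum.inl j) := by
  classical
  simp [phase, map_sum, Derivation.leibniz, pderiv_inr_baseIncl, pderiv_X, mul_comm]

/-- The action of `∂_i` on `ℂ[x][y] e^{-F}`. -/
def connection [Fintype σ] (f : σ → Poly n) (i : Fin n) : Module.End ℂ (GraphRing σ n) :=
  (pderiv (Sum.inr i)).toLinearMap - LinearMap.mulLeft ℂ (pderiv (Sum.inr i) (phase f))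

theorem connection_apply [Fintype σ] (f : σ → Poly n) (i : Fin n) (g : GraphRing σ n) :
    connection f i g = pderiv (Sum.inr i) g - pderiv (Sum.inr i) (phase f) * g := rfl

/-- The action of `t_j = -∂/∂y_j` on `ℂ[x][y] e^{-F}`. -/
def tAct (f : σ → Poly n) (j : σ) : Module.End ℂ (GraphRing σ n) :=
  LinearMap.mulLeft ℂ (baseIncl σ n (f j)) - (pderiv (Sum.inl j)).toLinearMap

theorem tAct_apply (f : σ → Poly n) (j : σ) (g : GraphRing σ n) :
    tAct f j g = baseIncl σ n (f j) * g - pderiv (Sum.inl j) g := rfl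

/-- The action of the Euler field `∑ y_j ∂/∂y_j` on `ℂ[x][y] e^{-F}`. -/
def eulerAct [Fintype σ] (f : σ → Poly n) : Module.End ℂ (GraphRing σ n) :=
  -∑ j, LinearMap.mulLeft ℂ (X (Sum.inl j)) * tAct f j

theorem eulerAct_apply [Fintype σ] (f : σ → Poly n) (g : GraphRing σ n) :
    eulerAct f g = -∑ j, X (Sum.inl j) * tAct f j g := by
  simp [eulerAct]

theorem connection_baseIncl_mul [Fintype σ] (f : σ → Poly n) (i : Fin n) (p : Poly n)
    (g : GraphRing σ n) :
    connection f i (baseIncl σ n p * g) =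
      baseIncl σ n (pderiv i p) * g + baseIncl σ n p * connection f i g := by
  rw [connection_apply, connection_apply, Derivation.leibniz, pderiv_inr_baseIncl, smul_eq_mul,
    smul_eq_mul]
  ring

theorem connection_X_mul [Fintype σ] (f : σ → Poly n) (i : Fin n) (j : σ) (g : GraphRing σ n) :
    connection f i (X (Sum.inl j) * g) = X (Sum.inl j) * connection f i g := by
  rw [connection_apply, connection_apply, Derivation.leibniz, pderiv_X_of_ne (by simp), smul_eq_mul,
    smul_zero]
  ring

/-- Both operators are, up to sign, conjugates by `e^{-F}` of commuting partial derivatives. -/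
theorem connection_tAct [Fintype σ] (f : σ → Poly n) (i : Fin n) (j : σ) (g : GraphRing σ n) :
    connection f i (tAct f j g) = tAct f j (connection f i g) := by
  simp only [connection_apply, tAct_apply, map_sub, Derivation.leibniz, smul_eq_mul,
    pderiv_comm (Sum.inl j) (Sum.inr i), pderiv_inl_phase]
  ring

/-- The summand `a^{m+1} ⊗ Sym^m` of `ℂ[x][y]`. -/
def reesPiece (σ : Type*) (a : Ideal (Poly n)) : ℕ → Submodule ℂ (GraphRing σ n)
  | 0 => Submodule.span ℂ {g | ∃ p ∈ a, g = baseIncl σ n p}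
  | m + 1 => Submodule.span ℂ {g | ∃ p ∈ a, ∃ j : σ, ∃ h ∈ reesPiece σ a m,
      g = baseIncl σ n p * X (Sum.inl j) * h}

theorem baseIncl_mem_reesPiece {a : Ideal (Poly n)} {p : Poly n} (hp : p ∈ a) :
    baseIncl σ n p ∈ reesPiece σ a 0 := Submodule.subset_span ⟨p, hp, rfl⟩

theorem mul_mem_reesPiece {a : Ideal (Poly n)} {p : Poly n} (hp : p ∈ a) (j : σ) {m : ℕ}
    {h : GraphRing σ n} (hh : h ∈ reesPiece σ a m) :
    baseIncl σ n p * X (Sum.inl j) * h ∈ reesPiece σ a (m + 1) :=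
  Submodule.subset_span ⟨p, hp, j, h, hh, rfl⟩

theorem baseIncl_mul_mem_reesPiece {a : Ideal (Poly n)} (q : Poly n) {m : ℕ}
    {g : GraphRing σ n} (hg : g ∈ reesPiece σ a m) : baseIncl σ n q * g ∈ reesPiece σ a m := by
  change g ∈ (reesPiece σ a m).comap (LinearMap.mulLeft ℂ (baseIncl σ n q))
  revert hg g
  change reesPiece σ a m ≤ (reesPiece σ a m).comap (LinearMap.mulLeft ℂ (baseIncl σ n q))
  cases m with
  | zero =>
    refine Submodule.span_le.2 ?_
    rintro _ ⟨p, hp, rfl⟩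
    have := baseIncl_mem_reesPiece (σ := σ) (a.mul_mem_left q hp)
    simpa using this
  | succ m =>
    refine Submodule.span_le.2 ?_
    rintro _ ⟨p, hp, j, h, hh, rfl⟩
    have := mul_mem_reesPiece (a.mul_mem_left q hp) j hh
    simpa [mul_assoc] using this

/-- By the Leibniz rule `y_k ∂/∂y_j` only exchanges one factor `y_j` for `y_k`; the coefficients in
`a` are untouched. -/
theorem X_mul_pderiv_mem_reesPiece {a : Ideal (Poly n)} (k j : σ) {m : ℕ}
    {g : GraphRing σ n} (hg : g ∈ reesPiece σ a m) :
    X (Sum.inl k) * pderiv (Sum.inl j) g ∈ reesPiece σ a m := by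
  classical
  induction m generalizing g with
  | zero =>
    refine Submodule.span_induction ?_ (by simp) ?_ ?_ hg
    · rintro _ ⟨p, hp, rfl⟩
      simp [pderiv_inl_baseIncl]
    · intro x y _ _ hx hy
      simpa [mul_add] using add_mem hx hy
    · intro c x _ hx
      simpa using Submodule.smul_mem _ c hx
  | succ m ih =>
    refine Submodule.span_induction ?_ (by simp) ?_ ?_ hg
    · rintro _ ⟨p, hp, l, h, hh, rfl⟩
      have e : X (Sum.inl k) * pderiv (Sum.inl j) (baseIncl σ n p * X (Sum.inl l) * h) =
          (Pi.single (M := fun _ : σ => ℂ) j 1 l) • (baseIncl σ n p * X (Sum.inl k) * h) +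
          baseIncl σ n p * X (Sum.inl l) * (X (Sum.inl k) * pderiv (Sum.inl j) h) := by
        simp only [Derivation.leibniz, pderiv_inl_baseIncl, smul_eq_mul, pderiv_X, Pi.single_apply,
          Sum.inl.injEq]
        split_ifs <;> simp <;> ring
      rw [e]
      exact add_mem (Submodule.smul_mem _ _ (mul_mem_reesPiece hp k hh))
        (mul_mem_reesPiece hp l (ih hh))
    · intro x y _ _ hx hy
      simpa [mul_add] using add_mem hx hy
    · intro c x _ hx
      simpa using Submodule.smul_mem _ c hx

/-- The `𝒟`-submodule of `ℂ[x][y] e^{-F}` generated by the `a^{m+1} ⊗ Sym^m`. -/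
def reesModule [Fintype σ] (f : σ → Poly n) (a : Ideal (Poly n)) : Submodule ℂ (GraphRing σ n) :=
  sInf {S | (∀ m, reesPiece σ a m ≤ S) ∧ ∀ i, S ≤ S.comap (connection f i)}

theorem reesModule_le [Fintype σ] {f : σ → Poly n} {a : Ideal (Poly n)}
    {S : Submodule ℂ (GraphRing σ n)} (h1 : ∀ m, reesPiece σ a m ≤ S)
    (h2 : ∀ i, S ≤ S.comap (connection f i)) : reesModule f a ≤ S :=
  sInf_le ⟨h1, h2⟩

theorem reesPiece_le_reesModule [Fintype σ] (f : σ → Poly n) (a : Ideal (Poly n)) (m : ℕ) :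
    reesPiece σ a m ≤ reesModule f a :=
  le_sInf fun _ hS => hS.1 m

theorem connection_mem_reesModule [Fintype σ] {f : σ → Poly n} {a : Ideal (Poly n)} (i : Fin n)
    {g : GraphRing σ n} (hg : g ∈ reesModule f a) : connection f i g ∈ reesModule f a :=
  Submodule.mem_sInf.2 fun S hS => hS.2 i (Submodule.mem_sInf.1 hg S hS)

theorem baseIncl_mul_mem_reesModule [Fintype σ] {f : σ → Poly n} {a : Ideal (Poly n)}
    (p : Poly n) {g : GraphRing σ n} (hg : g ∈ reesModule f a) :
    baseIncl σ n p * g ∈ reesModule f a := by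
  -- All `p` are treated at once, because commuting `p` past `∂_i` produces the multiplier `∂_i p`.
  let S : Submodule ℂ (GraphRing σ n) :=
    ⨅ p : Poly n, (reesModule f a).comap (LinearMap.mulLeft ℂ (baseIncl σ n p))
  have hS : ∀ {g}, g ∈ S ↔ ∀ p, baseIncl σ n p * g ∈ reesModule f a := by
    simp [S, Submodule.mem_iInf]
  have : reesModule f a ≤ S := by
    refine reesModule_le (fun m g hg => hS.2 fun p => ?_) (fun i g hg => hS.2 fun p => ?_)
    · exact reesPiece_le_reesModule f a m (baseIncl_mul_mem_reesPiece p hg)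
    · have e := connection_baseIncl_mul f i p g
      rw [eq_sub_of_add_eq' e.symm]
      exact sub_mem (connection_mem_reesModule i (hS.1 hg p)) (hS.1 hg _)
  exact hS.1 (this hg) p

/-- In `y_k t_j = f_j y_k - y_k ∂/∂y_j` the first term raises the piece from `m` to `m + 1` and the
second preserves it. This is why the pieces of all degrees must be taken together. -/
theorem X_mul_tAct_mem_reesModule [Fintype σ] {f : σ → Poly n} {a : Ideal (Poly n)}
    (hf : ∀ j, f j ∈ a) (k j : σ) {g : GraphRing σ n} (hg : g ∈ reesModule f a) :
    X (Sum.inl k) * tAct f j g ∈ reesModule f a := by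
  let S : Submodule ℂ (GraphRing σ n) :=
    (reesModule f a).comap (LinearMap.mulLeft ℂ (X (Sum.inl k)) * tAct f j)
  have : reesModule f a ≤ S := by
    refine reesModule_le (fun m g hg => ?_) (fun i g hg => ?_)
    · change X (Sum.inl k) * tAct f j g ∈ reesModule f a
      rw [tAct_apply, mul_sub]
      refine sub_mem (reesPiece_le_reesModule f a (m + 1) ?_)
        (reesPiece_le_reesModule f a m (X_mul_pderiv_mem_reesPiece k j hg))
      have := mul_mem_reesPiece (hf j) k hg
      rwa [mul_comm (baseIncl σ n (f j)), mul_assoc] at this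
    · change X (Sum.inl k) * tAct f j (connection f i g) ∈ reesModule f a
      rw [← connection_tAct, ← connection_X_mul]
      exact connection_mem_reesModule i hg
  exact this hg

theorem eulerAct_mem_reesModule [Fintype σ] {f : σ → Poly n} {a : Ideal (Poly n)}
    (hf : ∀ j, f j ∈ a) {g : GraphRing σ n} (hg : g ∈ reesModule f a) :
    eulerAct f g ∈ reesModule f a := by
  rw [eulerAct_apply]
  exact neg_mem (sum_mem fun j _ => X_mul_tAct_mem_reesModule hf j j hg)

/-- The functional equation for `b`, in terms of `ℂ[x][y] e^{-F}`. -/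
def GraphEquation [Fintype σ] (f : σ → Poly n) (a : Ideal (Poly n)) (b : Polynomial ℂ) : Prop :=
  Polynomial.aeval (eulerAct f) b (1 : GraphRing σ n) ∈ reesModule f a

/-- A linear map intertwining two endomorphisms intertwines polynomials in them. -/
theorem map_aeval_apply {V V' : Type*} [AddCommGroup V] [Module ℂ V] [AddCommGroup V'] [Module ℂ V']
    (φ : V →ₗ[ℂ] V') (A : Module.End ℂ V) (B : Module.End ℂ V') (h : ∀ v, φ (A v) = B (φ v))
    (b : Polynomial ℂ) (v : V) :
    φ (Polynomial.aeval A b v) = Polynomial.aeval B b (φ v) := by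
  induction b using Polynomial.induction_on generalizing v with
  | C c => simp
  | add p q hp hq => simp [hp, hq]
  | monomial k c hk =>
    rw [pow_succ, ← mul_assoc, map_mul _ (_ * _), map_mul _ (_ * _), Module.End.mul_apply,
      Module.End.mul_apply, hk, Polynomial.aeval_X, Polynomial.aeval_X, h]

theorem GraphEquation.mul_left [Fintype σ] {f : σ → Poly n} {a : Ideal (Poly n)}
    (hf : ∀ j, f j ∈ a) {b : Polynomial ℂ} (hb : GraphEquation f a b) (c : Polynomial ℂ) :
    GraphEquation f a (c * b) := by
  rw [GraphEquation] at hb ⊢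
  rw [map_mul, Module.End.mul_apply]
  generalize (Polynomial.aeval (eulerAct f) b) (1 : GraphRing σ n) = v at hb
  induction c using Polynomial.induction_on generalizing v with
  | C c => simpa using Submodule.smul_mem _ c hb
  | add p q hp hq => simpa using add_mem (hp v hb) (hq v hb)
  | monomial k c hk =>
    rw [pow_succ, ← mul_assoc, map_mul, Module.End.mul_apply]
    exact hk _ (by simpa using eulerAct_mem_reesModule hf hb)

theorem GraphEquation.add [Fintype σ] {f : σ → Poly n} {a : Ideal (Poly n)}
    {b c : Polynomial ℂ} (hb : GraphEquation f a b) (hc : GraphEquation f a c) :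
    GraphEquation f a (b + c) := by
  rw [GraphEquation] at hb hc ⊢
  simpa using add_mem hb hc

end BernsteinSato
end

noncomputable section
namespace BernsteinSato
open MvPolynomial
variable {n : ℕ} {σ τ : Type*}

/-! ### Independence of the generators -/

/-- The chain rule for substitutions into polynomials. -/
theorem pderiv_aeval {ι κ : Type*} [Fintype ι] (φ : ι → MvPolynomial κ ℂ) (v : κ)
    (g : MvPolynomial ι ℂ) :
    pderiv v (aeval φ g) = ∑ w, pderiv v (φ w) * aeval φ (pderiv w g) := by
  classical
  induction g using MvPolynomial.induction_on with
  | C c => simp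
  | add p q hp hq => simp only [map_add, hp, hq, mul_add, Finset.sum_add_distrib]
  | mul_X p i hp =>
    simp only [map_mul, Derivation.leibniz, hp, smul_eq_mul, aeval_X, pderiv_X, map_add, mul_add,
      Finset.sum_add_distrib, Finset.mul_sum]
    congr 1
    · rw [Finset.sum_eq_single i]
      · simp [mul_comm]
      · intro w _ hw
        simp [Ne.symm hw]
      · simp
    · exact Finset.sum_congr rfl fun w _ => by ring

/-- The substitution `y_j ↦ y_j + ∑ₖ c_{kj} z_k`. -/
def shearHom [Fintype τ] (c : τ → σ → Poly n) : GraphRing σ n →ₐ[ℂ] GraphRing (σ ⊕ τ) n :=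
  aeval (Sum.elim (fun j => X (Sum.inl (Sum.inl j)) +
    ∑ k, baseIncl (σ ⊕ τ) n (c k j) * X (Sum.inl (Sum.inr k))) fun i => X (Sum.inr i))

theorem shearHom_X_inl [Fintype τ] (c : τ → σ → Poly n) (j : σ) :
    shearHom c (X (Sum.inl j)) = X (Sum.inl (Sum.inl j)) +
      ∑ k, baseIncl (σ ⊕ τ) n (c k j) * X (Sum.inl (Sum.inr k)) := by
  simp [shearHom]

theorem shearHom_X_inr [Fintype τ] (c : τ → σ → Poly n) (i : Fin n) :
    shearHom c (X (Sum.inr i)) = X (Sum.inr i) := by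
  simp [shearHom]

theorem shearHom_baseIncl [Fintype τ] (c : τ → σ → Poly n) (p : Poly n) :
    shearHom c (baseIncl σ n p) = baseIncl (σ ⊕ τ) n p := by
  induction p using MvPolynomial.induction_on with
  | C c => simp [baseIncl]
  | add p q hp hq => simp [hp, hq]
  | mul_X p i hp => simp [hp, baseIncl_X, shearHom_X_inr]

/-- The coefficients `c_{kj}` introduced by the substitution are absorbed into the factors from `a`.
-/
theorem shearHom_mem_reesPiece [Fintype τ] {c : τ → σ → Poly n} {a : Ideal (Poly n)}
    {m : ℕ} {g : GraphRing σ n}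
    (hg : g ∈ reesPiece σ a m) : shearHom c g ∈ reesPiece (σ ⊕ τ) a m := by
  induction m generalizing g with
  | zero =>
    refine (Submodule.span_le (p := (reesPiece (σ ⊕ τ) a 0).comap (shearHom c).toLinearMap)).2 ?_ hg
    rintro _ ⟨p, hp, rfl⟩
    have := baseIncl_mem_reesPiece (σ := σ ⊕ τ) hp
    simpa [shearHom_baseIncl] using this
  | succ m ih =>
    refine (Submodule.span_le
      (p := (reesPiece (σ ⊕ τ) a (m + 1)).comap (shearHom c).toLinearMap)).2 ?_ hg
    rintro _ ⟨p, hp, j, q, hq, rfl⟩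
    change shearHom c (baseIncl σ n p * X (Sum.inl j) * q) ∈ reesPiece (σ ⊕ τ) a (m + 1)
    rw [map_mul, map_mul, shearHom_baseIncl, shearHom_X_inl, mul_add, add_mul, Finset.mul_sum,
      Finset.sum_mul]
    refine add_mem (mul_mem_reesPiece hp _ (ih hq)) (sum_mem fun k _ => ?_)
    have := mul_mem_reesPiece (a.mul_mem_right (c k j) hp) (Sum.inr k : σ ⊕ τ) (ih hq)
    rwa [map_mul, mul_assoc (baseIncl (σ ⊕ τ) n p)] at this

/-- The substitution `y_j ↦ 0`. -/
def projHom (σ τ : Type*) (n : ℕ) : GraphRing (σ ⊕ τ) n →ₐ[ℂ] GraphRing τ n :=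
  aeval (Sum.elim (Sum.elim (fun _ => 0) fun k => X (Sum.inl k)) fun i => X (Sum.inr i))

theorem projHom_X_inl_inl (j : σ) : projHom σ τ n (X (Sum.inl (Sum.inl j))) = 0 := by
  simp [projHom]

theorem projHom_X_inl_inr (k : τ) :
    projHom σ τ n (X (Sum.inl (Sum.inr k))) = X (Sum.inl k) := by
  simp [projHom]

theorem projHom_X_inr (i : Fin n) : projHom σ τ n (X (Sum.inr i)) = X (Sum.inr i) := by
  simp [projHom]

theorem projHom_baseIncl (p : Poly n) :
    projHom σ τ n (baseIncl (σ ⊕ τ) n p) = baseIncl τ n p := by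
  induction p using MvPolynomial.induction_on with
  | C c => simp [baseIncl]
  | add p q hp hq => simp [hp, hq]
  | mul_X p i hp => simp [hp, baseIncl_X, projHom_X_inr]

variable [Fintype σ] [Fintype τ]

theorem pderiv_inl_inl_shearHom (c : τ → σ → Poly n) (j : σ) (g : GraphRing σ n) :
    pderiv (Sum.inl (Sum.inl j)) (shearHom c g) = shearHom c (pderiv (Sum.inl j) g) := by
  classical
  rw [shearHom, pderiv_aeval, Fintype.sum_sum_type, Finset.sum_eq_single j]
  · simp [pderiv_inl_baseIncl, pderiv_X]
  · intro k _ hk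
    simp [pderiv_inl_baseIncl, pderiv_X, hk]
  · simp

theorem pderiv_inl_inr_shearHom (c : τ → σ → Poly n) (k : τ) (g : GraphRing σ n) :
    pderiv (Sum.inl (Sum.inr k)) (shearHom c g) =
      ∑ j, baseIncl (σ ⊕ τ) n (c k j) * shearHom c (pderiv (Sum.inl j) g) := by
  classical
  rw [shearHom, pderiv_aeval, Fintype.sum_sum_type]
  simp [pderiv_inl_baseIncl, pderiv_X, Pi.single_apply]

theorem pderiv_inr_shearHom (c : τ → σ → Poly n) (i : Fin n) (g : GraphRing σ n) :
    pderiv (Sum.inr i) (shearHom c g) = shearHom c (pderiv (Sum.inr i) g) +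
      ∑ j, (∑ k, baseIncl (σ ⊕ τ) n (pderiv i (c k j)) * X (Sum.inl (Sum.inr k))) *
        shearHom c (pderiv (Sum.inl j) g) := by
  classical
  rw [shearHom, pderiv_aeval, Fintype.sum_sum_type, add_comm]
  simp [pderiv_inr_baseIncl, pderiv_X, Pi.single_apply, mul_comm]

section shear

variable {f : σ → Poly n} {h : τ → Poly n} {c : τ → σ → Poly n}

theorem shearHom_phase (hc : ∀ k, h k = ∑ j, c k j * f j) :
    shearHom c (phase f) = phase (Sum.elim f h) := by
  simp only [phase, map_sum, map_mul, shearHom_baseIncl, shearHom_X_inl, Fintype.sum_sum_type,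
    Sum.elim_inl, Sum.elim_inr, hc, mul_add, Finset.sum_add_distrib, Finset.mul_sum, Finset.sum_mul]
  congr 1
  rw [Finset.sum_comm]
  refine Finset.sum_congr rfl fun k _ => Finset.sum_congr rfl fun j _ => ?_
  rw [mul_left_comm, mul_assoc]

theorem tAct_inl_shearHom (j : σ) (g : GraphRing σ n) :
    tAct (Sum.elim f h) (Sum.inl j) (shearHom c g) = shearHom c (tAct f j g) := by
  simp [tAct_apply, pderiv_inl_inl_shearHom, shearHom_baseIncl]

theorem tAct_inr_shearHom (hc : ∀ k, h k = ∑ j, c k j * f j) (k : τ) (g : GraphRing σ n) :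
    tAct (Sum.elim f h) (Sum.inr k) (shearHom c g) =
      ∑ j, baseIncl (σ ⊕ τ) n (c k j) * shearHom c (tAct f j g) := by
  simp [tAct_apply, pderiv_inl_inr_shearHom, shearHom_baseIncl, mul_sub, Finset.sum_sub_distrib, hc,
    Finset.sum_mul, mul_assoc]

theorem shearHom_eulerAct (hc : ∀ k, h k = ∑ j, c k j * f j) (g : GraphRing σ n) :
    shearHom c (eulerAct f g) = eulerAct (Sum.elim f h) (shearHom c g) := by
  simp only [eulerAct_apply, map_neg, map_sum, map_mul, shearHom_X_inl, Fintype.sum_sum_type,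
    tAct_inl_shearHom, tAct_inr_shearHom hc, add_mul, Finset.sum_add_distrib, Finset.mul_sum,
    Finset.sum_mul]
  congr 2
  rw [Finset.sum_comm]
  refine Finset.sum_congr rfl fun k _ => Finset.sum_congr rfl fun j _ => ?_
  rw [mul_left_comm, mul_assoc]

/-- The shear depends on `x` through `c`, so it does not commute with `∂_i`. The error is a
combination of operators `z_k t_j`, which preserve `reesModule`. -/
theorem shearHom_connection (hc : ∀ k, h k = ∑ j, c k j * f j) (i : Fin n) (g : GraphRing σ n) :
    shearHom c (connection f i g) = connection (Sum.elim f h) i (shearHom c g) +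
      ∑ j, ∑ k, baseIncl (σ ⊕ τ) n (pderiv i (c k j)) *
        (X (Sum.inl (Sum.inr k)) * tAct (Sum.elim f h) (Sum.inl j) (shearHom c g)) := by
  have e : ∀ j, ∑ k, baseIncl (σ ⊕ τ) n (pderiv i (c k j)) *
      (X (Sum.inl (Sum.inr k)) * tAct (Sum.elim f h) (Sum.inl j) (shearHom c g)) =
      (∑ k, baseIncl (σ ⊕ τ) n (pderiv i (c k j)) * X (Sum.inl (Sum.inr k))) *
        (baseIncl (σ ⊕ τ) n (f j)) * shearHom c g -
      (∑ k, baseIncl (σ ⊕ τ) n (pderiv i (c k j)) * X (Sum.inl (Sum.inr k))) *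
        shearHom c (pderiv (Sum.inl j) g) := fun j => by
    simp only [← mul_assoc, ← Finset.sum_mul]
    rw [tAct_inl_shearHom, tAct_apply, map_sub, map_mul, shearHom_baseIncl]
    ring
  simp only [e, connection_apply, ← shearHom_phase hc, pderiv_inr_shearHom, map_sub, map_mul,
    pderiv_inl_phase, shearHom_baseIncl, Finset.sum_sub_distrib, add_mul, ← Finset.sum_mul]
  ring

theorem shearHom_mem_reesModule {a : Ideal (Poly n)} (hf : ∀ j, f j ∈ a)
    (hc : ∀ k, h k = ∑ j, c k j * f j) {g : GraphRing σ n} (hg : g ∈ reesModule f a) :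
    shearHom c g ∈ reesModule (Sum.elim f h) a := by
  have hfh : ∀ l, Sum.elim f h l ∈ a := by
    rintro (j | k)
    · exact hf j
    · rw [Sum.elim_inr, hc]
      exact sum_mem fun j _ => a.mul_mem_left _ (hf j)
  refine reesModule_le (S := (reesModule (Sum.elim f h) a).comap (shearHom c).toLinearMap)
    (fun m g hg => reesPiece_le_reesModule _ a m (shearHom_mem_reesPiece hg))
    (fun i g hg => ?_) hg
  change shearHom c (connection f i g) ∈ reesModule (Sum.elim f h) a
  rw [shearHom_connection hc]
  exact add_mem (connection_mem_reesModule i hg) (sum_mem fun j _ => sum_mem fun k _ =>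
    baseIncl_mul_mem_reesModule _ (X_mul_tAct_mem_reesModule hfh _ _ hg))

theorem GraphEquation.sumElim {a : Ideal (Poly n)} (hf : ∀ j, f j ∈ a)
    (hc : ∀ k, h k = ∑ j, c k j * f j) {b : Polynomial ℂ} (hb : GraphEquation f a b) :
    GraphEquation (Sum.elim f h) a b := by
  have := shearHom_mem_reesModule hf hc hb
  rw [← AlgHom.toLinearMap_apply, map_aeval_apply (shearHom c).toLinearMap _ _
    (shearHom_eulerAct hc)] at this
  simpa [GraphEquation] using this

end shear

theorem pderiv_inl_projHom (k : τ) (g : GraphRing (σ ⊕ τ) n) :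
    pderiv (Sum.inl k) (projHom σ τ n g) = projHom σ τ n (pderiv (Sum.inl (Sum.inr k)) g) := by
  classical
  rw [projHom, pderiv_aeval, Fintype.sum_sum_type, Fintype.sum_sum_type]
  simp [pderiv_X, Pi.single_apply]

theorem pderiv_inr_projHom (i : Fin n) (g : GraphRing (σ ⊕ τ) n) :
    pderiv (Sum.inr i) (projHom σ τ n g) = projHom σ τ n (pderiv (Sum.inr i) g) := by
  classical
  rw [projHom, pderiv_aeval, Fintype.sum_sum_type, Fintype.sum_sum_type]
  simp [pderiv_X, Pi.single_apply]

theorem projHom_phase (f : σ → Poly n) (h : τ → Poly n) :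
    projHom σ τ n (phase (Sum.elim f h)) = phase h := by
  simp [phase, projHom_baseIncl, projHom_X_inl_inl, projHom_X_inl_inr]

theorem projHom_connection (f : σ → Poly n) (h : τ → Poly n) (i : Fin n)
    (g : GraphRing (σ ⊕ τ) n) :
    projHom σ τ n (connection (Sum.elim f h) i g) = connection h i (projHom σ τ n g) := by
  simp [connection_apply, ← pderiv_inr_projHom, projHom_phase]

theorem projHom_eulerAct (f : σ → Poly n) (h : τ → Poly n) (g : GraphRing (σ ⊕ τ) n) :
    projHom σ τ n (eulerAct (Sum.elim f h) g) = eulerAct h (projHom σ τ n g) := by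
  simp [eulerAct_apply, tAct_apply, pderiv_inl_projHom, projHom_baseIncl, projHom_X_inl_inl,
    projHom_X_inl_inr]

theorem projHom_mem_reesPiece {a : Ideal (Poly n)} {m : ℕ} {g : GraphRing (σ ⊕ τ) n}
    (hg : g ∈ reesPiece (σ ⊕ τ) a m) : projHom σ τ n g ∈ reesPiece τ a m := by
  induction m generalizing g with
  | zero =>
    refine (Submodule.span_le
      (p := (reesPiece τ a 0).comap (projHom σ τ n).toLinearMap)).2 ?_ hg
    rintro _ ⟨p, hp, rfl⟩
    have := baseIncl_mem_reesPiece (σ := τ) hp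
    simpa [projHom_baseIncl] using this
  | succ m ih =>
    refine (Submodule.span_le
      (p := (reesPiece τ a (m + 1)).comap (projHom σ τ n).toLinearMap)).2 ?_ hg
    rintro _ ⟨p, hp, j, q, hq, rfl⟩
    change projHom σ τ n (baseIncl (σ ⊕ τ) n p * X (Sum.inl j) * q) ∈ reesPiece τ a (m + 1)
    rw [map_mul, map_mul, projHom_baseIncl]
    rcases j with j | k
    · simp [projHom_X_inl_inl]
    · have := mul_mem_reesPiece hp k (ih hq)
      rwa [projHom_X_inl_inr]

theorem GraphEquation.of_sumElim {f : σ → Poly n} {h : τ → Poly n} {a : Ideal (Poly n)}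
    {b : Polynomial ℂ} (hb : GraphEquation (Sum.elim f h) a b) : GraphEquation h a b := by
  have key : reesModule (Sum.elim f h) a ≤ (reesModule h a).comap (projHom σ τ n).toLinearMap := by
    refine reesModule_le
      (fun m g hg => reesPiece_le_reesModule _ a m (projHom_mem_reesPiece hg)) fun i g hg => ?_
    change projHom σ τ n (connection (Sum.elim f h) i g) ∈ reesModule h a
    rw [projHom_connection]
    exact connection_mem_reesModule i hg
  have := key hb
  rw [Submodule.mem_comap, map_aeval_apply (projHom σ τ n).toLinearMap _ _
    (projHom_eulerAct f h)] at this
  simpa [GraphEquation] using this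

/-- Passes through the concatenated system: the shear adjoins `h` as redundant generators, and
setting the old variables to zero then discards `f`. -/
theorem GraphEquation.of_span_eq {f : σ → Poly n} {h : τ → Poly n} {a : Ideal (Poly n)}
    (hf : Ideal.span (Set.range f) = a) (hh : Ideal.span (Set.range h) = a) {b : Polynomial ℂ}
    (hb : GraphEquation f a b) : GraphEquation h a b := by
  have h1 : ∀ k, ∃ c : σ → Poly n, h k = ∑ j, c j * f j := fun k => by
    have : h k ∈ Ideal.span (Set.range f) := by
      rw [hf, ← hh]
      exact Ideal.subset_span ⟨k, rfl⟩
    obtain ⟨c, hc⟩ := (Ideal.mem_span_range_iff_exists_fun).1 this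
    exact ⟨c, hc.symm⟩
  choose c hc using h1
  exact (hb.sumElim (fun j => hf ▸ Ideal.subset_span ⟨j, rfl⟩) hc).of_sumElim

end BernsteinSato
end

noncomputable section
namespace BernsteinSato
open MvPolynomial
variable {n r : ℕ}

/-! ### Embedding into the module `ℂ[x][1/(f₁⋯f_r)][s] ∏ f_j^{s_j}` -/

theorem coeffPderiv_mul (f : Fin r → Poly n) (i : Fin n) (g h : PowModule f) :
    coeffPderiv f i (g * h) = coeffPderiv f i g * h + g * coeffPderiv f i h := by
  apply MvPolynomial.ext
  intro μ
  simp only [coeff_add, coeff_coeffPderiv, coeff_mul, map_sum, Derivation.leibniz, smul_eq_mul,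
    ← Finset.sum_add_distrib]
  exact Finset.sum_congr rfl fun x _ => by ring

theorem coeffPderiv_C (f : Fin r → Poly n) (i : Fin n) (c : Loc f) :
    coeffPderiv f i (C c) = C (locPderiv f i c) := by
  apply MvPolynomial.ext
  intro μ
  rw [coeff_coeffPderiv, coeff_C, coeff_C]
  split_ifs <;> simp

theorem coeffPderiv_X (f : Fin r → Poly n) (i : Fin n) (j : Fin r) :
    coeffPderiv f i (X j) = 0 := by
  apply MvPolynomial.ext
  intro μ
  rw [coeff_coeffPderiv, coeff_X, coeff_zero]
  split_ifs <;> simp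

theorem locPderiv_genInv (f : Fin r → Poly n) (i : Fin n) (j : Fin r) :
    locPderiv f i (genInv f j) = -(locPderiv f i (gen f j) * genInv f j * genInv f j) := by
  have h := congrArg (locPderiv f i) (gen_mul_genInv f j)
  rw [Derivation.leibniz, Derivation.map_one_eq_zero, smul_eq_mul, smul_eq_mul] at h
  linear_combination (genInv f j) * h - locPderiv f i (genInv f j) * gen_mul_genInv f j

/-- The substitution `s_j ↦ s_j + 1`. -/
def shiftUp (f : Fin r → Poly n) (j : Fin r) : PowModule f →ₐ[Loc f] PowModule f :=
  aeval fun k => X k + Pi.single (M := fun _ => PowModule f) j 1 k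

/-- The substitution `s_j ↦ s_j - 1`. -/
def shiftDown (f : Fin r → Poly n) (j : Fin r) : PowModule f →ₐ[Loc f] PowModule f :=
  aeval fun k => X k - Pi.single (M := fun _ => PowModule f) j 1 k

theorem shiftUp_X (f : Fin r → Poly n) (j k : Fin r) :
    shiftUp f j (X k) = X k + if k = j then 1 else 0 := by
  simp [shiftUp, Pi.single_apply]

theorem shiftDown_X (f : Fin r → Poly n) (j k : Fin r) :
    shiftDown f j (X k) = X k - if k = j then 1 else 0 := by
  simp [shiftDown, Pi.single_apply]

theorem shiftUp_C (f : Fin r → Poly n) (j : Fin r) (c : Loc f) : shiftUp f j (C c) = C c :=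
  (shiftUp f j).commutes c

theorem shiftDown_C (f : Fin r → Poly n) (j : Fin r) (c : Loc f) : shiftDown f j (C c) = C c :=
  (shiftDown f j).commutes c

theorem shiftDown_comm (f : Fin r → Poly n) (j k : Fin r) (g : PowModule f) :
    shiftDown f j (shiftDown f k g) = shiftDown f k (shiftDown f j g) := by
  have : (shiftDown f j).comp (shiftDown f k) = (shiftDown f k).comp (shiftDown f j) := by
    apply MvPolynomial.algHom_ext
    intro l
    simp only [AlgHom.comp_apply, shiftDown_X, map_sub]
    split_ifs <;> simp
  exact congrArg (fun φ : PowModule f →ₐ[Loc f] PowModule f => φ g) this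

theorem shiftUp_shiftDown_comm (f : Fin r → Poly n) (j k : Fin r) (g : PowModule f) :
    shiftUp f j (shiftDown f k g) = shiftDown f k (shiftUp f j g) := by
  have : (shiftUp f j).comp (shiftDown f k) = (shiftDown f k).comp (shiftUp f j) := by
    apply MvPolynomial.algHom_ext
    intro l
    simp only [AlgHom.comp_apply, shiftDown_X, shiftUp_X, map_sub, map_add]
    split_ifs <;> simp
  exact congrArg (fun φ : PowModule f →ₐ[Loc f] PowModule f => φ g) this

theorem shiftUp_shiftDown (f : Fin r → Poly n) (j : Fin r) (g : PowModule f) :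
    shiftUp f j (shiftDown f j g) = g := by
  have : (shiftUp f j).comp (shiftDown f j) = AlgHom.id _ _ := by
    apply MvPolynomial.algHom_ext
    intro l
    simp only [AlgHom.comp_apply, shiftDown_X, shiftUp_X, map_sub, AlgHom.id_apply]
    split_ifs <;> simp
  exact congrArg (fun φ : PowModule f →ₐ[Loc f] PowModule f => φ g) this

theorem coeffPderiv_shiftDown (f : Fin r → Poly n) (i : Fin n) (j : Fin r) (g : PowModule f) :
    coeffPderiv f i (shiftDown f j g) = shiftDown f j (coeffPderiv f i g) := by
  induction g using MvPolynomial.induction_on with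
  | C c => simp only [shiftDown_C, coeffPderiv_C]
  | add p q hp hq => simp only [map_add, hp, hq]
  | mul_X p k hp =>
    rw [map_mul, coeffPderiv_mul, coeffPderiv_mul, hp, coeffPderiv_X, map_add, map_mul, map_mul,
      map_zero, shiftDown_X, map_sub, coeffPderiv_X]
    have : coeffPderiv f i (if k = j then 1 else 0) = 0 := by
      split_ifs
      · rw [← C_1, coeffPderiv_C]
        simp
      · simp
    rw [this, sub_zero]

theorem tOp_apply (f : Fin r → Poly n) (j : Fin r) (g : PowModule f) :
    tOp f j g = C (gen f j) * shiftUp f j g := rfl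

theorem mulOp_apply (f : Fin r → Poly n) (p : Poly n) (g : PowModule f) :
    mulOp f p g = C (algebraMap (Poly n) (Loc f) p) * g := rfl

/-- The logarithmic derivative `∑ s_j ∂ᵢf_j / f_j` of `∏ f_j^{s_j}`. -/
def logDeriv (f : Fin r → Poly n) (i : Fin n) : PowModule f :=
  ∑ j, X j * C (locPderiv f i (gen f j) * genInv f j)

theorem derivOp_apply (f : Fin r → Poly n) (i : Fin n) (g : PowModule f) :
    derivOp f i g = coeffPderiv f i g + logDeriv f i * g := rfl

theorem shiftDown_logDeriv (f : Fin r → Poly n) (i : Fin n) (k : Fin r) :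
    shiftDown f k (logDeriv f i) =
      logDeriv f i - C (locPderiv f i (gen f k) * genInv f k) := by
  simp only [logDeriv, map_sum, map_mul (shiftDown f k), shiftDown_X, shiftDown_C, sub_mul,
    Finset.sum_sub_distrib, ite_mul, one_mul, zero_mul]
  simp

/-- The operator `-s_j t_j⁻¹`, which corresponds to multiplication by `y_j`. -/
def yOp (f : Fin r → Poly n) (j : Fin r) : Module.End ℂ (PowModule f) := -(sOp f j * tInvOp f j)

theorem yOp_apply (f : Fin r → Poly n) (j : Fin r) (g : PowModule f) :
    yOp f j g = -(X j * (C (genInv f j) * shiftDown f j g)) := rfl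

theorem yOp_C_mul (f : Fin r → Poly n) (j : Fin r) (c : Loc f) (g : PowModule f) :
    yOp f j (C c * g) = C c * yOp f j g := by
  rw [yOp_apply, yOp_apply, map_mul, shiftDown_C]
  ring

theorem yOp_comm (f : Fin r → Poly n) (j k : Fin r) (g : PowModule f) :
    yOp f j (yOp f k g) = yOp f k (yOp f j g) := by
  simp only [yOp_apply, map_neg, map_mul, shiftDown_C, shiftDown_X, shiftDown_comm f j k]
  by_cases h : j = k
  · subst h
    ring
  · simp only [h, Ne.symm h, if_false]
    ring

/-- The Weyl algebra relation `[t_j, y_k] = -δ_{jk}`, which lets `t_j` be read as `f_j - ∂/∂y_j` on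
`ℂ[x][y]`. -/
theorem tOp_yOp (f : Fin r → Poly n) (j k : Fin r) (g : PowModule f) :
    tOp f j (yOp f k g) = yOp f k (tOp f j g) - if j = k then g else 0 := by
  simp only [yOp_apply, tOp_apply, map_neg, map_mul, shiftUp_C, shiftDown_C, shiftUp_X,
    ← shiftUp_shiftDown_comm f j k]
  by_cases h : j = k
  · subst h
    have : (C (gen f j) * C (genInv f j) : PowModule f) = 1 := by
      rw [← C_mul, gen_mul_genInv, C_1]
    simp only [if_true, shiftUp_shiftDown]
    linear_combination -g * this
  · simp only [h, Ne.symm h, if_false]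
    ring

/-- The derivative of the factor `1/f_k` cancels the change of the logarithmic derivative under `s_k
↦ s_k - 1`. -/
theorem derivOp_yOp (f : Fin r → Poly n) (i : Fin n) (k : Fin r) (g : PowModule f) :
    derivOp f i (yOp f k g) = yOp f k (derivOp f i g) := by
  simp only [yOp_apply, derivOp_apply, map_neg, coeffPderiv_mul, coeffPderiv_X, coeffPderiv_C,
    coeffPderiv_shiftDown, locPderiv_genInv, map_add, map_mul, shiftDown_logDeriv]
  ring

theorem derivOp_C_mul (f : Fin r → Poly n) (i : Fin n) (c : Loc f) (g : PowModule f) :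
    derivOp f i (C c * g) = C (locPderiv f i c) * g + C c * derivOp f i g := by
  simp only [derivOp_apply, coeffPderiv_mul, coeffPderiv_C]
  ring

/-- The generators of the image of `ℂ[x][y]` in the endomorphisms of `PowModule f`. -/
def graphGen (f : Fin r → Poly n) : Fin r ⊕ Fin n → Module.End ℂ (PowModule f) :=
  Sum.elim (yOp f) fun i => mulOp f (X i)

theorem graphGen_comm (f : Fin r → Poly n) :
    ∀ A ∈ Set.range (graphGen f), ∀ B ∈ Set.range (graphGen f), A * B = B * A := by
  rintro _ ⟨j | i, rfl⟩ _ ⟨k | l, rfl⟩ <;> refine LinearMap.ext fun g => ?_ <;>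
    simp only [graphGen, Sum.elim_inl, Sum.elim_inr, Module.End.mul_apply, mulOp_apply, yOp_C_mul]
  · exact yOp_comm f j k g
  · ring

open scoped IsMulCommutative in
/-- The action of `ℂ[x][y]` on `PowModule f`. -/
def graphAction (f : Fin r → Poly n) : GraphRing (Fin r) n →ₐ[ℂ] Module.End ℂ (PowModule f) :=
  -- Polynomial evaluation needs a commutative target; the subalgebra generated by the commuting
  -- `y_j` and `x_i` is one, while `Module.End` is not.
  haveI := Algebra.isMulCommutative_adjoin ℂ (graphGen_comm f)
  (Algebra.adjoin ℂ (Set.range (graphGen f))).val.comp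
    (aeval fun l => (⟨graphGen f l, Algebra.subset_adjoin ⟨l, rfl⟩⟩ :
      Algebra.adjoin ℂ (Set.range (graphGen f))))

theorem graphAction_X (f : Fin r → Poly n) (l : Fin r ⊕ Fin n) :
    graphAction f (X l) = graphGen f l := by
  simp [graphAction]

/-- The embedding of `ℂ[x][y] e^{-F}` into `PowModule f`. -/
def graphEmb (f : Fin r → Poly n) : GraphRing (Fin r) n →ₗ[ℂ] PowModule f where
  toFun g := graphAction f g 1
  map_add' g h := by simp
  map_smul' c g := by simp

theorem graphEmb_one (f : Fin r → Poly n) : graphEmb f 1 = 1 := by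
  change graphAction f 1 1 = 1
  simp

theorem graphEmb_X_inl_mul (f : Fin r → Poly n) (j : Fin r) (g : GraphRing (Fin r) n) :
    graphEmb f (X (Sum.inl j) * g) = yOp f j (graphEmb f g) := by
  change graphAction f (X (Sum.inl j) * g) 1 = yOp f j (graphAction f g 1)
  rw [map_mul, graphAction_X]
  rfl

theorem graphEmb_X_inr_mul (f : Fin r → Poly n) (i : Fin n) (g : GraphRing (Fin r) n) :
    graphEmb f (X (Sum.inr i) * g) = mulOp f (X i) (graphEmb f g) := by
  change graphAction f (X (Sum.inr i) * g) 1 = mulOp f (X i) (graphAction f g 1)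
  rw [map_mul, graphAction_X]
  rfl

theorem graphEmb_baseIncl_mul (f : Fin r → Poly n) (p : Poly n) (g : GraphRing (Fin r) n) :
    graphEmb f (baseIncl _ n p * g) = mulOp f p (graphEmb f g) := by
  induction p using MvPolynomial.induction_on generalizing g with
  | C c =>
    have h1 : baseIncl (Fin r) n (C c) * g = c • g := by simp [baseIncl, smul_eq_C_mul]
    have h2 : C (algebraMap (Poly n) (Loc f) (C c)) * graphEmb f g = c • graphEmb f g := by
      rw [Algebra.smul_def]
      rfl
    rw [h1, map_smul, mulOp_apply, h2]
  | add p q hp hq =>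
    rw [map_add, add_mul, map_add, hp, hq]
    simp only [mulOp_apply, map_add, add_mul]
  | mul_X p i hp =>
    rw [map_mul (baseIncl _ n), mul_assoc, hp, baseIncl_X, graphEmb_X_inr_mul]
    simp only [mulOp_apply, map_mul, mul_assoc]

theorem graphEmb_baseIncl (f : Fin r → Poly n) (p : Poly n) :
    graphEmb f (baseIncl _ n p) = C (algebraMap (Poly n) (Loc f) p) := by
  rw [← mul_one (baseIncl _ n p), graphEmb_baseIncl_mul, graphEmb_one, mulOp_apply, mul_one]

theorem tOp_C_mul (f : Fin r → Poly n) (j : Fin r) (c : Loc f) (g : PowModule f) :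
    tOp f j (C c * g) = C c * tOp f j g := by
  rw [tOp_apply, tOp_apply, map_mul, shiftUp_C]
  ring

/-- Induction on elements of `ℂ[x][y]` by multiplication by variables. -/
theorem graphRing_induction {σ : Type*} {P : GraphRing σ n → Prop} (h1 : P 1)
    (hadd : ∀ g h, P g → P h → P (g + h)) (hsmul : ∀ (c : ℂ) g, P g → P (c • g))
    (hy : ∀ j g, P g → P (X (Sum.inl j) * g)) (hx : ∀ i g, P g → P (X (Sum.inr i) * g))
    (g : GraphRing σ n) : P g := by
  induction g using MvPolynomial.induction_on with
  | C c => simpa [smul_eq_C_mul] using hsmul c 1 h1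
  | add p q hp hq => exact hadd p q hp hq
  | mul_X p l hp =>
    rw [mul_comm]
    rcases l with j | i
    · exact hy j p hp
    · exact hx i p hp

/-- Both sides have the same commutation relations with all the variables, so it suffices that they
agree on `1`, where both give `f_j`. -/
theorem tOp_graphEmb (f : Fin r → Poly n) (j : Fin r) (g : GraphRing (Fin r) n) :
    tOp f j (graphEmb f g) = graphEmb f (tAct f j g) := by
  classical
  induction g using graphRing_induction with
  | h1 =>
    rw [tAct_apply, Derivation.map_one_eq_zero, sub_zero, graphEmb_baseIncl_mul, graphEmb_one,
      tOp_apply, mulOp_apply, map_one]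
    rfl
  | hadd g h hg hh => simp only [map_add, hg, hh]
  | hsmul c g hg => simp only [map_smul, hg]
  | hy k g hg =>
    have e : tAct f j (X (Sum.inl k) * g) =
        X (Sum.inl k) * tAct f j g - if j = k then g else 0 := by
      rw [tAct_apply, tAct_apply, Derivation.leibniz, pderiv_X, smul_eq_mul, smul_eq_mul]
      by_cases h : j = k
      · subst h
        simp
        ring
      · simp [h, Ne.symm h]
        ring
    rw [graphEmb_X_inl_mul, tOp_yOp, hg, e, map_sub, graphEmb_X_inl_mul]
    congr 1
    split_ifs <;> simp
  | hx i g hg =>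
    have e : tAct f j (X (Sum.inr i) * g) = X (Sum.inr i) * tAct f j g := by
      rw [tAct_apply, tAct_apply, Derivation.leibniz, pderiv_X_of_ne (by simp), smul_eq_mul,
        smul_zero]
      ring
    rw [graphEmb_X_inr_mul, mulOp_apply, tOp_C_mul, hg, e, graphEmb_X_inr_mul]
    rfl

/-- The same principle: on `1` the term `-∑ (∂_i f_j) y_j` becomes the logarithmic derivative of `∏
f_j^{s_j}`. -/
theorem derivOp_graphEmb (f : Fin r → Poly n) (i : Fin n) (g : GraphRing (Fin r) n) :
    derivOp f i (graphEmb f g) = graphEmb f (connection f i g) := by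
  induction g using graphRing_induction with
  | h1 =>
    rw [graphEmb_one, connection_apply, Derivation.map_one_eq_zero, zero_sub, map_neg, mul_one,
      pderiv_inr_phase, map_sum, derivOp_apply, ← C_1, coeffPderiv_C, Derivation.map_one_eq_zero,
      C_0, zero_add, C_1, mul_one, logDeriv, ← Finset.sum_neg_distrib]
    refine Finset.sum_congr rfl fun j _ => ?_
    rw [mul_comm (baseIncl _ n _), graphEmb_X_inl_mul, graphEmb_baseIncl, ← mul_one (C (algebraMap _ _ _)), yOp_C_mul, yOp_apply, map_one, gen, locPderiv_algebraMap, C_mul]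
    ring
  | hadd g h hg hh => simp only [map_add, hg, hh]
  | hsmul c g hg => simp only [map_smul, hg]
  | hy k g hg =>
    rw [graphEmb_X_inl_mul, derivOp_yOp, hg, connection_X_mul, graphEmb_X_inl_mul]
  | hx k g hg =>
    rw [← baseIncl_X, connection_baseIncl_mul, graphEmb_baseIncl_mul, mulOp_apply, derivOp_C_mul,
      hg, map_add, graphEmb_baseIncl_mul, graphEmb_baseIncl_mul, locPderiv_algebraMap]
    rfl

theorem sOp_eq (f : Fin r → Poly n) (j : Fin r) (g : PowModule f) :
    X j * g = -yOp f j (tOp f j g) := by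
  rw [yOp_apply, tOp_apply, map_mul, shiftDown_C, ← shiftUp_shiftDown_comm, shiftUp_shiftDown]
  have : (C (gen f j) * C (genInv f j) : PowModule f) = 1 := by
    rw [← C_mul, gen_mul_genInv, C_1]
  linear_combination (-X j * g) * this

theorem graphEmb_eulerAct (f : Fin r → Poly n) (g : GraphRing (Fin r) n) :
    graphEmb f (eulerAct f g) = (∑ j, X j) * graphEmb f g := by
  simp only [eulerAct_apply, map_neg, map_sum, graphEmb_X_inl_mul, ← tOp_graphEmb,
    Finset.sum_mul, sOp_eq f _ (graphEmb f g), Finset.sum_neg_distrib]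

/-- An element of `ℂ[x][y]` whose `y`-derivatives vanish lies in `ℂ[x]`. -/
theorem exists_baseIncl_eq {σ : Type*} {g : GraphRing σ n}
    (hg : ∀ j, pderiv (Sum.inl j) g = 0) : ∃ p, baseIncl σ n p = g := by
  refine exists_rename_eq_of_vars_subset_range g Sum.inr Sum.inr_injective fun l hl => ?_
  rcases l with j | i
  · exfalso
    obtain ⟨μ, hμ, hl⟩ := (mem_vars_iff_mem_support _).1 hl
    have h := coeff_pderiv (i := Sum.inl j) g (μ - Finsupp.single (Sum.inl j) 1)
    rw [hg, coeff_zero, tsub_add_cancel_of_le] at h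
    · rcases mul_eq_zero.1 h.symm with h | h
      · exact mem_support_iff.1 hμ h
      · exact Nat.cast_add_one_ne_zero _ h
    · rw [Finsupp.single_le_iff, Nat.one_le_iff_ne_zero]
      exact Finsupp.mem_support_iff.1 hl
  · exact ⟨i, rfl⟩

/-- The kernel is stable under `∂/∂y_j = f_j - t_j`. By induction on the degree, all `y`-derivatives
of a kernel element vanish, so it lies in `ℂ[x]`, which embeds in the localization because the `f_j`
are nonzero. -/
theorem graphEmb_injective (f : Fin r → Poly n) (hf : ∀ j, f j ≠ 0) :
    Function.Injective (graphEmb f) := by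
  rw [← LinearMap.ker_eq_bot, Submodule.eq_bot_iff]
  have hp : ∏ j, f j ≠ 0 := Finset.prod_ne_zero_iff.2 fun j _ => hf j
  have hinj : Function.Injective (algebraMap (Poly n) (Loc f)) :=
    IsLocalization.injective _ (powers_le_nonZeroDivisors_of_noZeroDivisors hp)
  have key : ∀ d : ℕ, ∀ g : GraphRing (Fin r) n, g.totalDegree ≤ d → graphEmb f g = 0 → g = 0 := by
    intro d
    induction d with
    | zero =>
      intro g hg h0
      rw [totalDegree_eq_zero_iff_eq_C.1 (Nat.le_zero.1 hg)] at h0 ⊢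
      have h1 : (C (coeff 0 g) : GraphRing (Fin r) n) = baseIncl _ n (C (coeff 0 g)) := by
        simp [baseIncl]
      rw [h1, graphEmb_baseIncl, C_eq_zero] at h0
      rw [h1, hinj (h0.trans (map_zero _).symm), map_zero]
    | succ d ih =>
      intro g hg h0
      have h1 : ∀ j, pderiv (Sum.inl j) g = 0 := fun j => by
        refine ih _ ?_ ?_
        · refine Finset.sup_le fun μ hμ => ?_
          rw [mem_support_iff, coeff_pderiv] at hμ
          have h2 := (le_totalDegree (mem_support_iff.2 (left_ne_zero_of_mul hμ))).trans hg
          rw [Finsupp.sum_add_index' (fun _ => rfl) fun _ _ _ => rfl,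
            Finsupp.sum_single_index rfl] at h2
          omega
        · have e : pderiv (Sum.inl j) g = baseIncl _ n (f j) * g - tAct f j g := by
            rw [tAct_apply]
            ring
          rw [e, map_sub, graphEmb_baseIncl_mul, ← tOp_graphEmb, h0]
          simp
      obtain ⟨p, rfl⟩ := exists_baseIncl_eq h1
      rw [graphEmb_baseIncl, C_eq_zero] at h0
      rw [hinj (h0.trans (map_zero _).symm), map_zero]
  exact fun g hg => key _ g le_rfl hg

end BernsteinSato
end

noncomputable section
namespace BernsteinSato
open MvPolynomial
variable {n r : ℕ}

/-! ### The functional equation depends only on the ideal -/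

/-- The set of all `∑ₖ Pₖ tₖ ∏ f_j^{s_j}` with `Pₖ` in the operator ring. -/
def targetModule (f : Fin r → Poly n) : Submodule ℂ (PowModule f) where
  carrier := {u | ∃ P : Fin r → Module.End ℂ (PowModule f), (∀ k, P k ∈ operatorRing f) ∧
    u = ∑ k, P k (tOp f k 1)}
  add_mem' := by
    rintro _ _ ⟨P, hP, rfl⟩ ⟨P', hP', rfl⟩
    exact ⟨P + P', fun k => add_mem (hP k) (hP' k), by simp [Finset.sum_add_distrib]⟩
  zero_mem' := ⟨0, fun _ => zero_mem _, by simp⟩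
  smul_mem' := by
    rintro c _ ⟨P, hP, rfl⟩
    exact ⟨c • P, fun k => Subalgebra.smul_mem _ (hP k) c, by simp [Finset.smul_sum]⟩

theorem functionalEquation_iff_mem_targetModule (f : Fin r → Poly n) (b : Polynomial ℂ) :
    FunctionalEquation f b ↔ Polynomial.aeval (∑ j, X j : PowModule f) b ∈ targetModule f :=
  Iff.rfl

theorem operatorRing_apply_mem_targetModule {f : Fin r → Poly n} {A : Module.End ℂ (PowModule f)}
    (hA : A ∈ operatorRing f) {u : PowModule f} (hu : u ∈ targetModule f) :
    A u ∈ targetModule f := by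
  obtain ⟨P, hP, rfl⟩ := hu
  exact ⟨fun k => A * P k, fun k => mul_mem hA (hP k), by simp [map_sum]⟩

theorem mulOp_mem_operatorRing (f : Fin r → Poly n) (p : Poly n) : mulOp f p ∈ operatorRing f :=
  Algebra.subset_adjoin (Or.inl (Or.inl ⟨p, rfl⟩))

theorem derivOp_mem_operatorRing (f : Fin r → Poly n) (i : Fin n) :
    derivOp f i ∈ operatorRing f :=
  Algebra.subset_adjoin (Or.inl (Or.inr ⟨i, rfl⟩))

theorem yOp_mul_tOp_mem_operatorRing (f : Fin r → Poly n) (i j : Fin r) :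
    yOp f i * tOp f j ∈ operatorRing f := by
  have e : yOp f i * tOp f j =
      (-1 : ℂ) • (sOp f i * tInvOp f i * tOp f j) := LinearMap.ext fun _ => by simp [yOp]
  rw [e]
  exact Subalgebra.smul_mem (operatorRing f) (Algebra.subset_adjoin (Or.inr ⟨(i, j), rfl⟩)) _

theorem tOp_one (f : Fin r → Poly n) (k : Fin r) :
    tOp f k 1 = graphEmb f (baseIncl _ n (f k)) := by
  rw [tOp_apply, map_one, mul_one, graphEmb_baseIncl]
  rfl

theorem tOp_one_mem_targetModule (f : Fin r → Poly n) (k : Fin r) :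
    tOp f k 1 ∈ targetModule f := by
  classical
  refine ⟨Pi.single k 1, fun l => ?_, ?_⟩
  · by_cases h : l = k
    · subst h
      simp
    · simp [h]
  · rw [Finset.sum_eq_single k]
    · simp
    · intro l _ hl
      simp [hl]
    · simp

/-- For `≤`, write `f_l y_j h = y_j t_l h + y_j ∂h/∂y_l`: the first term is an operator of the ring
applied to `h`, the second stays in the piece of `h`, so induction on the degree applies. For `≥`,
the left side contains each `t_k · 1 = f_k` and is stable under the generators of the operator ring.
-/
theorem map_graphEmb_reesModule (f : Fin r → Poly n) :
    (reesModule f (Ideal.span (Set.range f))).map (graphEmb f) = targetModule f := by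
  apply le_antisymm
  · have hbase : ∀ p ∈ Ideal.span (Set.range f), ∀ g : GraphRing (Fin r) n,
        (∀ l, graphEmb f (baseIncl _ n (f l) * g) ∈ targetModule f) →
        graphEmb f (baseIncl _ n p * g) ∈ targetModule f := by
      intro p hp g hg
      obtain ⟨c, rfl⟩ := Ideal.mem_span_range_iff_exists_fun.1 hp
      rw [map_sum, Finset.sum_mul, map_sum]
      refine sum_mem fun l _ => ?_
      rw [map_mul (baseIncl _ n), mul_assoc, graphEmb_baseIncl_mul]
      exact operatorRing_apply_mem_targetModule (mulOp_mem_operatorRing f _) (hg l)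
    rw [Submodule.map_le_iff_le_comap]
    refine reesModule_le (fun m => ?_) (fun i g hg => ?_)
    · induction m with
      | zero =>
        refine Submodule.span_le.2 ?_
        rintro _ ⟨p, hp, rfl⟩
        change graphEmb f (baseIncl _ n p) ∈ targetModule f
        rw [← mul_one (baseIncl _ n p)]
        refine hbase p hp 1 fun l => ?_
        rw [mul_one, ← tOp_one]
        exact tOp_one_mem_targetModule f l
      | succ m ih =>
        refine Submodule.span_le.2 ?_
        rintro _ ⟨p, hp, j, h, hh, rfl⟩
        change graphEmb f (baseIncl _ n p * X (Sum.inl j) * h) ∈ targetModule f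
        rw [mul_assoc]
        refine hbase p hp _ fun l => ?_
        have e : baseIncl (Fin r) n (f l) * (X (Sum.inl j) * h) =
            X (Sum.inl j) * tAct f l h + X (Sum.inl j) * pderiv (Sum.inl l) h := by
          rw [tAct_apply]
          ring
        rw [e, map_add, graphEmb_X_inl_mul, ← tOp_graphEmb]
        exact add_mem (operatorRing_apply_mem_targetModule (yOp_mul_tOp_mem_operatorRing f j l)
          (ih hh)) (ih (X_mul_pderiv_mem_reesPiece j l hh))
    · change graphEmb f (connection f i g) ∈ targetModule f
      rw [← derivOp_graphEmb]
      exact operatorRing_apply_mem_targetModule (derivOp_mem_operatorRing f i) hg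
  · rintro _ ⟨P, hP, rfl⟩
    refine sum_mem fun k _ => ?_
    have hstable : ∀ A ∈ operatorRing f,
        ∀ u ∈ (reesModule f (Ideal.span (Set.range f))).map (graphEmb f),
        A u ∈ (reesModule f (Ideal.span (Set.range f))).map (graphEmb f) := by
      intro A hA
      induction hA using Algebra.adjoin_induction with
      | mem A hA =>
        rintro _ ⟨g, hg, rfl⟩
        rcases hA with (⟨p, rfl⟩ | ⟨i, rfl⟩) | ⟨⟨i, j⟩, rfl⟩
        · rw [← graphEmb_baseIncl_mul]
          exact ⟨_, baseIncl_mul_mem_reesModule p hg, rfl⟩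
        · rw [derivOp_graphEmb]
          exact ⟨_, connection_mem_reesModule i hg, rfl⟩
        · have e : (sOp f i * tInvOp f i * tOp f j) (graphEmb f g) =
              -yOp f i (tOp f j (graphEmb f g)) := by
            simp [yOp]
          change (sOp f i * tInvOp f i * tOp f j) (graphEmb f g) ∈ _
          rw [e, tOp_graphEmb, ← graphEmb_X_inl_mul]
          exact neg_mem (Submodule.mem_map_of_mem (X_mul_tAct_mem_reesModule
            (fun l => Ideal.subset_span (Set.mem_range_self l)) i j hg))
      | algebraMap c =>
        intro u hu
        exact Submodule.smul_mem _ c hu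
      | add A B _ _ hA hB =>
        intro u hu
        exact add_mem (hA u hu) (hB u hu)
      | mul A B _ _ hA hB =>
        intro u hu
        exact hA _ (hB u hu)
    refine hstable _ (hP k) _ ?_
    rw [tOp_one]
    exact ⟨_, reesPiece_le_reesModule f _ 0
      (baseIncl_mem_reesPiece (Ideal.subset_span ⟨k, rfl⟩)), rfl⟩

theorem functionalEquation_iff_graphEquation {f : Fin r → Poly n} (hf0 : ∀ j, f j ≠ 0)
    {a : Ideal (Poly n)} (hf : Ideal.span (Set.range f) = a) (b : Polynomial ℂ) :
    FunctionalEquation f b ↔ GraphEquation f a b := by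
  subst hf
  have e : graphEmb f (Polynomial.aeval (eulerAct f) b 1) =
      Polynomial.aeval (∑ j, X j : PowModule f) b := by
    rw [map_aeval_apply (graphEmb f) (eulerAct f) (LinearMap.mulLeft ℂ (∑ j, X j))
      (graphEmb_eulerAct f), graphEmb_one]
    have := Polynomial.aeval_algHom_apply (Algebra.lmul ℂ (PowModule f)) (∑ j, X j) b
    change (Polynomial.aeval (Algebra.lmul ℂ (PowModule f) (∑ j, X j)) b) 1 = _
    rw [this]
    simp
  rw [functionalEquation_iff_mem_targetModule, ← map_graphEmb_reesModule, ← e, GraphEquation]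
  exact (graphEmb_injective f hf0).mem_set_image

/-- The functional equation depends only on the ideal generated by `f₁,…,f_r`. -/
theorem functionalEquation_congr {r' : ℕ} {f : Fin r → Poly n} {h : Fin r' → Poly n}
    (hf0 : ∀ j, f j ≠ 0) (hh0 : ∀ j, h j ≠ 0)
    (hfh : Ideal.span (Set.range f) = Ideal.span (Set.range h)) (b : Polynomial ℂ) :
    FunctionalEquation f b ↔ FunctionalEquation h b := by
  rw [functionalEquation_iff_graphEquation hf0 hfh, functionalEquation_iff_graphEquation hh0 rfl]
  exact ⟨fun hb => hb.of_span_eq hfh rfl, fun hb => hb.of_span_eq rfl hfh⟩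

end BernsteinSato
end

noncomputable section
namespace BernsteinSato
open MvPolynomial
variable {n : ℕ} {σ : Type*}

/-! ### Monomial generators -/

/-- The monomials `x^{A_k}`. -/
def mono (A : σ → Fin n →₀ ℕ) (k : σ) : Poly n := monomial (A k) 1

/-- The exponent `∑ ν_k A_k`. -/
def combo (A : σ → Fin n →₀ ℕ) : (σ →₀ ℕ) →ₗ[ℕ] (Fin n →₀ ℕ) := Finsupp.linearCombination ℕ A

theorem combo_single (A : σ → Fin n →₀ ℕ) (k : σ) : combo A (Finsupp.single k 1) = A k := by
  simp [combo]

theorem combo_apply [Fintype σ] (A : σ → Fin n →₀ ℕ) (ν : σ →₀ ℕ) (i : Fin n) :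
    combo A ν i = ∑ k, ν k * A k i := by
  rw [combo, Finsupp.linearCombination_apply, Finsupp.sum_fintype _ _ (by simp)]
  simp [Finsupp.finsetSum_apply]

/-- The linear form `ℓ_i(s) = ∑ₖ A_{k,i} s_k`. -/
def ellPoly [Fintype σ] (A : σ → Fin n →₀ ℕ) (i : Fin n) : MvPolynomial σ ℂ :=
  ∑ k, C (A k i : ℂ) * X k

/-- The polynomial `∏ᵢ ∏_{j < β_i} (ℓ_i(s) + j + 1)`. -/
def risePoly [Fintype σ] (A : σ → Fin n →₀ ℕ) (β : Fin n →₀ ℕ) : MvPolynomial σ ℂ :=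
  ∏ i, ∏ j ∈ Finset.range (β i), (ellPoly A i + C (j + 1 : ℂ))

/-- The polynomial `∏ₖ ∏_{j < ν_k} (j - s_k)`. -/
def fallPoly [Fintype σ] (ν : σ →₀ ℕ) : MvPolynomial σ ℂ :=
  ∏ k, ∏ j ∈ Finset.range (ν k), (C (j : ℂ) - X k)

/-- `x^{β + ∑ ν_k A_k}` lies in the power `|ν| + 1` of the ideal generated by the `x^{A_k}`. -/
def IsAdmissible (A : σ → Fin n →₀ ℕ) (ν : σ →₀ ℕ) (β : Fin n →₀ ℕ) : Prop :=
  ∃ μ : σ →₀ ℕ, μ.degree = ν.degree + 1 ∧ combo A μ ≤ β + combo A ν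

/-- The ideal of `ℂ[s]` whose intersection with `ℂ[∑ s_k]` consists of the polynomials satisfying
the functional equation. -/
def testIdeal [Fintype σ] (A : σ → Fin n →₀ ℕ) : Ideal (MvPolynomial σ ℂ) :=
  Ideal.span {g | ∃ ν β, IsAdmissible A ν β ∧ g = risePoly A β * fallPoly ν}

/-- The product `∏_{j < c} φ(j)` over all coordinates, for an exponent increased by one. -/
theorem prod_range_add_single {ι R : Type*} [Fintype ι] [CommRing R] (φ : ι → ℕ → R)
    (ν : ι →₀ ℕ) (k : ι) :
    ∏ l, ∏ j ∈ Finset.range ((ν + Finsupp.single k 1 : ι →₀ ℕ) l), φ l j =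
      (∏ l, ∏ j ∈ Finset.range (ν l), φ l j) * φ k (ν k) := by
  classical
  have : ∀ l, ∏ j ∈ Finset.range ((ν + Finsupp.single k 1 : ι →₀ ℕ) l), φ l j =
      (∏ j ∈ Finset.range (ν l), φ l j) * if l = k then φ k (ν k) else 1 := fun l => by
    by_cases h : l = k
    · subst h
      simp [Finset.prod_range_succ]
    · simp [h]
  simp only [this, Finset.prod_mul_distrib]
  simp

theorem risePoly_add_single [Fintype σ] (A : σ → Fin n →₀ ℕ) (β : Fin n →₀ ℕ) (i : Fin n) :
    risePoly A (β + Finsupp.single i 1) = risePoly A β * (ellPoly A i + C (β i + 1 : ℂ)) :=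
  prod_range_add_single (fun i j => ellPoly A i + C (j + 1 : ℂ)) β i

theorem fallPoly_add_single [Fintype σ] (ν : σ →₀ ℕ) (k : σ) :
    fallPoly (ν + Finsupp.single k 1) = fallPoly ν * (C (ν k : ℂ) - X k) :=
  prod_range_add_single (fun k j => C (j : ℂ) - X k) ν k

/-! ### The operators on monomials of `ℂ[x][y]` -/

/-- The monomial `x^u y^ν`. -/
def biMono (ν : σ →₀ ℕ) (u : Fin n →₀ ℕ) : GraphRing σ n :=
  monomial (Finsupp.sumFinsuppAddEquivProdFinsupp.symm (ν, u)) 1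

theorem biMono_mul (ν ν' : σ →₀ ℕ) (u u' : Fin n →₀ ℕ) :
    biMono ν u * biMono ν' u' = biMono (ν + ν') (u + u') := by
  rw [biMono, biMono, biMono, monomial_mul, one_mul, ← map_add, Prod.mk_add_mk]

theorem symm_single_inl (k : σ) (c : ℕ) :
    (Finsupp.sumFinsuppAddEquivProdFinsupp (α := σ) (β := Fin n)).symm (Finsupp.single k c, 0) =
      Finsupp.single (Sum.inl k) c := by
  classical
  ext (j | i) <;> simp [Finsupp.single_apply]

theorem biMono_zero_right (k : σ) :
    biMono (Finsupp.single k 1) (0 : Fin n →₀ ℕ) = X (Sum.inl k) := by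
  rw [biMono, symm_single_inl]
  rfl

theorem baseIncl_monomial (u : Fin n →₀ ℕ) (c : ℂ) :
    baseIncl σ n (monomial u c) = c • biMono 0 u := by
  classical
  have h : u.mapDomain (Sum.inr : Fin n → σ ⊕ Fin n) =
      Finsupp.sumFinsuppAddEquivProdFinsupp.symm (0, u) := by
    ext (j | i)
    · rw [Finsupp.mapDomain_of_notMem_range _ _ (by simp)]
      simp
    · rw [Finsupp.mapDomain_apply Sum.inr_injective]
      simp
  rw [baseIncl, rename_monomial, biMono, smul_monomial, smul_eq_mul, mul_one, h]

theorem X_inl_mul_biMono (k : σ) (ν : σ →₀ ℕ) (u : Fin n →₀ ℕ) :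
    X (Sum.inl k) * biMono ν u = biMono (ν + Finsupp.single k 1) u := by
  rw [← biMono_zero_right, biMono_mul, zero_add, add_comm]

theorem baseIncl_monomial_mul_biMono (u u' : Fin n →₀ ℕ) (c : ℂ) (ν : σ →₀ ℕ) :
    baseIncl σ n (monomial u' c) * biMono ν u = c • biMono ν (u' + u) := by
  rw [baseIncl_monomial, smul_mul_assoc, biMono_mul, zero_add]

theorem X_mul_pderiv_inl_biMono (k : σ) (ν : σ →₀ ℕ) (u : Fin n →₀ ℕ) :
    X (Sum.inl k) * pderiv (Sum.inl k) (biMono ν u) = (ν k : ℂ) • biMono ν u := by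
  rw [biMono, X_mul_pderiv_monomial, Nat.cast_smul_eq_nsmul]
  simp

theorem pderiv_inr_biMono (i : Fin n) (ν : σ →₀ ℕ) (u : Fin n →₀ ℕ) :
    pderiv (Sum.inr i) (biMono ν u) = (u i : ℂ) • biMono ν (u - Finsupp.single i 1) := by
  classical
  have h : Finsupp.sumFinsuppAddEquivProdFinsupp.symm (ν, u) - Finsupp.single (Sum.inr i) 1 =
      Finsupp.sumFinsuppAddEquivProdFinsupp.symm (ν, u - Finsupp.single i 1) := by
    ext (j | l) <;> simp [Finsupp.single_apply]
  rw [biMono, biMono, pderiv_monomial, smul_monomial, h]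
  simp

/-- A linear map on `ℂ[x][y]` is determined by its values on monomials. -/
theorem linearMap_ext_biMono {V : Type*} [AddCommGroup V] [Module ℂ V]
    {φ ψ : GraphRing σ n →ₗ[ℂ] V} (h : ∀ ν u, φ (biMono ν u) = ψ (biMono ν u)) : φ = ψ := by
  refine (basisMonomials _ ℂ).ext fun w => ?_
  have := h (Finsupp.sumFinsuppAddEquivProdFinsupp w).1 (Finsupp.sumFinsuppAddEquivProdFinsupp w).2
  rw [biMono, Prod.mk.eta, AddEquiv.symm_apply_apply] at this
  simpa using this

theorem tAct_mono_biMono (A : σ → Fin n →₀ ℕ) (k : σ) (ν : σ →₀ ℕ) (u : Fin n →₀ ℕ) :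
    X (Sum.inl k) * tAct (mono A) k (biMono ν u) =
      biMono (ν + Finsupp.single k 1) (A k + u) - (ν k : ℂ) • biMono ν u := by
  rw [tAct_apply, mul_sub, X_mul_pderiv_inl_biMono, mono, baseIncl_monomial_mul_biMono, one_smul,
    X_inl_mul_biMono]

theorem eulerAct_biMono [Fintype σ] (A : σ → Fin n →₀ ℕ) (ν : σ →₀ ℕ) (u : Fin n →₀ ℕ) :
    eulerAct (mono A) (biMono ν u) =
      ∑ k, ((ν k : ℂ) • biMono ν u - biMono (ν + Finsupp.single k 1) (A k + u)) := by
  rw [eulerAct_apply, ← Finset.sum_neg_distrib]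
  simp only [tAct_mono_biMono, neg_sub]

theorem connection_biMono [Fintype σ] (A : σ → Fin n →₀ ℕ) (i : Fin n) (ν : σ →₀ ℕ)
    (u : Fin n →₀ ℕ) :
    connection (mono A) i (biMono ν u) = (u i : ℂ) • biMono ν (u - Finsupp.single i 1) -
      ∑ k, (A k i : ℂ) •
        biMono (ν + Finsupp.single k 1) (A k - Finsupp.single i 1 + u) := by
  rw [connection_apply, pderiv_inr_biMono, pderiv_inr_phase, Finset.sum_mul]
  congr 1
  refine Finset.sum_congr rfl fun k _ => ?_
  rw [mul_assoc, X_inl_mul_biMono, mono, pderiv_monomial, one_mul, baseIncl_monomial_mul_biMono]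

/-! ### Functionals on `ℂ[x][y]` attached to a point `s` -/

section functional

variable [Fintype σ]

open Classical in
/-- The functional sending `x^u y^ν` to `∏ₖ ∏_{j < ν_k} (j - s_k)` if `u = d + ∑ ν_k A_k` and to `0`
otherwise. -/
def mellin (A : σ → Fin n →₀ ℕ) (s : σ → ℂ) (d : Fin n →₀ ℕ) : GraphRing σ n →ₗ[ℂ] ℂ :=
  (basisMonomials _ ℂ).constr ℂ fun w =>
    if (Finsupp.sumFinsuppAddEquivProdFinsupp w).2 =
      d + combo A (Finsupp.sumFinsuppAddEquivProdFinsupp w).1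
    then eval s (fallPoly (Finsupp.sumFinsuppAddEquivProdFinsupp w).1) else 0

open Classical in
theorem mellin_biMono (A : σ → Fin n →₀ ℕ) (s : σ → ℂ) (d : Fin n →₀ ℕ) (ν : σ →₀ ℕ)
    (u : Fin n →₀ ℕ) :
    mellin A s d (biMono ν u) = if u = d + combo A ν then eval s (fallPoly ν) else 0 := by
  have : biMono ν u =
      basisMonomials _ ℂ (Finsupp.sumFinsuppAddEquivProdFinsupp.symm (ν, u)) := by
    simp [biMono]
  rw [this, mellin, Module.Basis.constr_basis, AddEquiv.apply_symm_apply]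

theorem eval_fallPoly_add_single (s : σ → ℂ) (ν : σ →₀ ℕ) (k : σ) :
    eval s (fallPoly (ν + Finsupp.single k 1)) = eval s (fallPoly ν) * (ν k - s k) := by
  simp [fallPoly_add_single]

/-- Multiplication by `x^{A_k} y_k` preserves the support condition and contributes `ν_k - s_k`, so
`-y_k t_k` contributes `ν_k - (ν_k - s_k) = s_k`. -/
theorem mellin_eulerAct (A : σ → Fin n →₀ ℕ) (s : σ → ℂ) (g : GraphRing σ n) :
    mellin A s 0 (eulerAct (mono A) g) = (∑ k, s k) * mellin A s 0 g := by
  classical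
  have : mellin A s 0 ∘ₗ eulerAct (mono A) = (∑ k, s k) • mellin A s 0 := by
    refine linearMap_ext_biMono fun ν u => ?_
    rw [LinearMap.comp_apply, eulerAct_biMono, map_sum, LinearMap.smul_apply, smul_eq_mul,
      Finset.sum_mul]
    refine Finset.sum_congr rfl fun k _ => ?_
    rw [map_sub, map_smul, mellin_biMono, mellin_biMono, eval_fallPoly_add_single, smul_eq_mul,
      map_add, combo_single, zero_add, zero_add, add_comm (A k)]
    simp only [add_left_inj]
    split_ifs
    · ring
    · simp
  exact congrArg (fun φ : GraphRing σ n →ₗ[ℂ] ℂ => φ g) this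

theorem eval_ellPoly (A : σ → Fin n →₀ ℕ) (s : σ → ℂ) (i : Fin n) :
    eval s (ellPoly A i) = ∑ k, (A k i : ℂ) * s k := by
  simp [ellPoly]

/-- The factor `ℓ_i(s) + d_i + 1` is exactly the one gained by `risePoly` when `d` grows by the
`i`-th unit vector. -/
theorem mellin_connection (A : σ → Fin n →₀ ℕ) (s : σ → ℂ) (d : Fin n →₀ ℕ) (i : Fin n)
    (g : GraphRing σ n) :
    mellin A s d (connection (mono A) i g) =
      (∑ k, (A k i : ℂ) * s k + (d i + 1)) * mellin A s (d + Finsupp.single i 1) g := by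
  classical
  have : mellin A s d ∘ₗ connection (mono A) i =
      (∑ k, (A k i : ℂ) * s k + (d i + 1)) • mellin A s (d + Finsupp.single i 1) := by
    refine linearMap_ext_biMono fun ν u => ?_
    have h1 : mellin A s d ((u i : ℂ) • biMono ν (u - Finsupp.single i 1)) =
        (u i : ℂ) * if u = d + Finsupp.single i 1 + combo A ν
          then eval s (fallPoly ν) else 0 := by
      rw [map_smul, mellin_biMono, smul_eq_mul]
      -- Truncated subtraction of exponents goes wrong only for `u i = 0`, where the coefficient
      -- vanishes; likewise for `A k i = 0` below.
      by_cases h0 : u i = 0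
      · simp [h0]
      · obtain ⟨u', rfl⟩ : ∃ u', u = u' + Finsupp.single i 1 :=
          ⟨_, (Finsupp.sub_add_single_one_cancel h0).symm⟩
        simp only [add_tsub_cancel_right, add_right_comm d _ (combo A ν), add_left_inj]
    have h2 : ∀ k, mellin A s d ((A k i : ℂ) •
        biMono (ν + Finsupp.single k 1) (A k - Finsupp.single i 1 + u)) =
        (A k i : ℂ) * if u = d + Finsupp.single i 1 + combo A ν
          then eval s (fallPoly ν) * (ν k - s k) else 0 := fun k => by
      rw [map_smul, mellin_biMono, smul_eq_mul, eval_fallPoly_add_single, map_add, combo_single]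
      by_cases h0 : A k i = 0
      · simp [h0]
      · have e : A k - Finsupp.single i 1 + u = d + (combo A ν + A k) ↔
            u = d + Finsupp.single i 1 + combo A ν := by
          have h3 : d + (combo A ν + A k) =
              A k - Finsupp.single i 1 + (d + Finsupp.single i 1 + combo A ν) := by
            conv_lhs => rw [← Finsupp.sub_add_single_one_cancel h0]
            generalize A k - Finsupp.single i 1 = v
            abel
          rw [h3, add_right_inj]
        simp only [e]
    rw [LinearMap.comp_apply, connection_biMono, map_sub, map_sum, h1, LinearMap.smul_apply,
      smul_eq_mul, mellin_biMono]
    simp only [h2]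
    split_ifs with h
    · have h3 : (u i : ℂ) = d i + 1 + ∑ k, (ν k : ℂ) * (A k i : ℂ) := by
        rw [h]
        simp [combo_apply]
      have h4 : ∑ k, (A k i : ℂ) * (eval s (fallPoly ν) * (ν k - s k)) =
          (∑ k, (ν k : ℂ) * (A k i : ℂ) - ∑ k, (A k i : ℂ) * s k) * eval s (fallPoly ν) := by
        rw [← Finset.sum_sub_distrib, Finset.sum_mul]
        exact Finset.sum_congr rfl fun k _ => by ring
      rw [h3, h4]
      ring
    · simp
  exact congrArg (fun φ : GraphRing σ n →ₗ[ℂ] ℂ => φ g) this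

end functional

theorem monomial_mem_span_mono {A : σ → Fin n →₀ ℕ} {u : Fin n →₀ ℕ} {k : σ} (h : A k ≤ u) :
    (monomial u 1 : Poly n) ∈ Ideal.span (Set.range (mono A)) := by
  obtain ⟨v, rfl⟩ := exists_add_of_le h
  rw [add_comm, ← one_mul (1 : ℂ), ← monomial_mul]
  exact Ideal.mul_mem_left _ _ (Ideal.subset_span ⟨k, rfl⟩)

theorem exists_le_of_mem_span_mono {A : σ → Fin n →₀ ℕ} {p : Poly n}
    (hp : p ∈ Ideal.span (Set.range (mono A))) {u : Fin n →₀ ℕ} (hu : u ∈ p.support) :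
    ∃ k, A k ≤ u := by
  have e : Set.range (mono A) = (fun v => (monomial v 1 : Poly n)) '' Set.range A := by
    rw [← Set.range_comp]
    rfl
  rw [e, mem_ideal_span_monomial_image] at hp
  obtain ⟨_, ⟨k, rfl⟩, hk⟩ := hp u hu
  exact ⟨k, hk⟩

/-- The span of the `x^u y^ν` with `|ν| = m` and `x^u` in the power `m + 1` of the ideal. -/
def goodSpan (A : σ → Fin n →₀ ℕ) (m : ℕ) : Submodule ℂ (GraphRing σ n) :=
  Submodule.span ℂ {g | ∃ ν u, ν.degree = m ∧ (∃ μ : σ →₀ ℕ, μ.degree = m + 1 ∧ combo A μ ≤ u) ∧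
    g = biMono ν u}

theorem reesPiece_le_goodSpan (A : σ → Fin n →₀ ℕ) (m : ℕ) :
    reesPiece σ (Ideal.span (Set.range (mono A))) m ≤ goodSpan A m := by
  induction m with
  | zero =>
    refine Submodule.span_le.2 ?_
    rintro _ ⟨p, hp, rfl⟩
    rw [← support_sum_monomial_coeff p, map_sum]
    refine sum_mem fun u hu => ?_
    rw [baseIncl_monomial]
    obtain ⟨k, hk⟩ := exists_le_of_mem_span_mono hp hu
    exact Submodule.smul_mem _ _ (Submodule.subset_span ⟨0, u, by simp,
      ⟨Finsupp.single k 1, by simp, by rwa [combo_single]⟩, rfl⟩)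
  | succ m ih =>
    refine Submodule.span_le.2 ?_
    rintro _ ⟨p, hp, j, h, hh, rfl⟩
    have h1 : ∀ u, ∀ k, A k ≤ u → goodSpan A m ≤ (goodSpan A (m + 1)).comap
        (LinearMap.mulLeft ℂ (baseIncl σ n (monomial u 1) * X (Sum.inl j))) := by
      intro u k hk
      refine Submodule.span_le.2 ?_
      rintro _ ⟨ν, v, hν, ⟨μ, hμ, hv⟩, rfl⟩
      change baseIncl σ n (monomial u 1) * X (Sum.inl j) * biMono ν v ∈ goodSpan A (m + 1)
      rw [mul_assoc, X_inl_mul_biMono, baseIncl_monomial_mul_biMono, one_smul]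
      refine Submodule.subset_span ⟨_, _, ?_, ⟨μ + Finsupp.single k 1, ?_, ?_⟩, rfl⟩
      · simp [hν]
      · simp [hμ]
      · rw [map_add, combo_single, add_comm]
        exact add_le_add hk hv
    change baseIncl σ n p * X (Sum.inl j) * h ∈ goodSpan A (m + 1)
    rw [← support_sum_monomial_coeff p, map_sum, Finset.sum_mul, Finset.sum_mul]
    refine sum_mem fun u hu => ?_
    obtain ⟨k, hk⟩ := exists_le_of_mem_span_mono hp hu
    have h2 := Submodule.smul_mem (goodSpan A (m + 1)) (coeff u p) (h1 u k hk (ih hh))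
    have e : baseIncl σ n (monomial u (coeff u p)) =
        coeff u p • baseIncl σ n (monomial u 1) := by
      rw [baseIncl_monomial, baseIncl_monomial, one_smul]
    rw [e, smul_mul_assoc, smul_mul_assoc]
    exact h2

/-- Polynomials satisfying the functional equation vanish at `∑ s_k` for every common zero `s` of
the test ideal. -/
theorem GraphEquation.eval_eq_zero [Fintype σ] {A : σ → Fin n →₀ ℕ} {b : Polynomial ℂ}
    (hb : GraphEquation (mono A) (Ideal.span (Set.range (mono A))) b) {s : σ → ℂ}
    (hs : ∀ ν β, IsAdmissible A ν β → eval s (risePoly A β) * eval s (fallPoly ν) = 0) :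
    b.eval (∑ k, s k) = 0 := by
  classical
  -- Weighting the functional for `d` by `risePoly A d` makes the common kernel stable under every
  -- `∂_i`.
  let S : Submodule ℂ (GraphRing σ n) :=
    ⨅ d : Fin n →₀ ℕ, LinearMap.ker (eval s (risePoly A d) • mellin A s d)
  have hS : ∀ {g}, g ∈ S ↔ ∀ d, eval s (risePoly A d) * mellin A s d g = 0 := by
    simp only [S, Submodule.mem_iInf, LinearMap.mem_ker, LinearMap.smul_apply, smul_eq_mul,
      implies_true]
  have key : reesModule (mono A) (Ideal.span (Set.range (mono A))) ≤ S := by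
    refine reesModule_le (fun m => (reesPiece_le_goodSpan A m).trans ?_) fun i g hg => ?_
    · refine Submodule.span_le.2 ?_
      rintro _ ⟨ν, u, hν, ⟨μ, hμ, hu⟩, rfl⟩
      refine hS.2 fun d => ?_
      rw [mellin_biMono]
      split_ifs with h
      -- On the support `u = d + ∑ ν_k A_k` of the functional, `x^u ∈ a^{m+1}` says that `(ν, d)` is
      -- admissible.
      · exact hs ν d ⟨μ, by rw [hμ, hν], h ▸ hu⟩
      · simp
    · refine hS.2 fun d => ?_
      have h1 := hS.1 hg (d + Finsupp.single i 1)
      rw [risePoly_add_single, map_mul, map_add, eval_ellPoly, eval_C] at h1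
      rw [mellin_connection, ← mul_assoc]
      exact h1
  have h0 : mellin A s 0 1 = 1 := by
    have : (1 : GraphRing σ n) = biMono 0 0 := by
      rw [biMono, Prod.mk_zero_zero, map_zero]
      rfl
    rw [this, mellin_biMono]
    simp [fallPoly]
  -- For `d = 0` the weight is `1`, and the functional sends `b(Euler) 1` to `b(∑ s_k)`.
  have h1 := hS.1 (key hb) 0
  rw [map_aeval_apply (mellin A s 0) _ (LinearMap.mulLeft ℂ (∑ k, s k)) (mellin_eulerAct A s),
    h0] at h1
  have h2 := Polynomial.aeval_algHom_apply (Algebra.lmul ℂ ℂ) (∑ k, s k) b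
  change Polynomial.aeval (LinearMap.mulLeft ℂ (∑ k, s k)) b = _ at h2
  rw [h2] at h1
  simpa [risePoly, Polynomial.aeval_def] using h1

end BernsteinSato
end

noncomputable section
namespace BernsteinSato
open MvPolynomial
variable {n r : ℕ}

/-! ### The test ideal consists of solutions of the functional equation -/

theorem finsupp_induction_single {ι : Type*} {P : (ι →₀ ℕ) → Prop} (h0 : P 0)
    (h1 : ∀ ν i, P ν → P (ν + Finsupp.single i 1)) (ν : ι →₀ ℕ) : P ν := by
  induction h : ν.degree generalizing ν with
  | zero => rwa [(Finsupp.degree_eq_zero_iff ν).1 h]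
  | succ m ih =>
    obtain ⟨i, hi⟩ : ∃ i, ν i ≠ 0 := by
      by_contra! hν
      rw [show ν = 0 from Finsupp.ext hν] at h
      simp at h
    rw [← Finsupp.sub_add_single_one_cancel hi] at h ⊢
    refine h1 _ _ (ih _ ?_)
    simpa using h

/-- The inclusion `ℂ[s] → PowModule f`. -/
def scalarEmb (f : Fin r → Poly n) : MvPolynomial (Fin r) ℂ →ₐ[ℂ] PowModule f :=
  aeval X

theorem scalarEmb_X (f : Fin r → Poly n) (k : Fin r) : scalarEmb f (X k) = X k := by
  simp [scalarEmb]

theorem scalarEmb_C (f : Fin r → Poly n) (c : ℂ) :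
    scalarEmb f (C c) = C (algebraMap ℂ (Loc f) c) := by
  simp [scalarEmb]

theorem X_mul_mem_targetModule {f : Fin r → Poly n} (k : Fin r) {u : PowModule f}
    (hu : u ∈ targetModule f) : X k * u ∈ targetModule f := by
  rw [sOp_eq]
  exact neg_mem (operatorRing_apply_mem_targetModule (yOp_mul_tOp_mem_operatorRing f k k) hu)

theorem scalarEmb_mul_mem_targetModule {f : Fin r → Poly n} (q : MvPolynomial (Fin r) ℂ)
    {u : PowModule f} (hu : u ∈ targetModule f) : scalarEmb f q * u ∈ targetModule f := by
  induction q using MvPolynomial.induction_on generalizing u with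
  | C c =>
    have : scalarEmb f (C c) * u = c • u := by
      rw [← algebraMap_eq, AlgHom.commutes, Algebra.smul_def]
    rw [this]
    exact Submodule.smul_mem _ c hu
  | add p q hp hq =>
    rw [map_add, add_mul]
    exact add_mem (hp hu) (hq hu)
  | mul_X p k hp =>
    rw [map_mul, mul_assoc, scalarEmb_X]
    exact hp (X_mul_mem_targetModule k hu)

theorem coeffPderiv_scalarEmb (f : Fin r → Poly n) (i : Fin n) (q : MvPolynomial (Fin r) ℂ) :
    coeffPderiv f i (scalarEmb f q) = 0 := by
  induction q using MvPolynomial.induction_on with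
  | C c => rw [scalarEmb_C, coeffPderiv_C, Derivation.map_algebraMap, C_0]
  | add p q hp hq => rw [map_add, map_add, hp, hq, add_zero]
  | mul_X p k hp =>
    rw [map_mul, coeffPderiv_mul, hp, scalarEmb_X, coeffPderiv_X, zero_mul, mul_zero, add_zero]

variable (A : Fin r → Fin n →₀ ℕ)

/-- Multiplication by `x^{A_k} y_k` equals `y_k t_k + y_k ∂/∂y_k`, that is `-s_k + ν_k` on a
monomial of exponent `ν`; each step of the induction adds this factor. -/
theorem graphEmb_biMono (ν : Fin r →₀ ℕ) :
    graphEmb (mono A) (biMono ν (combo A ν)) = scalarEmb (mono A) (fallPoly ν) := by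
  induction ν using finsupp_induction_single with
  | h0 =>
    have h1 : biMono 0 (combo A 0) = (1 : GraphRing (Fin r) n) := by
      rw [map_zero, biMono, Prod.mk_zero_zero, map_zero]
      rfl
    have h2 : fallPoly (0 : Fin r →₀ ℕ) = 1 := by simp [fallPoly]
    rw [h1, h2, graphEmb_one, map_one]
  | h1 ν k ih =>
    have e := tAct_mono_biMono A k ν (combo A ν)
    have e2 := sOp_eq (mono A) k (graphEmb (mono A) (biMono ν (combo A ν)))
    rw [tOp_graphEmb, ← graphEmb_X_inl_mul, e, map_sub, map_smul, ih] at e2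
    rw [map_add, combo_single, add_comm (combo A ν), fallPoly_add_single, map_mul, map_sub,
      scalarEmb_X, ← algebraMap_eq, AlgHom.commutes, mul_sub, mul_comm (scalarEmb _ _) (X k), e2,
      mul_comm, ← Algebra.smul_def]
    ring

/-- Peels off one generator of `μ` together with one variable of `ν`, leaving the surplus exponent
to the piece of degree `0`. -/
theorem biMono_mem_reesPiece {ν : Fin r →₀ ℕ} {u : Fin n →₀ ℕ} {m : ℕ} (hν : ν.degree = m)
    {μ : Fin r →₀ ℕ} (hμ : μ.degree = m + 1) (hu : combo A μ ≤ u) :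
    biMono ν u ∈ reesPiece (Fin r) (Ideal.span (Set.range (mono A))) m := by
  have exists_of_degree : ∀ {μ : Fin r →₀ ℕ} {m : ℕ}, μ.degree = m + 1 →
      ∃ k μ', μ = μ' + Finsupp.single k 1 ∧ μ'.degree = m := by
    intro μ m hμ
    obtain ⟨i, hi⟩ : ∃ i, μ i ≠ 0 := by
      by_contra! h
      rw [show μ = 0 from Finsupp.ext h] at hμ
      simp at hμ
    have e := (Finsupp.sub_add_single_one_cancel hi).symm
    refine ⟨i, _, e, ?_⟩
    rw [e, map_add, Finsupp.degree_single] at hμ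
    exact Nat.succ_injective hμ
  induction m generalizing ν μ u with
  | zero =>
    rw [(Finsupp.degree_eq_zero_iff ν).1 hν]
    obtain ⟨k, μ', rfl, -⟩ := exists_of_degree hμ
    rw [← one_smul ℂ (biMono 0 u), ← baseIncl_monomial]
    refine baseIncl_mem_reesPiece (monomial_mem_span_mono (k := k) (le_trans ?_ hu))
    rw [map_add, combo_single]
    exact le_add_self
  | succ m ih =>
    obtain ⟨k, μ', rfl, hμ'⟩ := exists_of_degree hμ
    obtain ⟨j, ν', rfl, hν'⟩ := exists_of_degree hν
    rw [map_add, combo_single] at hu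
    obtain ⟨v, rfl⟩ := exists_add_of_le hu
    have := mul_mem_reesPiece (monomial_mem_span_mono (A := A) (k := k) le_rfl) j
      (ih (u := combo A μ' + v) hν' hμ' le_self_add)
    rw [mul_assoc, X_inl_mul_biMono, baseIncl_monomial_mul_biMono, one_smul] at this
    convert this using 2
    abel

theorem logDeriv_mono (i : Fin n) :
    C (algebraMap (Poly n) (Loc (mono A)) (X i)) * logDeriv (mono A) i =
      scalarEmb (mono A) (ellPoly A i) := by
  rw [logDeriv, Finset.mul_sum, ellPoly, map_sum]
  refine Finset.sum_congr rfl fun k _ => ?_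
  have h1 : algebraMap (Poly n) (Loc (mono A)) (X i) * locPderiv (mono A) i (gen (mono A) k) =
      algebraMap ℂ (Loc (mono A)) (A k i) * gen (mono A) k := by
    rw [gen, locPderiv_algebraMap, ← map_mul, mono, X_mul_pderiv_monomial,
      IsScalarTower.algebraMap_apply ℂ (Poly n) (Loc (mono A)), ← map_mul]
    congr 1
    simp
  rw [map_mul (scalarEmb _), scalarEmb_X, scalarEmb_C, mul_comm (X k), ← mul_assoc, ← C_mul, ← mul_assoc, h1,
    mul_assoc, gen_mul_genInv, mul_one]

/-- The operator `x_i ∂_i` multiplies `∏ x^{A_k s_k}` by `ℓ_i(s)`, and the extra power of `x_i` adds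
`d_i + 1`. -/
theorem derivOp_monomial_mul (d : Fin n →₀ ℕ) (i : Fin n) (q : MvPolynomial (Fin r) ℂ) :
    derivOp (mono A) i (mulOp (mono A) (monomial (d + Finsupp.single i 1) 1)
      (scalarEmb (mono A) q)) =
      mulOp (mono A) (monomial d 1) (scalarEmb (mono A) ((ellPoly A i + C (d i + 1 : ℂ)) * q)) := by
  have h1 : (monomial (d + Finsupp.single i 1) 1 : Poly n) = monomial d 1 * X i := by
    rw [X, monomial_mul, one_mul]
  have h2 : pderiv i (monomial (d + Finsupp.single i 1) 1 : Poly n) =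
      monomial d 1 * C (d i + 1 : ℂ) := by
    rw [pderiv_monomial, add_tsub_cancel_right, mul_comm (monomial d _), C_mul_monomial]
    simp
  have h3 : algebraMap (Poly n) (Loc (mono A)) (C (d i + 1 : ℂ)) = algebraMap ℂ _ (d i + 1 : ℂ) :=
    (IsScalarTower.algebraMap_apply ℂ (Poly n) (Loc (mono A)) _).symm
  rw [mulOp_apply, derivOp_C_mul, locPderiv_algebraMap, h2, h1, derivOp_apply,
    coeffPderiv_scalarEmb, zero_add, mulOp_apply, map_mul (scalarEmb _), map_add (scalarEmb _),
    ← logDeriv_mono, scalarEmb_C]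
  simp only [map_mul (algebraMap (Poly n) (Loc (mono A))), h3, C_mul]
  ring

/-- Applying `∂^d` strips off `x^d` one variable at a time and collects the factors of `risePoly`.
-/
theorem risePoly_mul_mem (d : Fin n →₀ ℕ) (q : MvPolynomial (Fin r) ℂ)
    (h : mulOp (mono A) (monomial d 1) (scalarEmb (mono A) q) ∈ targetModule (mono A)) :
    scalarEmb (mono A) (risePoly A d * q) ∈ targetModule (mono A) := by
  induction d using finsupp_induction_single generalizing q with
  | h0 =>
    have : risePoly A 0 = 1 := by simp [risePoly]
    rw [this, one_mul]
    rw [mulOp_apply, monomial_zero', C_1, map_one, C_1, one_mul] at h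
    exact h
  | h1 d i ih =>
    rw [risePoly_add_single, mul_assoc]
    refine ih _ ?_
    rw [← derivOp_monomial_mul]
    exact operatorRing_apply_mem_targetModule (derivOp_mem_operatorRing _ i) h

/-- For an admissible pair, `x^β x^{∑ν_k A_k} y^ν` lies in a generating piece; it equals `x^β` times
`fallPoly ν`, and `∂^β` turns `x^β` into `risePoly A β`. -/
theorem scalarEmb_mem_targetModule {q : MvPolynomial (Fin r) ℂ} (hq : q ∈ testIdeal A) :
    scalarEmb (mono A) q ∈ targetModule (mono A) := by
  refine Submodule.span_induction ?_ ?_ ?_ ?_ hq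
  · rintro _ ⟨ν, β, ⟨μ, hμ, hu⟩, rfl⟩
    refine risePoly_mul_mem A β _ ?_
    rw [← graphEmb_biMono, ← graphEmb_baseIncl_mul, baseIncl_monomial_mul_biMono, one_smul,
      ← map_graphEmb_reesModule]
    exact Submodule.mem_map_of_mem
      (reesPiece_le_reesModule _ _ _ (biMono_mem_reesPiece A rfl hμ hu))
  · rw [map_zero]
    exact zero_mem _
  · intro x y _ _ hx hy
    rw [map_add]
    exact add_mem hx hy
  · intro c x _ hx
    rw [smul_eq_mul, map_mul]
    exact scalarEmb_mul_mem_targetModule c hx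

theorem functionalEquation_of_mem_testIdeal {b : Polynomial ℂ}
    (hb : Polynomial.aeval (∑ k, X k : MvPolynomial (Fin r) ℂ) b ∈ testIdeal A) :
    FunctionalEquation (mono A) b := by
  rw [functionalEquation_iff_mem_targetModule]
  have := scalarEmb_mem_targetModule A hb
  rw [← Polynomial.aeval_algHom_apply, map_sum] at this
  simpa only [scalarEmb_X] using this

end BernsteinSato
end

noncomputable section
namespace BernsteinSato
open MvPolynomial
variable {n r : ℕ}

/-! ### Existence of the `b`-function and its roots in terms of the test ideal -/

/-- The zero set of the test ideal. -/
def testZeros (A : Fin r → Fin n →₀ ℕ) : Set (Fin r → ℂ) :=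
  {s | ∀ ν β, IsAdmissible A ν β → eval s (risePoly A β) * eval s (fallPoly ν) = 0}

theorem mem_testZeros_iff {A : Fin r → Fin n →₀ ℕ} {s : Fin r → ℂ} :
    s ∈ testZeros A ↔ ∀ q ∈ testIdeal A, eval s q = 0 := by
  constructor
  · intro hs q hq
    refine Submodule.span_induction ?_ ?_ ?_ ?_ hq
    · rintro _ ⟨ν, β, h, rfl⟩
      rw [map_mul]
      exact hs ν β h
    · simp
    · intro x y _ _ hx hy
      rw [map_add, hx, hy, add_zero]
    · intro c x _ hx
      rw [smul_eq_mul, map_mul, hx, mul_zero]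
  · intro hs ν β h
    rw [← map_mul]
    exact hs _ (Ideal.subset_span ⟨ν, β, h, rfl⟩)

theorem eval_risePoly_eq_zero {A : Fin r → Fin n →₀ ℕ} {s : Fin r → ℂ} {β : Fin n →₀ ℕ} :
    eval s (risePoly A β) = 0 ↔
      ∃ i, ∃ j < β i, ∑ k, (A k i : ℂ) * s k + (j + 1) = 0 := by
  simp [risePoly, map_prod, Finset.prod_eq_zero_iff, eval_ellPoly]

theorem eval_fallPoly_eq_zero {s : Fin r → ℂ} {ν : Fin r →₀ ℕ} :
    eval s (fallPoly ν) = 0 ↔ ∃ k, ∃ j < ν k, s k = j := by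
  simp [fallPoly, map_prod, Finset.prod_eq_zero_iff, sub_eq_zero, @eq_comm ℂ (s _)]

/-- The zero set is cut out by finitely many products of affine forms, so it suffices to show that
the sum depends only on which forms vanish at `s`. If two zeros with the same pattern had different
sums, the complex line through them would consist of zeros, and some sum on it would not be real. -/
theorem finite_image_testZeros (A : Fin r → Fin n →₀ ℕ)
    (hreal : ∀ s ∈ testZeros A, ∃ x : ℝ, ∑ k, s k = (x : ℂ)) :
    ((fun s => ∑ k, s k) '' testZeros A).Finite := by
  -- Finitely many products generate the test ideal, so a bound `N` on their exponents leaves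
  -- finitely many affine forms.
  obtain ⟨T, hT, hspan⟩ := (Submodule.fg_span_iff_fg_span_finset_subset _).1
    (IsNoetherian.noetherian (testIdeal A))
  obtain ⟨N, hN⟩ : ∃ N : ℕ, ∀ g ∈ T, ∃ ν β, g = risePoly A β * fallPoly ν ∧
      (∀ i, β i ≤ N) ∧ ∀ k, ν k ≤ N := by
    have : ∀ᶠ N : ℕ in Filter.atTop, ∀ g ∈ T, ∃ ν β, g = risePoly A β * fallPoly ν ∧
        (∀ i, β i ≤ N) ∧ ∀ k, ν k ≤ N := by
      rw [Filter.eventually_all_finset]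
      intro g hg
      obtain ⟨ν, β, -, rfl⟩ := hT hg
      filter_upwards [Filter.eventually_ge_atTop (β.degree + ν.degree)] with N hN
      exact ⟨ν, β, rfl, fun i => (Finsupp.le_degree i β).trans (by omega),
        fun k => (Finsupp.le_degree k ν).trans (by omega)⟩
    exact this.exists
  let sig : (Fin r → ℂ) → Set (Fin n × Fin N) × Set (Fin r × Fin N) := fun s =>
    ({p | ∑ k, (A k p.1 : ℂ) * s k + ((p.2 : ℕ) + 1) = 0}, {p | s p.1 = (p.2 : ℕ)})
  have key : ∀ s ∈ testZeros A, ∀ s' ∈ testZeros A, sig s = sig s' → ∑ k, s k = ∑ k, s' k := by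
    intro s hs s' hs' hsig
    by_contra hne
    have hsub : ∑ k, s' k - ∑ k, s k ≠ 0 := sub_ne_zero.2 (Ne.symm hne)
    -- The parameter at which the sum along the line takes the value `I`.
    set z : ℂ := (Complex.I - ∑ k, s k) / (∑ k, s' k - ∑ k, s k) with hz
    have hmem : (fun k => s k + z * (s' k - s k)) ∈ testZeros A := by
      rw [mem_testZeros_iff]
      intro q hq
      have hq' : q ∈ Submodule.span (MvPolynomial (Fin r) ℂ) (T : Set (MvPolynomial (Fin r) ℂ)) := by
        rw [← hspan]
        exact hq
      refine Submodule.span_induction ?_ ?_ ?_ ?_ hq'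
      · intro g hg
        obtain ⟨ν, β, rfl, hβ, hν⟩ := hN g hg
        have h0 := mem_testZeros_iff.1 hs _ (Ideal.subset_span (hT hg))
        rw [map_mul, mul_eq_zero, eval_risePoly_eq_zero, eval_fallPoly_eq_zero] at h0 ⊢
        rcases h0 with ⟨i, j, hj, h⟩ | ⟨k, j, hj, h⟩
        · have h1 : (i, (⟨j, hj.trans_le (hβ i)⟩ : Fin N)) ∈ (sig s).1 := h
          rw [hsig] at h1
          have h2 : ∑ k, (A k i : ℂ) * s' k + (j + 1) = 0 := h1
          refine Or.inl ⟨i, j, hj, ?_⟩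
          have h3 : ∑ k, (A k i : ℂ) * (s k + z * (s' k - s k)) =
              (1 - z) * ∑ k, (A k i : ℂ) * s k + z * ∑ k, (A k i : ℂ) * s' k := by
            rw [Finset.mul_sum, Finset.mul_sum, ← Finset.sum_add_distrib]
            exact Finset.sum_congr rfl fun k _ => by ring
          rw [h3]
          linear_combination (1 - z) * h + z * h2
        · have h1 : (k, (⟨j, hj.trans_le (hν k)⟩ : Fin N)) ∈ (sig s).2 := h
          rw [hsig] at h1
          have h2 : s' k = j := h1
          refine Or.inr ⟨k, j, hj, ?_⟩
          linear_combination (1 - z) * h + z * h2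
      · simp
      · intro x y _ _ hx hy
        rw [map_add, hx, hy, add_zero]
      · intro c x _ hx
        rw [smul_eq_mul, map_mul, hx, mul_zero]
    obtain ⟨x, hx⟩ := hreal _ hmem
    have hI : ∑ k, (s k + z * (s' k - s k)) = Complex.I := by
      rw [Finset.sum_add_distrib, ← Finset.mul_sum, Finset.sum_sub_distrib, hz]
      field_simp
      ring
    rw [hI] at hx
    simpa using congrArg Complex.im hx
  have : Finite ((fun s => ∑ k, s k) '' testZeros A) := by
    refine Finite.of_injective (fun α => sig α.2.choose) fun α α' h => Subtype.ext ?_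
    rw [← α.2.choose_spec.2, ← α'.2.choose_spec.2]
    exact key _ α.2.choose_spec.1 _ α'.2.choose_spec.1 h
  exact Set.toFinite _

/-- The ideal of polynomials satisfying the functional equation. -/
def equationIdeal (f : Fin r → Poly n) (hf0 : ∀ j, f j ≠ 0) : Ideal (Polynomial ℂ) where
  carrier := {b | FunctionalEquation f b}
  add_mem' {b c} hb hc := by
    rw [Set.mem_ofPred_eq, functionalEquation_iff_graphEquation hf0 rfl] at *
    exact hb.add hc
  zero_mem' := ⟨0, fun _ => zero_mem _, by simp⟩
  smul_mem' c b hb := by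
    rw [Set.mem_ofPred_eq, functionalEquation_iff_graphEquation hf0 rfl] at *
    exact hb.mul_left (fun j => Ideal.subset_span (Set.mem_range_self j)) c

theorem mono_ne_zero (A : Fin r → Fin n →₀ ℕ) (k : Fin r) : mono A k ≠ 0 := by
  simp [mono]

/-- The polynomial `B` with simple roots at the sums of test zeros vanishes on the zero set, so by
the Nullstellensatz a power of it solves the equation. The monic generator of the solution ideal
divides that power, which bounds its roots from above; the functionals bound them from below. -/
theorem exists_isBFunction {r' : ℕ} (f : Fin r' → Poly n) (hf0 : ∀ j, f j ≠ 0)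
    (A : Fin r → Fin n →₀ ℕ) (hfA : Ideal.span (Set.range f) = Ideal.span (Set.range (mono A)))
    (hreal : ∀ s ∈ testZeros A, ∃ x : ℝ, ∑ k, s k = (x : ℂ)) :
    ∃ b, IsBFunction f b ∧ ∀ z, b.eval z = 0 ↔ ∃ s ∈ testZeros A, ∑ k, s k = z := by
  classical
  have hFE := functionalEquation_congr hf0 (mono_ne_zero A) hfA
  have hfin := finite_image_testZeros A hreal
  let B : Polynomial ℂ := ∏ z ∈ hfin.toFinset, (Polynomial.X - Polynomial.C z)
  have hBroot : ∀ z, B.eval z = 0 ↔ ∃ s ∈ testZeros A, ∑ k, s k = z := by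
    intro z
    simp only [B, Polynomial.eval_prod, Finset.prod_eq_zero_iff, Polynomial.eval_sub,
      Polynomial.eval_X, Polynomial.eval_C, sub_eq_zero, Set.Finite.mem_toFinset, Set.mem_image]
    constructor
    · rintro ⟨w, h, rfl⟩
      exact h
    · exact fun h => ⟨z, h, rfl⟩
  have hB0 : B ≠ 0 := Finset.prod_ne_zero_iff.2 fun z _ => Polynomial.X_sub_C_ne_zero z
  obtain ⟨N, hN⟩ : Polynomial.aeval (∑ k, X k : MvPolynomial (Fin r) ℂ) B ∈
      (testIdeal A).radical := by
    rw [← vanishingIdeal_zeroLocus_eq_radical (K := ℂ), mem_vanishingIdeal_iff]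
    intro s hs
    have hs' : s ∈ testZeros A := mem_testZeros_iff.2 fun q hq => by
      have := hs q hq
      simpa using this
    rw [← Polynomial.aeval_algHom_apply, map_sum]
    simp only [aeval_X]
    rw [Polynomial.coe_aeval_eq_eval]
    exact (hBroot _).2 ⟨s, hs', rfl⟩
  rw [← map_pow] at hN
  have hBN : B ^ N ∈ equationIdeal f hf0 :=
    (hFE _).2 (functionalEquation_of_mem_testIdeal A hN)
  let g := Submodule.IsPrincipal.generator (equationIdeal f hf0)
  have hmem : ∀ c, c ∈ equationIdeal f hf0 ↔ normalize g ∣ c := fun c => by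
    rw [normalize_dvd_iff, ← Ideal.mem_span_singleton, Ideal.span_singleton_generator]
  have hg0 : g ≠ 0 := by
    intro h
    have := (hmem _).1 hBN
    rw [h, normalize_zero, zero_dvd_iff] at this
    exact pow_ne_zero N hB0 this
  have hb : FunctionalEquation f (normalize g) := (hmem _).2 dvd_rfl
  refine ⟨normalize g, ⟨Polynomial.monic_normalize hg0, hb, fun c hc hcf =>
    Polynomial.natDegree_le_of_dvd ((hmem c).1 hcf) hc.ne_zero⟩, fun z => ⟨fun hz => ?_, ?_⟩⟩
  · rw [← hBroot]
    obtain ⟨d, hd⟩ := (hmem _).1 hBN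
    have := congrArg (Polynomial.eval z) hd
    rw [Polynomial.eval_mul, hz, zero_mul, Polynomial.eval_pow] at this
    exact eq_zero_of_pow_eq_zero this
  · rintro ⟨s, hs, rfl⟩
    rw [hFE, functionalEquation_iff_graphEquation (mono_ne_zero A) rfl] at hb
    exact hb.eval_eq_zero hs

end BernsteinSato
end

noncomputable section
namespace BernsteinSato

/-! ### Linear inequalities over an ordered field -/

section farkas

variable {K V : Type*} [Field K] [LinearOrder K] [IsStrictOrderedRing K] [AddCommGroup V]
  [Module K V]

/-- Farkas' lemma. -/
theorem farkas_fin {m : ℕ} (g : Fin m → V →ₗ[K] K) (φ : V →ₗ[K] K) :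
    (∃ x, (∀ j, 0 ≤ g j x) ∧ φ x < 0) ∨ ∃ c : Fin m → K, (∀ j, 0 ≤ c j) ∧ φ = ∑ j, c j • g j := by
  induction m generalizing φ with
  | zero =>
    by_cases h : φ = 0
    · exact Or.inr ⟨0, fun _ => le_rfl, by simp [h]⟩
    · obtain ⟨x, hx⟩ : ∃ x, φ x ≠ 0 := by
        by_contra! h'
        exact h (LinearMap.ext h')
      rcases hx.lt_or_gt with hx | hx
      · exact Or.inl ⟨x, fun j => j.elim0, hx⟩
      · exact Or.inl ⟨-x, fun j => j.elim0, by simpa using hx⟩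
  | succ m ih =>
    rcases ih (fun j => g j.succ) φ with ⟨x, hx, hφ⟩ | ⟨c, hc, hφ⟩
    · rcases le_or_gt 0 (g 0 x) with h0 | h0
      · exact Or.inl ⟨x, Fin.cases h0 hx, hφ⟩
      -- Here `g 0 x < 0`. The forms are corrected by multiples of `g 0` so as to vanish at `x`,
      -- which amounts to restricting them to `g 0 = 0` by projecting along `x`.
      · rcases ih (fun j => g j.succ - (g j.succ x / g 0 x) • g 0) (φ - (φ x / g 0 x) • g 0) with
          ⟨x', hx', hφ'⟩ | ⟨c, hc, hφ'⟩
        · have e : ∀ ψ : V →ₗ[K] K, ψ (x' - (g 0 x' / g 0 x) • x) =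
              (ψ - (ψ x / g 0 x) • g 0) x' := fun ψ => by
            simp only [LinearMap.sub_apply, LinearMap.smul_apply, smul_eq_mul, map_sub, map_smul]
            ring
          refine Or.inl ⟨x' - (g 0 x' / g 0 x) • x, fun j => ?_, ?_⟩
          · rw [e]
            refine Fin.cases ?_ hx' j
            rw [div_self h0.ne, one_smul, sub_self]
            exact le_rfl
          · rw [e]
            exact hφ'
        -- The coefficient of `g 0` is nonnegative since `φ x` and `g 0 x` are negative while the
        -- other `g j x` are not.
        · have h2 : ∑ j, c j * (g j.succ x / g 0 x) ≤ 0 := Finset.sum_nonpos fun j _ =>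
            mul_nonpos_of_nonneg_of_nonpos (hc j) (div_nonpos_of_nonneg_of_nonpos (hx j) h0.le)
          have h1 := div_pos_of_neg_of_neg hφ h0
          have h3 : φ = (φ x / g 0 x - ∑ j, c j * (g j.succ x / g 0 x)) • g 0 +
              ∑ j, c j • g j.succ := by
            refine LinearMap.ext fun y => ?_
            have h4 := congrArg (fun ψ : V →ₗ[K] K => ψ y) hφ'
            simp only [LinearMap.add_apply, LinearMap.sub_apply, LinearMap.smul_apply,
              LinearMap.sum_apply, smul_eq_mul, mul_sub, Finset.sum_sub_distrib, ← mul_assoc,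
              ← Finset.sum_mul] at h4 ⊢
            linear_combination h4
          refine Or.inr ⟨Fin.cons (φ x / g 0 x - ∑ j, c j * (g j.succ x / g 0 x)) c,
            fun j => Fin.cases ?_ hc j, ?_⟩
          · rw [Fin.sum_univ_succ]
            exact h3
          · rw [Fin.cons_zero]
            linarith
    · exact Or.inr ⟨Fin.cons 0 c, fun j => Fin.cases le_rfl hc j, by
        simp [Fin.sum_univ_succ, hφ]⟩

theorem farkas {ι : Type*} [Fintype ι] (g : ι → V →ₗ[K] K) (φ : V →ₗ[K] K) :
    (∃ x, (∀ j, 0 ≤ g j x) ∧ φ x < 0) ∨ ∃ c : ι → K, (∀ j, 0 ≤ c j) ∧ φ = ∑ j, c j • g j := by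
  let e := Fintype.equivFin ι
  rcases farkas_fin (fun j => g (e.symm j)) φ with ⟨x, hx, hφ⟩ | ⟨c, hc, hφ⟩
  · exact Or.inl ⟨x, fun j => by simpa using hx (e j), hφ⟩
  · refine Or.inr ⟨fun j => c (e j), fun j => hc _, ?_⟩
    rw [hφ, ← e.sum_comp]
    simp

/-- A strictly complementary version of Farkas' lemma. -/
theorem farkas_strict {ι : Type*} [Fintype ι] (g : ι → V →ₗ[K] K) (φ : V →ₗ[K] K) :
    (∃ x, (∀ j, 0 ≤ g j x) ∧ φ x < 0) ∨ ∃ (c : ι → K) (x : V), (∀ j, 0 ≤ c j) ∧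
      φ = ∑ j, c j • g j ∧ (∀ j, 0 ≤ g j x) ∧ φ x = 0 ∧ ∀ j, 0 < c j ∨ 0 < g j x := by
  classical
  rcases farkas g φ with h | ⟨c₀, hc₀, hφ₀⟩
  · exact Or.inl h
  refine Or.inr ?_
  have hnonneg : ∀ x, (∀ j, 0 ≤ g j x) → 0 ≤ φ x := fun x hx => by
    rw [hφ₀]
    simpa using Finset.sum_nonneg fun j _ => mul_nonneg (hc₀ j) (hx j)
  -- Complementarity is first obtained for one index at a time; averaging the `c` and adding the `x`
  -- then gives it for all.
  have key : ∀ j, ∃ (c : ι → K) (x : V), (∀ i, 0 ≤ c i) ∧ φ = ∑ i, c i • g i ∧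
      (∀ i, 0 ≤ g i x) ∧ φ x = 0 ∧ (0 < c j ∨ 0 < g j x) := by
    intro j
    -- Either some `x` with all `g i x ≥ 0` and `φ x ≤ 0` has `g j x > 0`, or a certificate for `-g
    -- j` yields an expression of `φ` with positive coefficient at `j`.
    rcases farkas (fun i : Option ι => i.elim (-φ) g) (-g j) with ⟨x, hx, hj⟩ | ⟨c, hc, hj⟩
    · have h1 : ∀ i, 0 ≤ g i x := fun i => hx (some i)
      have h2 : 0 ≤ -φ x := hx none
      refine ⟨c₀, x, hc₀, hφ₀, h1, le_antisymm (neg_nonneg.1 h2) (hnonneg x h1), Or.inr ?_⟩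
      simpa using hj
    · rw [Fintype.sum_option] at hj
      have hpos : 0 < 1 + c none := by linarith [hc none]
      refine ⟨fun i => (1 + c none)⁻¹ * (c₀ i + c (some i) + if i = j then 1 else 0), 0,
        fun i => mul_nonneg (inv_nonneg.2 hpos.le) ?_, ?_, by simp, by simp,
        Or.inl (mul_pos (inv_pos.2 hpos) ?_)⟩
      · have := hc₀ i
        have := hc (some i)
        split_ifs <;> linarith
      · have h3 : (1 + c none) • φ =
            ∑ i, (c₀ i + c (some i) + if i = j then 1 else 0) • g i := by
          simp only [add_smul, Finset.sum_add_distrib, ← hφ₀, one_smul, ite_smul, zero_smul,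
            Finset.sum_ite_eq', Finset.mem_univ, if_true]
          have h4 : -g j = -(c none • φ) + ∑ i, c (some i) • g i := by
            simpa using hj
          have h5 : ∑ i, c (some i) • g i = c none • φ - g j := by
            rw [sub_eq_add_neg, h4]
            abel
          rw [h5]
          abel
        simp only [mul_smul, ← Finset.smul_sum]
        rw [← h3, smul_smul, inv_mul_cancel₀ hpos.ne', one_smul]
      · have := hc₀ j
        have := hc (some j)
        simp
        linarith
  choose c x hc hφ hx hφx hcx using key
  -- The initial certificate `c₀` is included in the average, so the denominator is nonzero even
  -- when `ι` is empty.
  have hcard : (0 : K) < 1 + Fintype.card ι := by positivity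
  refine ⟨fun i => (1 + Fintype.card ι : K)⁻¹ * (c₀ i + ∑ j, c j i), ∑ j, x j,
    fun i => mul_nonneg (inv_nonneg.2 hcard.le)
      (add_nonneg (hc₀ i) (Finset.sum_nonneg fun j _ => hc j i)), ?_, fun i => ?_, ?_, fun i => ?_⟩
  · have h : ∑ i, (c₀ i + ∑ j, c j i) • g i = (1 + Fintype.card ι : K) • φ := by
      simp only [add_smul, Finset.sum_add_distrib, ← hφ₀, Finset.sum_smul]
      rw [Finset.sum_comm]
      simp only [← hφ]
      simp [Nat.cast_smul_eq_nsmul]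
    simp only [mul_smul, ← Finset.smul_sum]
    rw [h, smul_smul, inv_mul_cancel₀ hcard.ne', one_smul]
  · rw [map_sum]
    exact Finset.sum_nonneg fun j _ => hx j i
  · rw [map_sum]
    exact Finset.sum_eq_zero fun j _ => hφx j
  · rcases hcx i with h | h
    · refine Or.inl (mul_pos (inv_pos.2 hcard) (add_pos_of_nonneg_of_pos (hc₀ i) ?_))
      exact h.trans_le (Finset.single_le_sum (f := fun j => c j i) (fun j _ => hc j i)
        (Finset.mem_univ i))
    · right
      rw [map_sum]
      exact h.trans_le (Finset.single_le_sum (f := fun j => g i (x j)) (fun j _ => hx j i)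
        (Finset.mem_univ i))

end farkas
end BernsteinSato
end

noncomputable section
namespace BernsteinSato
open MvPolynomial
variable {n r : ℕ}

/-! ### Faces of the Newton polyhedron -/

/-- The integer vector `∑ c_k A_k`. -/
def latticeCombo (A : Fin r → Fin n →₀ ℕ) (c : Fin r → ℤ) : Fin n → ℤ :=
  fun i => ∑ k, c k * A k i

theorem latticeCombo_add (A : Fin r → Fin n →₀ ℕ) (c d : Fin r → ℤ) :
    latticeCombo A (c + d) = latticeCombo A c + latticeCombo A d := by
  ext i
  simp [latticeCombo, add_mul, Finset.sum_add_distrib]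

theorem latticeCombo_sub (A : Fin r → Fin n →₀ ℕ) (c d : Fin r → ℤ) :
    latticeCombo A (c - d) = latticeCombo A c - latticeCombo A d := by
  ext i
  simp [latticeCombo, sub_mul, Finset.sum_sub_distrib]

theorem latticeCombo_smul (A : Fin r → Fin n →₀ ℕ) (N : ℤ) (c : Fin r → ℤ) :
    latticeCombo A (N • c) = N • latticeCombo A c := by
  ext i
  simp [latticeCombo, mul_assoc, Finset.mul_sum]

/-- The exponent `A_k` as an integer vector. -/
def latticePt (A : Fin r → Fin n →₀ ℕ) (k : Fin r) : Fin n → ℤ := fun i => (A k i : ℤ)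

theorem latticeCombo_single (A : Fin r → Fin n →₀ ℕ) (k : Fin r) (t : ℤ) :
    latticeCombo A (Pi.single k t) = t • latticePt A k := by
  ext i
  simp [latticeCombo, latticePt, Pi.single_apply]

theorem mem_lattExpSet_iff {A : Fin r → Fin n →₀ ℕ} {v : Fin n → ℤ} :
    v ∈ lattExpSet (Ideal.span (Set.range (mono A))) ↔ ∃ k, latticePt A k ≤ v := by
  constructor
  · rintro ⟨u, hu, rfl⟩
    obtain ⟨k, hk⟩ := exists_le_of_mem_span_mono (A := A) (u := u) hu (by simp [mem_support_iff])
    exact ⟨k, fun i => by simpa [latticePt] using hk i⟩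
  · rintro ⟨k, hk⟩
    have hv : ∀ i, 0 ≤ v i := fun i => (Int.natCast_nonneg _).trans (hk i)
    refine ⟨Finsupp.equivFunOnFinite.symm fun i => (v i).toNat,
      monomial_mem_span_mono (k := k) fun i => ?_, ?_⟩
    · have := hk i
      simp only [latticePt] at this
      simp
      omega
    · ext i
      simp [hv i]

theorem toReal_add (u v : Fin n → ℤ) : toReal (u + v) = toReal u + toReal v := by
  ext i
  simp [toReal]

theorem toReal_single (i : Fin n) (t : ℤ) :
    toReal (Pi.single i t) = (t : ℝ) • (Pi.single i 1 : Fin n → ℝ) := by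
  classical
  ext j
  by_cases h : j = i
  · subst h
    simp [toReal]
  · simp [toReal, h]

theorem toReal_eq_sum (v : Fin n → ℤ) :
    toReal v = ∑ i, (v i : ℝ) • (Pi.single i 1 : Fin n → ℝ) := by
  classical
  ext j
  simp [toReal, Finset.sum_apply, Pi.single_apply]

/-- `w = ∑ c_k A_k + m` with `∑ c_k = t`, where `c_k ≥ 0` for `k ∉ κ` and `m_i ≥ 0` for `i ∉ J`. -/
def InCone (A : Fin r → Fin n →₀ ℕ) (κ : Set (Fin r)) (J : Set (Fin n)) (t : ℤ)
    (w : Fin n → ℤ) : Prop :=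
  ∃ (c : Fin r → ℤ) (m : Fin n → ℤ), ∑ k, c k = t ∧ (∀ k, k ∉ κ → 0 ≤ c k) ∧
    (∀ i, i ∉ J → 0 ≤ m i) ∧ w = latticeCombo A c + m

theorem InCone.add {A : Fin r → Fin n →₀ ℕ} {κ : Set (Fin r)} {J : Set (Fin n)} {t t' : ℤ}
    {w w' : Fin n → ℤ} (h : InCone A κ J t w) (h' : InCone A κ J t' w') :
    InCone A κ J (t + t') (w + w') := by
  obtain ⟨c, m, hc, hκ, hJ, rfl⟩ := h
  obtain ⟨c', m', hc', hκ', hJ', rfl⟩ := h'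
  refine ⟨c + c', m + m', by simp [Finset.sum_add_distrib, hc, hc'],
    fun k hk => add_nonneg (hκ k hk) (hκ' k hk), fun i hi => add_nonneg (hJ i hi) (hJ' i hi), ?_⟩
  rw [latticeCombo_add]
  abel

theorem inCone_latticePt (A : Fin r → Fin n →₀ ℕ) (κ : Set (Fin r)) (J : Set (Fin n)) (k : Fin r) :
    InCone A κ J 1 (latticePt A k) := by
  refine ⟨Pi.single k 1, 0, by simp, fun l _ => ?_, fun _ _ => le_rfl, ?_⟩
  · by_cases h : l = k
    · subst h
      simp
    · simp [h]
  · rw [latticeCombo_single, one_smul, add_zero]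

theorem inCone_neg_latticePt (A : Fin r → Fin n →₀ ℕ) {κ : Set (Fin r)} (J : Set (Fin n))
    {k : Fin r} (hk : k ∈ κ) : InCone A κ J (-1) (-latticePt A k) := by
  refine ⟨Pi.single k (-1), 0, by simp, fun l hl => ?_, fun _ _ => le_rfl, ?_⟩
  · have h : l ≠ k := fun h => hl (h ▸ hk)
    simp [h]
  · rw [latticeCombo_single, neg_smul, one_smul, add_zero]

theorem inCone_zero (A : Fin r → Fin n →₀ ℕ) (κ : Set (Fin r)) {J : Set (Fin n)} {m : Fin n → ℤ}
    (hm : ∀ i, i ∉ J → 0 ≤ m i) : InCone A κ J 0 m :=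
  ⟨0, m, by simp, fun _ _ => le_rfl, hm, by ext; simp [latticeCombo]⟩

section face

variable {A : Fin r → Fin n →₀ ℕ} {Q : Set (Fin n → ℝ)} {l : (Fin n → ℝ) →ₗ[ℝ] ℝ}

/-- `Q` is the nonempty locus where `l` attains its maximum over the Newton polyhedron. -/
structure IsMaxLocus (A : Fin r → Fin n →₀ ℕ) (l : (Fin n → ℝ) →ₗ[ℝ] ℝ)
    (Q : Set (Fin n → ℝ)) : Prop where
  nonempty : Q.Nonempty
  eq : Q = {x ∈ newtonPolyhedron (Ideal.span (Set.range (mono A))) |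
    ∀ y ∈ newtonPolyhedron (Ideal.span (Set.range (mono A))), l y ≤ l x}

/-- The generators lying on `Q`. -/
def faceGens (A : Fin r → Fin n →₀ ℕ) (Q : Set (Fin n → ℝ)) : Set (Fin r) :=
  {k | toReal (latticePt A k) ∈ Q}

/-- The coordinates on which `l` does not depend. -/
def freeCoords (l : (Fin n → ℝ) →ₗ[ℝ] ℝ) : Set (Fin n) := {i | l (Pi.single i 1) = 0}

theorem toReal_mem_newtonPolyhedron {v : Fin n → ℤ} {k : Fin r} (h : latticePt A k ≤ v) :
    toReal v ∈ newtonPolyhedron (Ideal.span (Set.range (mono A))) :=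
  subset_convexHull ℝ _ ⟨v, mem_lattExpSet_iff.2 ⟨k, h⟩, rfl⟩

namespace IsMaxLocus

theorem exists_max (h : IsMaxLocus A l Q) : ∃ M, Q =
    {x ∈ newtonPolyhedron (Ideal.span (Set.range (mono A))) | l x = M} ∧
    ∀ y ∈ newtonPolyhedron (Ideal.span (Set.range (mono A))), l y ≤ M := by
  obtain ⟨x₀, hx₀⟩ := h.nonempty
  have h0 := hx₀
  rw [h.eq] at h0
  refine ⟨l x₀, ?_, h0.2⟩
  rw [h.eq]
  ext x
  exact ⟨fun hx => ⟨hx.1, le_antisymm (h0.2 x hx.1) (hx.2 x₀ h0.1)⟩,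
    fun hx => ⟨hx.1, fun y hy => hx.2 ▸ h0.2 y hy⟩⟩

/-- Translating by multiples of the `i`-th unit vector stays in the polyhedron, on which `l` is
bounded above. -/
theorem l_single_nonpos (h : IsMaxLocus A l Q) (i : Fin n) : l (Pi.single i 1) ≤ 0 := by
  obtain ⟨M, -, hM⟩ := h.exists_max
  have hne : (lattExpSet (Ideal.span (Set.range (mono A)))).Nonempty := by
    obtain ⟨x, hx⟩ := h.nonempty
    rw [h.eq] at hx
    exact (convexHull_nonempty_iff.1 ⟨x, hx.1⟩).of_image
  obtain ⟨v, hv⟩ := hne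
  obtain ⟨k, hk⟩ := mem_lattExpSet_iff.1 hv
  by_contra! hpos
  obtain ⟨N, hN⟩ := exists_nat_gt ((M - l (toReal v)) / l (Pi.single i 1))
  rw [div_lt_iff₀ hpos] at hN
  have h1 := hM _ (toReal_mem_newtonPolyhedron (v := v + Pi.single i (N : ℤ))
    (hk.trans (le_add_of_nonneg_right (Pi.single_nonneg.2 (Int.natCast_nonneg N)))))
  rw [toReal_add, toReal_single, map_add, map_smul, smul_eq_mul, Int.cast_natCast] at h1
  linarith

/-- A lattice point of `Q` is a generator on `Q` plus a vector in the free directions. -/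
theorem exists_of_mem (h : IsMaxLocus A l Q) {v : Fin n → ℤ}
    (hv : v ∈ facePoints (Ideal.span (Set.range (mono A))) Q) :
    ∃ k ∈ faceGens A Q, ∃ m : Fin n → ℤ, (∀ i, 0 ≤ m i) ∧ (∀ i, i ∉ freeCoords l → m i = 0) ∧
      v = latticePt A k + m := by
  obtain ⟨M, hQ, hM⟩ := h.exists_max
  obtain ⟨k, hk⟩ := mem_lattExpSet_iff.1 hv.1
  have hvQ := hv.2
  rw [hQ] at hvQ
  have hkP := toReal_mem_newtonPolyhedron (le_refl (latticePt A k))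
  have hm : ∀ i, 0 ≤ (v - latticePt A k) i := fun i => sub_nonneg.2 (hk i)
  have e : l (toReal v) = l (toReal (latticePt A k)) +
      ∑ i, ((v - latticePt A k) i : ℝ) * l (Pi.single i 1) := by
    have : v = latticePt A k + (v - latticePt A k) := by abel
    conv_lhs => rw [this, toReal_add, toReal_eq_sum (v - latticePt A k), map_add, map_sum]
    simp
  have hterm : ∀ i ∈ Finset.univ, ((v - latticePt A k) i : ℝ) * l (Pi.single i 1) ≤ 0 := fun i _ =>
    mul_nonpos_of_nonneg_of_nonpos (by exact_mod_cast hm i) (h.l_single_nonpos i)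
  have hsum := Finset.sum_nonpos hterm
  have hkM := hM _ hkP
  have h0 : ∑ i, ((v - latticePt A k) i : ℝ) * l (Pi.single i 1) = 0 := by
    linarith [hvQ.2]
  refine ⟨k, ?_, v - latticePt A k, hm, fun i hi => ?_, by abel⟩
  · change toReal (latticePt A k) ∈ Q
    rw [hQ]
    exact ⟨hkP, by linarith [hvQ.2]⟩
  · have := (Finset.sum_eq_zero_iff_of_nonpos hterm).1 h0 i (Finset.mem_univ i)
    rcases mul_eq_zero.1 this with h1 | h1
    · exact_mod_cast h1
    · exact absurd h1 hi

theorem add_mem_facePoints (h : IsMaxLocus A l Q) {k : Fin r} (hk : k ∈ faceGens A Q)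
    {m : Fin n → ℤ} (hm : 0 ≤ m) (hJ : ∀ i, i ∉ freeCoords l → m i = 0) :
    latticePt A k + m ∈ facePoints (Ideal.span (Set.range (mono A))) Q := by
  obtain ⟨M, hQ, hM⟩ := h.exists_max
  have hle : latticePt A k ≤ latticePt A k + m := le_add_of_nonneg_right hm
  refine ⟨mem_lattExpSet_iff.2 ⟨k, hle⟩, ?_⟩
  have hk' : toReal (latticePt A k) ∈ Q := hk
  rw [hQ] at hk' ⊢
  refine ⟨toReal_mem_newtonPolyhedron hle, ?_⟩
  rw [toReal_add, map_add, hk'.2, toReal_eq_sum m, map_sum, add_eq_left]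
  refine Finset.sum_eq_zero fun i _ => ?_
  by_cases hi : i ∈ freeCoords l
  · rw [map_smul, show l (Pi.single i 1) = 0 from hi, smul_zero]
  · rw [hJ i hi]
    simp

/-- The points of `Q` lie in every linear subspace that contains its lattice points. -/
theorem subset_of_facePoints (h : IsMaxLocus A l Q) {S : Submodule ℝ (Fin n → ℝ)}
    (hS : ∀ v ∈ facePoints (Ideal.span (Set.range (mono A))) Q, toReal v ∈ S) : Q ⊆ S := by
  obtain ⟨M, hQ, hM⟩ := h.exists_max
  -- A convex combination of points with `l ≤ M` attains `M` only if the points of nonzero weight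
  -- do; so this set is convex, and it contains the convex hull of `Γ_a`.
  have hT : Convex ℝ {x | l x ≤ M ∧ (l x = M → x ∈ S)} := by
    rintro x ⟨hx1, hx2⟩ y ⟨hy1, hy2⟩ a b ha hb hab
    have e : l (a • x + b • y) = a * l x + b * l y := by simp
    have e2 : a * M + b * M = M := by rw [← add_mul, hab, one_mul]
    have h1 := mul_le_mul_of_nonneg_left hx1 ha
    have h2 := mul_le_mul_of_nonneg_left hy1 hb
    refine ⟨by rw [e]; linarith, fun heq => ?_⟩
    rw [e] at heq
    have h3 : a * (M - l x) = 0 := by linarith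
    have h4 : b * (M - l y) = 0 := by linarith
    refine add_mem ?_ ?_
    · rcases mul_eq_zero.1 h3 with h5 | h5
      · simp [h5]
      · exact S.smul_mem a (hx2 (by linarith))
    · rcases mul_eq_zero.1 h4 with h5 | h5
      · simp [h5]
      · exact S.smul_mem b (hy2 (by linarith))
  have hsub : newtonPolyhedron (Ideal.span (Set.range (mono A))) ⊆
      {x | l x ≤ M ∧ (l x = M → x ∈ S)} := by
    refine convexHull_min ?_ hT
    rintro _ ⟨v, hv, rfl⟩
    have hvP := subset_convexHull ℝ (toReal '' lattExpSet (Ideal.span (Set.range (mono A))))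
      ⟨v, hv, rfl⟩
    refine ⟨hM _ hvP, fun heq => hS v ⟨hv, ?_⟩⟩
    rw [hQ]
    exact ⟨hvP, heq⟩
  intro x hx
  rw [hQ] at hx
  exact (hsub hx.1).2 hx.2

/-- Otherwise all of `Γ_a`, and with it the convex hull, would lie in the open half-space `l < M`.
-/
theorem facePoints_nonempty (h : IsMaxLocus A l Q) :
    (facePoints (Ideal.span (Set.range (mono A))) Q).Nonempty := by
  obtain ⟨M, hQ, hM⟩ := h.exists_max
  by_contra hne
  rw [Set.not_nonempty_iff_eq_empty] at hne
  have hsub : newtonPolyhedron (Ideal.span (Set.range (mono A))) ⊆ {x | l x < M} := by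
    refine convexHull_min ?_ (convex_halfSpace_lt l.isLinear M)
    rintro _ ⟨v, hv, rfl⟩
    have hvP := subset_convexHull ℝ (toReal '' lattExpSet (Ideal.span (Set.range (mono A))))
      ⟨v, hv, rfl⟩
    refine lt_of_le_of_ne (hM _ hvP) fun heq => ?_
    have : v ∈ facePoints (Ideal.span (Set.range (mono A))) Q := by
      refine ⟨hv, ?_⟩
      rw [hQ]
      exact ⟨hvP, heq⟩
    rw [hne] at this
    exact this
  obtain ⟨x, hx⟩ := h.nonempty
  rw [hQ] at hx
  exact (hsub hx.1).ne hx.2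

theorem exists_mem_faceGens (h : IsMaxLocus A l Q) : ∃ k, k ∈ faceGens A Q := by
  obtain ⟨v, hv⟩ := h.facePoints_nonempty
  obtain ⟨k, hk, -⟩ := h.exists_of_mem hv
  exact ⟨k, hk⟩

theorem single_mem_span (h : IsMaxLocus A l Q) {i : Fin n} (hi : i ∈ freeCoords l) :
    (Pi.single i 1 : Fin n → ℝ) ∈ Submodule.span ℝ Q := by
  obtain ⟨k, hk⟩ := h.exists_mem_faceGens
  have h1 := (h.add_mem_facePoints hk (m := Pi.single i 1) (Pi.single_nonneg.2 zero_le_one)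
    fun j hj => by
      have : j ≠ i := fun e => hj (e ▸ hi)
      simp [this]).2
  rw [toReal_add, toReal_single, Int.cast_one, one_smul] at h1
  have := sub_mem (Submodule.subset_span (R := ℝ) h1) (Submodule.subset_span (R := ℝ) hk)
  rwa [add_sub_cancel_left] at this

theorem apply_single_eq_zero (h : IsMaxLocus A l Q) {L : (Fin n → ℝ) →ₗ[ℝ] ℝ}
    (hL : ∀ x ∈ Q, L x = 1) {i : Fin n} (hi : i ∈ freeCoords l) : L (Pi.single i 1) = 0 := by
  obtain ⟨k, hk⟩ := h.exists_mem_faceGens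
  have h1 := hL _ (h.add_mem_facePoints hk (m := Pi.single i 1) (Pi.single_nonneg.2 zero_le_one)
    fun j hj => by
      have : j ≠ i := fun e => hj (e ▸ hi)
      simp [this]).2
  rw [toReal_add, toReal_single, Int.cast_one, one_smul, map_add, hL _ hk] at h1
  linarith

/-- Elements of the span of `Q` in terms of generators and free coordinates. -/
theorem exists_of_mem_span (h : IsMaxLocus A l Q) {x : Fin n → ℝ} (hx : x ∈ Submodule.span ℝ Q) :
    ∃ (τ : Fin r → ℝ) (ρ : Fin n → ℝ), (∀ k, k ∉ faceGens A Q → τ k = 0) ∧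
      (∀ i, i ∉ freeCoords l → ρ i = 0) ∧ x = ∑ k, τ k • toReal (latticePt A k) + ρ := by
  let S : Submodule ℝ (Fin n → ℝ) :=
    { carrier := {x | ∃ (τ : Fin r → ℝ) (ρ : Fin n → ℝ), (∀ k, k ∉ faceGens A Q → τ k = 0) ∧
        (∀ i, i ∉ freeCoords l → ρ i = 0) ∧ x = ∑ k, τ k • toReal (latticePt A k) + ρ}
      add_mem' := by
        rintro _ _ ⟨τ, ρ, h1, h2, rfl⟩ ⟨τ', ρ', h1', h2', rfl⟩
        refine ⟨τ + τ', ρ + ρ', fun k hk => by simp [h1 k hk, h1' k hk],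
          fun i hi => by simp [h2 i hi, h2' i hi], ?_⟩
        simp only [Pi.add_apply, add_smul, Finset.sum_add_distrib]
        abel
      zero_mem' := ⟨0, 0, by simp, by simp, by simp⟩
      smul_mem' := by
        rintro t _ ⟨τ, ρ, h1, h2, rfl⟩
        exact ⟨t • τ, t • ρ, fun k hk => by simp [h1 k hk], fun i hi => by simp [h2 i hi],
          by simp [Finset.smul_sum, mul_smul]⟩ }
  refine (Submodule.span_le (p := S)).2 (h.subset_of_facePoints fun v hv => ?_) hx
  obtain ⟨k, hk, m, -, hm, rfl⟩ := h.exists_of_mem hv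
  refine ⟨Pi.single k 1, toReal m, fun j hj => ?_, fun i hi => by simp [toReal, hm i hi], ?_⟩
  · have : j ≠ k := fun e => hj (e ▸ hk)
    simp [this]
  · rw [toReal_add, Finset.sum_eq_single k]
    · simp
    · intro j _ hj
      simp [hj]
    · simp

/-- Since `∑ c_k = 0`, a cone vector is a combination of the differences `A_k - A_{k₀}`, with `k₀`
on `Q`, and of unit vectors. All of these lie in `M_Q`, and so do their negatives when `A_k` is on
`Q` or the coordinate is free. -/
theorem mem_faceSemigroup_iff (h : IsMaxLocus A l Q) {w : Fin n → ℤ} :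
    w ∈ faceSemigroup (Ideal.span (Set.range (mono A))) Q ↔
      InCone A (faceGens A Q) (freeCoords l) 0 w := by
  constructor
  · intro hw
    induction hw using AddSubsemigroup.closure_induction with
    | mem w hw =>
      obtain ⟨u, hu, v, hv, rfl⟩ := hw
      obtain ⟨k, hk⟩ := mem_lattExpSet_iff.1 hu
      obtain ⟨k', hk', m, -, hm, rfl⟩ := h.exists_of_mem hv
      have h1 := (inCone_latticePt A (faceGens A Q) (freeCoords l) k).add
        ((inCone_neg_latticePt A (freeCoords l) hk').add
        (inCone_zero A (faceGens A Q) (J := freeCoords l) (m := u - latticePt A k - m)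
          fun i hi => by
            have := hk i
            simp only [Pi.sub_apply, hm i hi]
            linarith))
      convert h1 using 1
      · norm_num
      · abel
    | add x y _ _ hx hy => simpa using hx.add hy
  · rintro ⟨c, m, hc, hκ, hJ, rfl⟩
    obtain ⟨k₀, hk₀⟩ := h.exists_mem_faceGens
    set T := faceSemigroup (Ideal.span (Set.range (mono A))) Q with hT
    have hgen : ∀ u ∈ lattExpSet (Ideal.span (Set.range (mono A))),
        ∀ v ∈ facePoints (Ideal.span (Set.range (mono A))) Q, u - v ∈ T := fun u hu v hv =>
      AddSubsemigroup.subset_closure ⟨u, hu, v, hv, rfl⟩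
    have hpt : ∀ k, latticePt A k ∈ lattExpSet (Ideal.span (Set.range (mono A))) := fun k =>
      mem_lattExpSet_iff.2 ⟨k, le_rfl⟩
    have hface : ∀ k ∈ faceGens A Q,
        latticePt A k ∈ facePoints (Ideal.span (Set.range (mono A))) Q := fun k hk => ⟨hpt k, hk⟩
    let T' : AddSubmonoid (Fin n → ℤ) :=
      { T with zero_mem' := by simpa using hgen _ (hpt k₀) _ (hface k₀ hk₀) }
    have hzsmul : ∀ (t : ℤ) (x : Fin n → ℤ), x ∈ T' → (0 ≤ t ∨ -x ∈ T') → t • x ∈ T' := by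
      intro t x hx ht
      rcases le_total 0 t with h0 | h0
      · obtain ⟨N, rfl⟩ := Int.eq_ofNat_of_zero_le h0
        rw [natCast_zsmul]
        exact nsmul_mem hx N
      · rcases ht with ht | ht
        · rw [le_antisymm h0 ht, zero_smul]
          exact zero_mem _
        · obtain ⟨N, hN⟩ := Int.eq_ofNat_of_zero_le (neg_nonneg.2 h0)
          rw [← neg_neg t, hN, neg_smul, ← smul_neg, natCast_zsmul]
          exact nsmul_mem ht N
    have e : latticeCombo A c + m = ∑ k, c k • (latticePt A k - latticePt A k₀) +
        ∑ i, m i • (Pi.single i 1 : Fin n → ℤ) := by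
      simp only [smul_sub, Finset.sum_sub_distrib, ← Finset.sum_smul, hc, zero_smul, sub_zero]
      congr 1
      · ext i
        simp [latticeCombo, latticePt]
      · ext i
        simp [Pi.single_apply]
    rw [e]
    change _ ∈ T'
    refine add_mem (sum_mem fun k _ => hzsmul _ _ (hgen _ (hpt k) _ (hface k₀ hk₀)) ?_)
      (sum_mem fun i _ => hzsmul _ _ ?_ ?_)
    · by_cases hk : k ∈ faceGens A Q
      · right
        rw [neg_sub]
        exact hgen _ (hpt k₀) _ (hface k hk)
      · exact Or.inl (hκ k hk)
    · have := hgen (latticePt A k₀ + Pi.single i 1) (mem_lattExpSet_iff.2 ⟨k₀,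
        le_add_of_nonneg_right (Pi.single_nonneg.2 zero_le_one)⟩) _ (hface k₀ hk₀)
      rwa [add_sub_cancel_left] at this
    · by_cases hi : i ∈ freeCoords l
      · right
        have := hgen _ (hpt k₀) _ (h.add_mem_facePoints hk₀ (m := Pi.single i 1)
          (Pi.single_nonneg.2 zero_le_one) fun j hj => by
            have : j ≠ i := fun e => hj (e ▸ hi)
            simp [this])
        rwa [sub_add_cancel_left] at this
      · exact Or.inl (hJ i hi)

theorem mem_shiftedFaceSemigroup_iff (h : IsMaxLocus A l Q) {w : Fin n → ℤ} :
    w ∈ shiftedFaceSemigroup (Ideal.span (Set.range (mono A))) Q ↔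
      InCone A (faceGens A Q) (freeCoords l) 1 w := by
  obtain ⟨k₀, hk₀⟩ := h.exists_mem_faceGens
  rw [shiftedFaceSemigroup_eq _ Q (latticePt A k₀) ⟨mem_lattExpSet_iff.2 ⟨k₀, le_rfl⟩, hk₀⟩]
  constructor
  · rintro ⟨m, hm, rfl⟩
    simpa using (inCone_latticePt A _ _ k₀).add (h.mem_faceSemigroup_iff.1 hm)
  · intro hw
    refine ⟨w - latticePt A k₀, h.mem_faceSemigroup_iff.2 ?_, by abel⟩
    simpa [sub_eq_add_neg] using hw.add (inCone_neg_latticePt A (freeCoords l) hk₀)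

end IsMaxLocus

end face

end BernsteinSato
end

noncomputable section
namespace BernsteinSato
open MvPolynomial
variable {n r : ℕ}

/-! ### The common zeros of the test polynomials in terms of faces -/

/-- The integer vectors `c` such that `s_k + c_k ∈ ℕ` whenever `s_k ∈ ℕ`, and
`ℓ_i(s + c) ∈ ℤ_{<0}` whenever `ℓ_i(s) ∈ ℤ_{<0}`. -/
def IsFeasible (A : Fin r → Fin n →₀ ℕ) (s : Fin r → ℂ) (c : Fin r → ℤ) : Prop :=
  (∀ k (m : ℕ), s k = m → -(m : ℤ) ≤ c k) ∧
    ∀ i (m : ℕ), ∑ k, (A k i : ℂ) * s k + (m + 1) = 0 → latticeCombo A c i ≤ m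

/-- An admissible pair with witness `μ` gives `c = μ - ν` of sum `1`. Conversely the smallest
admissible exponents for `c` are the negative part of `c` for `ν` and the positive part of `∑ c_k
A_k` for `β`. Feasibility says that no factor vanishes at `s`. -/
theorem mem_testZeros_iff_not_isFeasible {A : Fin r → Fin n →₀ ℕ} {s : Fin r → ℂ} :
    s ∈ testZeros A ↔ ∀ c : Fin r → ℤ, ∑ k, c k = 1 → ¬ IsFeasible A s c := by
  constructor
  · rintro hs c hc ⟨h1, h2⟩
    let ν : Fin r →₀ ℕ := Finsupp.equivFunOnFinite.symm fun k => (-c k).toNat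
    let μ : Fin r →₀ ℕ := Finsupp.equivFunOnFinite.symm fun k => (c k).toNat
    let β : Fin n →₀ ℕ := Finsupp.equivFunOnFinite.symm fun i => (latticeCombo A c i).toNat
    have hμν : ∀ k, (μ k : ℤ) = c k + ν k := fun k => by
      simp only [μ, ν, Finsupp.coe_equivFunOnFinite_symm]
      omega
    have hadm : IsAdmissible A ν β := by
      refine ⟨μ, ?_, fun i => ?_⟩
      · rw [Finsupp.degree_eq_sum, Finsupp.degree_eq_sum]
        zify
        rw [Finset.sum_congr rfl fun k _ => hμν k, Finset.sum_add_distrib, hc, add_comm]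
      · have h3 : (combo A μ i : ℤ) = latticeCombo A c i + combo A ν i := by
          rw [combo_apply, combo_apply, latticeCombo, ← sub_eq_iff_eq_add]
          push_cast
          rw [← Finset.sum_sub_distrib]
          exact Finset.sum_congr rfl fun k _ => by rw [hμν]; ring
        rw [Finsupp.add_apply]
        simp only [β, Finsupp.coe_equivFunOnFinite_symm]
        omega
    rcases mul_eq_zero.1 (hs ν β hadm) with h | h
    · obtain ⟨i, j, hj, h⟩ := eval_risePoly_eq_zero.1 h
      have := h2 i j h
      simp only [β, Finsupp.coe_equivFunOnFinite_symm] at hj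
      omega
    · obtain ⟨k, j, hj, h⟩ := eval_fallPoly_eq_zero.1 h
      have := h1 k j h
      simp only [ν, Finsupp.coe_equivFunOnFinite_symm] at hj
      omega
  · rintro hs ν β ⟨μ, hdeg, hle⟩
    by_contra hne
    rw [mul_eq_zero, not_or, eval_risePoly_eq_zero, eval_fallPoly_eq_zero] at hne
    refine hs (fun k => (μ k : ℤ) - ν k) ?_ ⟨fun k m hk => ?_, fun i m hi => ?_⟩
    · rw [Finsupp.degree_eq_sum, Finsupp.degree_eq_sum] at hdeg
      zify at hdeg
      rw [Finset.sum_sub_distrib, hdeg, add_sub_cancel_left]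
    · have : ¬ m < ν k := fun h => hne.2 ⟨k, m, h, hk⟩
      dsimp only
      omega
    · have h1 : ¬ m < β i := fun h => hne.1 ⟨i, m, h, hi⟩
      have h2 := hle i
      have h3 : latticeCombo A (fun k => (μ k : ℤ) - ν k) i = combo A μ i - combo A ν i := by
        rw [combo_apply, combo_apply, latticeCombo]
        push_cast
        rw [← Finset.sum_sub_distrib]
        exact Finset.sum_congr rfl fun k _ => by ring
      rw [Finsupp.add_apply] at h2
      rw [h3]
      omega

/-- The vectors contributing to the roots of a face come from zeros of the test polynomials. -/
theorem IsMaxLocus.exists_mem_testZeros {A : Fin r → Fin n →₀ ℕ} {Q : Set (Fin n → ℝ)}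
    {l L : (Fin n → ℝ) →ₗ[ℝ] ℝ} (h : IsMaxLocus A l Q) (hL : ∀ x ∈ Q, L x = 1) {w : Fin n → ℤ}
    (hw : InCone A (faceGens A Q) (freeCoords l) 0 w)
    (hw' : ¬ InCone A (faceGens A Q) (freeCoords l) 1 w)
    (hspan : toReal (1 + w) ∈ Submodule.span ℝ Q) :
    ∃ s ∈ testZeros A, ∑ k, s k = -((L (toReal (1 + w)) : ℝ) : ℂ) := by
  obtain ⟨c, m, hc, hκ, hJ, rfl⟩ := hw
  obtain ⟨τ, ρ, hτ, hρ, e⟩ := h.exists_of_mem_span hspan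
  -- With this choice `s_k = c_k` for `A_k` off `Q` and `ℓ_i(s) = -(m_i + 1)` off the free
  -- coordinates, so adding a feasible vector of sum `1` to `c` would put `w` into `M'_Q`.
  refine ⟨fun k => ((c k - τ k : ℝ) : ℂ), mem_testZeros_iff_not_isFeasible.2 fun c' hc' hfeas => hw' ?_, ?_⟩
  · refine ⟨c + c', m - latticeCombo A c', by simp [Finset.sum_add_distrib, hc, hc'],
      fun k hk => ?_, fun i hi => ?_, by rw [latticeCombo_add]; abel⟩
    · obtain ⟨a, ha⟩ := Int.eq_ofNat_of_zero_le (hκ k hk)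
      have := hfeas.1 k a (by simp [hτ k hk, ha])
      simp only [Pi.add_apply]
      omega
    · have := hfeas.2 i (m i).toNat (by
        have h0 : (((m i).toNat : ℕ) : ℝ) = m i := by
          have : ((m i).toNat : ℤ) = m i := Int.toNat_of_nonneg (hJ i hi)
          exact_mod_cast this
        have h1 := congrFun e i
        simp only [toReal, Pi.add_apply, Pi.one_apply, Finset.sum_apply, Pi.smul_apply,
          smul_eq_mul, latticePt, latticeCombo, hρ i hi] at h1
        push_cast at h1
        have h2 : ∑ k, (A k i : ℝ) * (c k - τ k) + ((m i).toNat + 1) = 0 := by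
          simp only [mul_comm (A _ i : ℝ), sub_mul, Finset.sum_sub_distrib]
          rw [h0]
          linarith
        have h3 := congrArg (fun x : ℝ => (x : ℂ)) h2
        push_cast at h3 ⊢
        exact h3)
      rw [Int.toNat_of_nonneg (hJ i hi)] at this
      simp only [Pi.sub_apply]
      linarith
  · have h1 : L (toReal (1 + (latticeCombo A c + m))) = ∑ k, τ k := by
      rw [e, map_add, map_sum]
      have h2 : L ρ = 0 := by
        have h3 : ρ = ∑ i, ρ i • (Pi.single i 1 : Fin n → ℝ) := by
          ext j
          simp [Finset.sum_apply, Pi.single_apply]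
        rw [h3, map_sum]
        refine Finset.sum_eq_zero fun i _ => ?_
        by_cases hi : i ∈ freeCoords l
        · rw [map_smul, h.apply_single_eq_zero hL hi, smul_zero]
        · rw [hρ i hi, zero_smul, map_zero]
      rw [h2, add_zero]
      refine Finset.sum_congr rfl fun k _ => ?_
      by_cases hk : k ∈ faceGens A Q
      · rw [map_smul, hL _ hk, smul_eq_mul, mul_one]
      · rw [hτ k hk, zero_smul, map_zero]
    rw [h1, ← Complex.ofReal_sum, Finset.sum_sub_distrib]
    have h3 : ∑ k, (c k : ℝ) = 0 := by exact_mod_cast hc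
    rw [h3]
    simp

theorem exists_int_multiple (x : Fin r → ℚ) :
    ∃ (N : ℕ) (c : Fin r → ℤ), 0 < N ∧ ∀ k, (c k : ℚ) = N * x k := by
  have h : ∀ k, ∃ e : ℕ, ∏ j, (x j).den = (x k).den * e := fun k =>
    Finset.dvd_prod_of_mem (fun j => (x j).den) (Finset.mem_univ k)
  choose e he using h
  refine ⟨∏ j, (x j).den, fun k => e k * (x k).num, Finset.prod_pos fun j _ => (x j).den_pos,
    fun k => ?_⟩
  rw [he k]
  push_cast
  rw [mul_right_comm, mul_comm ((x k).den : ℚ), Rat.mul_den_eq_num, mul_comm]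

theorem cast_latticeCombo {A : Fin r → Fin n →₀ ℕ} {x : Fin r → ℚ} {N : ℕ} {c : Fin r → ℤ}
    (hc : ∀ k, (c k : ℚ) = N * x k) (i : Fin n) :
    (latticeCombo A c i : ℚ) = N * ∑ k, (A k i : ℚ) * x k := by
  simp only [latticeCombo]
  push_cast
  rw [Finset.mul_sum]
  exact Finset.sum_congr rfl fun k _ => by rw [hc]; ring

/-- If all `s_k` were natural numbers, no `ℓ_i(s)` would be negative and any unit vector would be
feasible. -/
theorem exists_not_nat_of_mem_testZeros [NeZero r] {A : Fin r → Fin n →₀ ℕ} {s : Fin r → ℂ}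
    (hs : s ∈ testZeros A) : ∃ k, ∀ m : ℕ, s k ≠ m := by
  by_contra! hK
  choose m hm using hK
  refine mem_testZeros_iff_not_isFeasible.1 hs (Pi.single 0 1) (by simp) ⟨fun k m _ => ?_, fun i m' h => ?_⟩
  · have : (0 : ℤ) ≤ (Pi.single 0 1 : Fin r → ℤ) k := by
      rw [Pi.single_apply]
      split_ifs <;> norm_num
    omega
  · exfalso
    simp only [hm] at h
    have : ∑ k, A k i * m k + (m' + 1) = 0 := by exact_mod_cast h
    omega

/-- A violating `x` scales to an integer vector of sum at least `1`. The surplus is removed at a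
coordinate where `s` is not a natural number: it carries no sign constraint, and lowering it only
decreases `∑ c_k A_k`. -/
theorem sum_nonpos_of_mem_testZeros [NeZero r] {A : Fin r → Fin n →₀ ℕ} {s : Fin r → ℂ}
    (hs : s ∈ testZeros A) {x : Fin r → ℚ} (hx : ∀ k (m : ℕ), s k = m → 0 ≤ x k)
    (hx' : ∀ i (m : ℕ), ∑ k, (A k i : ℂ) * s k + (m + 1) = 0 → ∑ k, (A k i : ℚ) * x k ≤ 0) :
    ∑ k, x k ≤ 0 := by
  by_contra! hpos
  obtain ⟨k₀, hk₀⟩ := exists_not_nat_of_mem_testZeros hs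
  obtain ⟨N, c, hN, hc⟩ := exists_int_multiple x
  have hNQ : (0 : ℚ) < N := by exact_mod_cast hN
  have hsum : 0 < ∑ k, c k := by
    have : (0 : ℚ) < ((∑ k, c k : ℤ) : ℚ) := by
      push_cast
      simp only [hc, ← Finset.mul_sum]
      positivity
    exact_mod_cast this
  refine mem_testZeros_iff_not_isFeasible.1 hs (c - Pi.single k₀ (∑ k, c k - 1))
    (by simp [Finset.sum_sub_distrib]) ⟨fun k m hk => ?_, fun i m hi => ?_⟩
  · have hne : k ≠ k₀ := fun e => hk₀ m (e ▸ hk)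
    have h1 : (0 : ℚ) ≤ c k := by
      rw [hc]
      exact mul_nonneg hNQ.le (hx k m hk)
    have h2 : 0 ≤ c k := by exact_mod_cast h1
    simp [hne]
    omega
  · have h1 : (latticeCombo A c i : ℚ) ≤ 0 := by
      rw [cast_latticeCombo hc]
      exact mul_nonpos_of_nonneg_of_nonpos hNQ.le (hx' i m hi)
    have h2 : latticeCombo A c i ≤ 0 := by exact_mod_cast h1
    have h3 : 0 ≤ (∑ k, c k - 1) * latticePt A k₀ i :=
      mul_nonneg (by omega) (Int.natCast_nonneg _)
    rw [latticeCombo_sub, latticeCombo_single]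
    simp only [Pi.sub_apply, Pi.smul_apply, smul_eq_mul]
    omega

/-- The dual description of the bound `sum_nonpos_of_mem_testZeros`, with strict
complementarity. -/
theorem exists_weights_of_mem_testZeros [NeZero r] {A : Fin r → Fin n →₀ ℕ} {s : Fin r → ℂ}
    (hs : s ∈ testZeros A) : ∃ (p : Fin r → ℚ) (q : Fin n → ℚ) (c : Fin r → ℤ),
      (∀ k, 0 ≤ p k) ∧ (∀ i, 0 ≤ q i) ∧ (∀ k, ∑ i, q i * A k i = 1 + p k) ∧
      (∀ k, 0 < p k → ∃ m : ℕ, s k = m) ∧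
      (∀ i, 0 < q i → ∃ m : ℕ, ∑ k, (A k i : ℂ) * s k + (m + 1) = 0) ∧
      ∑ k, c k = 0 ∧ (∀ k (m : ℕ), s k = m → 0 ≤ c k ∧ (p k = 0 → 0 < c k)) ∧
      ∀ i (m : ℕ), ∑ k, (A k i : ℂ) * s k + (m + 1) = 0 →
        latticeCombo A c i ≤ 0 ∧ (q i = 0 → latticeCombo A c i < 0) := by
  classical
  -- Absent constraints are replaced by the zero form, which keeps the index type fixed. Strict
  -- complementarity gives zero forms a positive weight, so `p` and `q` below are masked by the same
  -- conditions.
  let g : Fin r ⊕ Fin n → (Fin r → ℚ) →ₗ[ℚ] ℚ := Sum.elim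
    (fun k => if ∃ m : ℕ, s k = m then LinearMap.proj k else 0)
    (fun i => if ∃ m : ℕ, ∑ k, (A k i : ℂ) * s k + (m + 1) = 0 then
      -∑ k, (A k i : ℚ) • LinearMap.proj k else 0)
  have hg1 : ∀ k (x : Fin r → ℚ), g (Sum.inl k) x = if ∃ m : ℕ, s k = m then x k else 0 :=
    fun k x => by
      simp only [g, Sum.elim_inl]
      split_ifs <;> simp
  have hg2 : ∀ i (x : Fin r → ℚ), g (Sum.inr i) x =
      if ∃ m : ℕ, ∑ k, (A k i : ℂ) * s k + (m + 1) = 0 then -∑ k, (A k i : ℚ) * x k else 0 :=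
    fun i x => by
      simp only [g, Sum.elim_inr]
      split_ifs <;> simp
  rcases farkas_strict g (-∑ k, LinearMap.proj k) with ⟨x, hx, hφ⟩ | ⟨c, x, hc, hφ, hx, hφx, hcx⟩
  · exfalso
    have h := sum_nonpos_of_mem_testZeros hs (x := x)
      (fun k m hk => by
        have := hx (Sum.inl k)
        rwa [hg1, if_pos ⟨m, hk⟩] at this)
      (fun i m hi => by
        have := hx (Sum.inr i)
        rw [hg2, if_pos ⟨m, hi⟩] at this
        linarith)
    simp at hφ
    linarith
  · obtain ⟨N, d, hN, hd⟩ := exists_int_multiple x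
    have hNQ : (0 : ℚ) < N := by exact_mod_cast hN
    refine ⟨fun k => if ∃ m : ℕ, s k = m then c (Sum.inl k) else 0,
      fun i => if ∃ m : ℕ, ∑ k, (A k i : ℂ) * s k + (m + 1) = 0 then c (Sum.inr i) else 0, d,
      fun k => ?_, fun i => ?_, fun k => ?_, fun k hk => ?_, fun i hi => ?_, ?_, fun k m hk => ?_,
      fun i m hi => ?_⟩
    · dsimp only
      split_ifs
      exacts [hc _, le_rfl]
    · dsimp only
      split_ifs
      exacts [hc _, le_rfl]
    · have h1 := congrArg (fun ψ : (Fin r → ℚ) →ₗ[ℚ] ℚ => ψ (Pi.single k 1)) hφ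
      simp only [LinearMap.neg_apply, LinearMap.sum_apply, LinearMap.smul_apply,
        LinearMap.proj_apply, Fintype.sum_sum_type, LinearMap.add_apply, smul_eq_mul] at h1
      have h2 : ∑ j, c (Sum.inl j) * g (Sum.inl j) (Pi.single k 1) =
          if ∃ m : ℕ, s k = m then c (Sum.inl k) else 0 := by
        rw [Finset.sum_eq_single k]
        · rw [hg1, Pi.single_eq_same, mul_ite, mul_one, mul_zero]
        · intro j _ hj
          rw [hg1, Pi.single_eq_of_ne hj, ite_self, mul_zero]
        · simp
      have h3 : ∑ i, c (Sum.inr i) * g (Sum.inr i) (Pi.single k 1) =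
          -∑ i, (if ∃ m : ℕ, ∑ k, (A k i : ℂ) * s k + (m + 1) = 0 then c (Sum.inr i) else 0) *
            A k i := by
        rw [← Finset.sum_neg_distrib]
        refine Finset.sum_congr rfl fun i _ => ?_
        rw [hg2]
        split_ifs
        · simp [Pi.single_apply]
        · simp
      have h4 : ∑ j, (Pi.single k 1 : Fin r → ℚ) j = 1 := by simp
      rw [h2, h3, h4] at h1
      dsimp only
      linarith
    · by_contra h
      simp [if_neg h] at hk
    · by_contra h
      simp [if_neg h] at hi
    · have h1 : ((∑ k, d k : ℤ) : ℚ) = 0 := by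
        push_cast
        simp only [hd, ← Finset.mul_sum]
        have : ∑ k, x k = 0 := by simpa using hφx
        rw [this, mul_zero]
      exact_mod_cast h1
    · have h1 := hx (Sum.inl k)
      have h2 := hcx (Sum.inl k)
      rw [hg1, if_pos ⟨m, hk⟩] at h1 h2
      dsimp only
      rw [if_pos ⟨m, hk⟩]
      have h3 : (0 : ℚ) ≤ d k := by
        rw [hd]
        positivity
      refine ⟨by exact_mod_cast h3, fun h0 => ?_⟩
      have h4 : (0 : ℚ) < d k := by
        rw [hd]
        exact mul_pos hNQ (h2.resolve_left h0.le.not_gt)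
      exact_mod_cast h4
    · have h1 := hx (Sum.inr i)
      have h2 := hcx (Sum.inr i)
      rw [hg2, if_pos ⟨m, hi⟩] at h1 h2
      dsimp only
      rw [if_pos ⟨m, hi⟩]
      have h3 : (latticeCombo A d i : ℚ) ≤ 0 := by
        rw [cast_latticeCombo hd]
        exact mul_nonpos_of_nonneg_of_nonpos hNQ.le (by linarith)
      refine ⟨by exact_mod_cast h3, fun h0 => ?_⟩
      have h4 : (latticeCombo A d i : ℚ) < 0 := by
        rw [cast_latticeCombo hd]
        have := h2.resolve_left h0.le.not_gt
        exact mul_neg_of_pos_of_neg hNQ (by linarith)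
      exact_mod_cast h4

end BernsteinSato
end

/-! ### Weights, the faces they cut out, and the passage from test zeros to face roots -/

noncomputable section
namespace BernsteinSato
open MvPolynomial
variable {n r : ℕ}

section weights

variable {A : Fin r → Fin n →₀ ℕ} {p : Fin r → ℚ} {q : Fin n → ℚ}

/-- The linear form `x ↦ ∑ q_i x_i`. -/
def weightForm (q : Fin n → ℚ) : (Fin n → ℝ) →ₗ[ℝ] ℝ := ∑ i, (q i : ℝ) • LinearMap.proj i

theorem weightForm_apply (q : Fin n → ℚ) (x : Fin n → ℝ) : weightForm q x = ∑ i, q i * x i := by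
  simp [weightForm]

theorem weightForm_single (q : Fin n → ℚ) (i : Fin n) : weightForm q (Pi.single i 1) = q i := by
  simp [weightForm_apply, Pi.single_apply]

theorem weightForm_latticePt (hqA : ∀ k, ∑ i, q i * A k i = 1 + p k) (k : Fin r) :
    weightForm q (toReal (latticePt A k)) = 1 + p k := by
  rw [weightForm_apply]
  simp only [toReal, latticePt, Int.cast_natCast]
  exact_mod_cast congrArg (fun x : ℚ => (x : ℝ)) (hqA k)

theorem weightForm_mono (hq : ∀ i, 0 ≤ q i) {u v : Fin n → ℤ} (h : u ≤ v) :
    weightForm q (toReal u) ≤ weightForm q (toReal v) := by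
  rw [weightForm_apply, weightForm_apply]
  refine Finset.sum_le_sum fun i _ => mul_le_mul_of_nonneg_left ?_ (by exact_mod_cast hq i)
  exact Int.cast_le.2 (h i)

/-- The face of the Newton polyhedron cut out by `∑ q_i x_i = 1`. -/
def weightFace (A : Fin r → Fin n →₀ ℕ) (q : Fin n → ℚ) : Set (Fin n → ℝ) :=
  {x ∈ newtonPolyhedron (Ideal.span (Set.range (mono A))) | weightForm q x = 1}

theorem one_le_weightForm (hp : ∀ k, 0 ≤ p k) (hq : ∀ i, 0 ≤ q i)
    (hqA : ∀ k, ∑ i, q i * A k i = 1 + p k) {x : Fin n → ℝ}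
    (hx : x ∈ newtonPolyhedron (Ideal.span (Set.range (mono A)))) : 1 ≤ weightForm q x := by
  refine (convexHull_min (t := {x | 1 ≤ weightForm q x}) ?_
    (convex_halfSpace_ge (weightForm q).isLinear 1)) hx
  rintro _ ⟨v, hv, rfl⟩
  obtain ⟨k, hk⟩ := mem_lattExpSet_iff.1 hv
  have h1 := weightForm_mono hq hk
  rw [weightForm_latticePt hqA] at h1
  have h2 : (0 : ℝ) ≤ p k := by exact_mod_cast hp k
  change 1 ≤ weightForm q (toReal v)
  linarith

theorem mem_faceGens_weightFace (hqA : ∀ k, ∑ i, q i * A k i = 1 + p k) {k : Fin r} :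
    k ∈ faceGens A (weightFace A q) ↔ p k = 0 := by
  change _ ∧ _ ↔ _
  rw [weightForm_latticePt hqA, add_eq_left, Rat.cast_eq_zero]
  exact and_iff_right (toReal_mem_newtonPolyhedron le_rfl)

theorem mem_freeCoords_weightForm {i : Fin n} : i ∈ freeCoords (-weightForm q) ↔ q i = 0 := by
  change (-weightForm q) (Pi.single i 1) = 0 ↔ _
  rw [LinearMap.neg_apply, weightForm_single, neg_eq_zero, Rat.cast_eq_zero]

theorem isMaxLocus_weightFace (hp : ∀ k, 0 ≤ p k) (hq : ∀ i, 0 ≤ q i)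
    (hqA : ∀ k, ∑ i, q i * A k i = 1 + p k) {k₀ : Fin r} (hk₀ : p k₀ = 0) :
    IsMaxLocus A (-weightForm q) (weightFace A q) := by
  have h0 : toReal (latticePt A k₀) ∈ weightFace A q := (mem_faceGens_weightFace hqA).2 hk₀
  refine ⟨⟨_, h0⟩, ?_⟩
  ext x
  refine and_congr_right fun hx => ⟨fun h y hy => ?_, fun h => ?_⟩
  · rw [LinearMap.neg_apply, LinearMap.neg_apply, h]
    exact neg_le_neg (one_le_weightForm hp hq hqA hy)
  · have h1 := h _ h0.1
    rw [LinearMap.neg_apply, LinearMap.neg_apply, h0.2] at h1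
    exact le_antisymm (neg_le_neg_iff.1 h1) (one_le_weightForm hp hq hqA hx)

end weights

theorem IsMaxLocus.isExposed {A : Fin r → Fin n →₀ ℕ} {l : (Fin n → ℝ) →ₗ[ℝ] ℝ}
    {Q : Set (Fin n → ℝ)} (h : IsMaxLocus A l Q) :
    IsExposed ℝ (newtonPolyhedron (Ideal.span (Set.range (mono A)))) Q :=
  fun _ => ⟨LinearMap.toContinuousLinearMap l, h.eq⟩

theorem exists_isMaxLocus {A : Fin r → Fin n →₀ ℕ} {Q : Set (Fin n → ℝ)}
    (hQ : Q ∈ faces (Ideal.span (Set.range (mono A)))) : ∃ l, IsMaxLocus A l Q := by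
  obtain ⟨hne, hexp, -⟩ := hQ
  obtain ⟨l, hl⟩ := hexp hne
  exact ⟨l.toLinearMap, hne, hl⟩

/-- The test zeros are accounted for by the roots of the faces. -/
theorem exists_face_of_mem_testZeros [NeZero r] {A : Fin r → Fin n →₀ ℕ} {s : Fin r → ℂ}
    (hs : s ∈ testZeros A) : ∃ Q ∈ faces (Ideal.span (Set.range (mono A))),
      ∃ x ∈ faceRoots (Ideal.span (Set.range (mono A))) Q, ∑ k, s k = -((x : ℝ) : ℂ) := by
  classical
  obtain ⟨p, q, d, hp, hq, hqA, hps, hqs, hd, hdp, hdq⟩ := exists_weights_of_mem_testZeros hs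
  obtain ⟨k₀, hk₀⟩ := exists_not_nat_of_mem_testZeros hs
  -- A coordinate of `s` that is not a natural number carries no weight, so its generator lies on
  -- the face, which is therefore nonempty.
  have hpk₀ : p k₀ = 0 := by
    by_contra h
    obtain ⟨m, hm⟩ := hps k₀ (lt_of_le_of_ne (hp k₀) (Ne.symm h))
    exact hk₀ m hm
  have hQ := isMaxLocus_weightFace hp hq hqA hpk₀
  have hκ : ∀ k, k ∉ faceGens A (weightFace A q) → ∃ m : ℕ, s k = m := fun k hk =>
    hps k (lt_of_le_of_ne (hp k) fun h => hk ((mem_faceGens_weightFace hqA).2 h.symm))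
  have hJ : ∀ i, i ∉ freeCoords (-weightForm q) →
      ∃ m : ℕ, ∑ k, (A k i : ℂ) * s k + (m + 1) = 0 := fun i hi =>
    hqs i (lt_of_le_of_ne (hq i) fun h => hi (mem_freeCoords_weightForm.2 h.symm))
  have hface : weightFace A q ∈ faces (Ideal.span (Set.range (mono A))) := by
    refine ⟨hQ.nonempty, hQ.isExposed, fun i hi => ?_⟩
    -- In a free direction the face is unbounded. Otherwise `Q ⊆ {x_i = 0}` would leave in `ℓ_i(s)`
    -- only terms with `s_k ∈ ℕ`, so it could not be a negative integer.
    by_cases hqi : i ∈ freeCoords (-weightForm q)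
    · have h1 := hi (hQ.add_mem_facePoints ((mem_faceGens_weightFace hqA).2 hpk₀)
        (m := Pi.single i 1) (Pi.single_nonneg.2 zero_le_one) fun j hj => by
          have : j ≠ i := fun e => hj (e ▸ hqi)
          simp [this]).2
      have h2 : (A k₀ i : ℝ) + 1 = 0 := by simpa [toReal, latticePt] using h1
      have h3 : (0 : ℝ) ≤ A k₀ i := Nat.cast_nonneg _
      linarith
    · obtain ⟨m, hm⟩ := hJ i hqi
      have h1 : ∀ k, ∃ a : ℕ, (A k i : ℂ) * s k = a := fun k => by
        by_cases hk : k ∈ faceGens A (weightFace A q)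
        · have h2 : (A k i : ℝ) = 0 := by simpa [toReal, latticePt] using hi hk
          have h3 : A k i = 0 := by exact_mod_cast h2
          exact ⟨0, by simp [h3]⟩
        · obtain ⟨a, ha⟩ := hκ k hk
          exact ⟨A k i * a, by rw [ha]; push_cast; ring⟩
      choose a ha using h1
      simp only [ha] at hm
      have : ∑ k, a k + (m + 1) = 0 := by exact_mod_cast hm
      omega
  choose! b hb using hκ
  choose! m hm using hJ
  -- The integers `s_k` off `Q`, extended by `0`; the sum is then corrected to `0` at `k₀`, where
  -- the cone imposes no sign.
  let c₁ : Fin r → ℤ := fun k => if k ∈ faceGens A (weightFace A q) then 0 else b k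
  let c₀ : Fin r → ℤ := c₁ - Pi.single k₀ (∑ k, c₁ k)
  let m₀ : Fin n → ℤ := fun i => m i
  have hc₀ : ∑ k, c₀ k = 0 := by simp [c₀, Finset.sum_sub_distrib]
  have hc₀b : ∀ k, k ∉ faceGens A (weightFace A q) → c₀ k = b k := fun k hk => by
    have : k ≠ k₀ := fun e => hk (e ▸ (mem_faceGens_weightFace hqA).2 hpk₀)
    simp [c₀, c₁, this, hk]
  have hw : InCone A (faceGens A (weightFace A q)) (freeCoords (-weightForm q)) 0
      (latticeCombo A c₀ + m₀) :=
    ⟨c₀, m₀, hc₀, fun k hk => by simp [hc₀b k hk], fun i _ => by simp [m₀], rfl⟩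
  have hcoord : ∀ i, i ∉ freeCoords (-weightForm q) →
      ((1 + (latticeCombo A c₀ + m₀) : Fin n → ℤ) i : ℂ) = ∑ k, A k i * (c₀ k - s k) := by
    intro i hi
    have := hm i hi
    simp only [Pi.add_apply, Pi.one_apply, latticeCombo, m₀, mul_sub, Finset.sum_sub_distrib]
    push_cast
    simp only [mul_comm (A _ i : ℂ)] at this ⊢
    linear_combination this
  refine ⟨_, hface, _, ⟨weightForm q, ⟨fun i => ⟨q i, weightForm_single q i⟩, fun x hx => hx.2⟩,
    latticeCombo A c₀ + m₀, hQ.mem_faceSemigroup_iff.2 hw, fun hw' => ?_, ?_, rfl⟩, ?_⟩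
  · obtain ⟨c', m', hc', hκ', hJ', e⟩ := hQ.mem_shiftedFaceSemigroup_iff.1 hw'
    -- The vector `c' - c₀` has sum `1` and meets the constraints seen by the face. Those of weight
    -- zero may fail, by at most `N` up to sign, and `d` has slack at least `1` in each of them, so
    -- adding `N • d` makes the vector feasible.
    let N : ℤ := ∑ k, |c' k - c₀ k| + ∑ i, |latticeCombo A (c' - c₀) i|
    have hN1 : ∀ k, |c' k - c₀ k| ≤ N := fun k => by
      have h1 := Finset.single_le_sum (f := fun k => |c' k - c₀ k|) (fun k _ => abs_nonneg _)
        (Finset.mem_univ k)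
      have h2 : 0 ≤ ∑ i, |latticeCombo A (c' - c₀) i| := Finset.sum_nonneg fun i _ => abs_nonneg _
      omega
    have hN2 : ∀ i, |latticeCombo A (c' - c₀) i| ≤ N := fun i => by
      have h1 := Finset.single_le_sum (f := fun i => |latticeCombo A (c' - c₀) i|)
        (fun k _ => abs_nonneg _) (Finset.mem_univ i)
      have h2 : 0 ≤ ∑ k, |c' k - c₀ k| := Finset.sum_nonneg fun i _ => abs_nonneg _
      omega
    have hN : 0 ≤ N := (abs_nonneg _).trans (hN1 k₀)
    refine mem_testZeros_iff_not_isFeasible.1 hs (c' - c₀ + N • d) ?_ ⟨fun k a hk => ?_,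
      fun i a hi => ?_⟩
    · simp [Finset.sum_add_distrib, Finset.sum_sub_distrib, hc', hc₀, ← Finset.mul_sum, hd]
    · simp only [Pi.add_apply, Pi.sub_apply, Pi.smul_apply, smul_eq_mul]
      have h1 := hdp k a hk
      by_cases hkQ : k ∈ faceGens A (weightFace A q)
      · have h2 := h1.2 ((mem_faceGens_weightFace hqA).1 hkQ)
        have h3 : N * 1 ≤ N * d k := mul_le_mul_of_nonneg_left (by omega) hN
        have := neg_abs_le (c' k - c₀ k)
        have := hN1 k
        omega
      · have h2 : b k = a := by
          have := (hb k hkQ).symm.trans hk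
          exact_mod_cast this
        have h3 : 0 ≤ N * d k := mul_nonneg hN h1.1
        have := hκ' k hkQ
        rw [hc₀b k hkQ, h2]
        omega
    · rw [latticeCombo_add, latticeCombo_smul]
      simp only [Pi.add_apply, Pi.smul_apply, smul_eq_mul]
      have h1 := hdq i a hi
      by_cases hiJ : i ∈ freeCoords (-weightForm q)
      · have h2 := h1.2 (mem_freeCoords_weightForm.1 hiJ)
        have h3 : N * latticeCombo A d i ≤ N * (-1) := mul_le_mul_of_nonneg_left (by omega) hN
        have := le_abs_self (latticeCombo A (c' - c₀) i)
        have := hN2 i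
        omega
      · have h2 : m i = a := by
          have : (m i : ℂ) = a := by linear_combination hm i hiJ - hi
          exact_mod_cast this
        have h3 : N * latticeCombo A d i ≤ 0 := mul_nonpos_of_nonneg_of_nonpos hN h1.1
        have h4 := congrFun e i
        have h5 := hJ' i hiJ
        simp only [Pi.add_apply, m₀] at h4
        rw [latticeCombo_sub, Pi.sub_apply]
        omega
  -- What remains of `e + w` after subtracting `∑ (c₀ - re s)_k A_k`. It is supported on the free
  -- coordinates, and the coefficients `c₀ - re s` vanish off `Q`.
  · let ρ : Fin n → ℝ := toReal (1 + (latticeCombo A c₀ + m₀)) -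
      ∑ k, (c₀ k - (s k).re) • toReal (latticePt A k)
    have hρ : ∀ i, i ∉ freeCoords (-weightForm q) → ρ i = 0 := fun i hi => by
      have h1 := congrArg Complex.re (hcoord i hi)
      simp only [ρ, Pi.sub_apply, Finset.sum_apply, Pi.smul_apply, smul_eq_mul, toReal, latticePt,
        Int.cast_natCast, sub_eq_zero]
      rw [Complex.intCast_re, Complex.re_sum] at h1
      rw [h1]
      exact Finset.sum_congr rfl fun k _ => by simp [mul_comm]
    have e : toReal (1 + (latticeCombo A c₀ + m₀)) =
        ∑ k, (c₀ k - (s k).re) • toReal (latticePt A k) +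
          ∑ i, ρ i • (Pi.single i 1 : Fin n → ℝ) := by
      have h3 : ρ = ∑ i, ρ i • (Pi.single i 1 : Fin n → ℝ) := by
        ext j
        simp [Finset.sum_apply, Pi.single_apply]
      rw [← h3]
      simp [ρ]
    rw [e]
    refine add_mem (sum_mem fun k _ => ?_) (sum_mem fun i _ => ?_)
    · by_cases hk : k ∈ faceGens A (weightFace A q)
      · exact Submodule.smul_mem _ _ (Submodule.subset_span hk)
      · rw [hc₀b k hk, hb k hk]
        simp
    · by_cases hi : i ∈ freeCoords (-weightForm q)
      · exact Submodule.smul_mem _ _ (hQ.single_mem_span hi)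
      · rw [hρ i hi, zero_smul]
        exact zero_mem _
  · rw [weightForm_apply]
    push_cast
    have h1 : ∀ i, (q i : ℂ) * ((toReal (1 + (latticeCombo A c₀ + m₀)) i : ℝ) : ℂ) =
        ∑ k, (c₀ k - s k) * (q i * A k i) := fun i => by
      by_cases hi : i ∈ freeCoords (-weightForm q)
      · simp [mem_freeCoords_weightForm.1 hi]
      · have h2 := hcoord i hi
        simp only [toReal, Complex.ofReal_intCast]
        rw [h2, Finset.mul_sum]
        exact Finset.sum_congr rfl fun k _ => by ring
    rw [Finset.sum_congr rfl fun i _ => h1 i, Finset.sum_comm]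
    -- Either `q · A_k = 1`, on `Q`, or `c₀ k = s k`, off `Q`.
    have h2 : ∀ k, ∑ i, (c₀ k - s k) * (q i * A k i) = c₀ k - s k := fun k => by
      rw [← Finset.mul_sum]
      by_cases hk : k ∈ faceGens A (weightFace A q)
      · have h3 : ∑ i, (q i : ℂ) * A k i = 1 := by
          have := hqA k
          rw [(mem_faceGens_weightFace hqA).1 hk, add_zero] at this
          exact_mod_cast congrArg (fun x : ℚ => (x : ℂ)) this
        rw [h3, mul_one]
      · rw [hc₀b k hk, hb k hk]
        simp
    rw [Finset.sum_congr rfl fun k _ => h2 k, Finset.sum_sub_distrib]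
    have h3 : ∑ k, (c₀ k : ℂ) = 0 := by exact_mod_cast hc₀
    rw [h3]
    ring

/-- The sums of the coordinates of the test zeros are the negatives of the roots of the faces. -/
theorem exists_testZero_iff [NeZero r] {A : Fin r → Fin n →₀ ℕ} {z : ℂ} :
    (∃ s ∈ testZeros A, ∑ k, s k = -z) ↔
      z ∈ ⋃ Q ∈ faces (Ideal.span (Set.range (mono A))), (fun x : ℝ => (x : ℂ)) ''
        faceRoots (Ideal.span (Set.range (mono A))) Q := by
  simp only [Set.mem_iUnion, exists_prop]
  constructor
  · rintro ⟨s, hs, hz⟩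
    obtain ⟨Q, hQ, x, hx, h⟩ := exists_face_of_mem_testZeros hs
    exact ⟨Q, hQ, x, hx, neg_injective (h.symm.trans hz)⟩
  · rintro ⟨Q, hQ, x, ⟨L, hL, w, h1, h2, h3, rfl⟩, rfl⟩
    obtain ⟨l, hl⟩ := exists_isMaxLocus hQ
    exact hl.exists_mem_testZeros hL.2 (hl.mem_faceSemigroup_iff.1 h1)
      (fun h => h2 (hl.mem_shiftedFaceSemigroup_iff.2 h)) h3

theorem exists_mono_of_isMonomialIdeal {a : Ideal (Poly n)} (ha : IsMonomialIdeal a) :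
    ∃ (m : ℕ) (A : Fin m → Fin n →₀ ℕ), a = Ideal.span (Set.range (mono A)) := by
  obtain ⟨S, rfl⟩ := ha
  obtain ⟨T, hT, hspan⟩ := (Submodule.fg_span_iff_fg_span_finset_subset _).1
    (IsNoetherian.noetherian (Ideal.span ((fun u => (monomial u 1 : Poly n)) '' S)))
  have hT' : ∀ g ∈ T, ∃ u ∈ S, (monomial u 1 : Poly n) = g := fun g hg => hT hg
  choose! u hu using hT'
  refine ⟨T.card, fun k => u (T.equivFin.symm k), ?_⟩
  refine hspan.trans (congrArg _ ?_)
  ext g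
  constructor
  · intro hg
    refine ⟨T.equivFin ⟨g, hg⟩, ?_⟩
    simpa [mono] using (hu g hg).2
  · rintro ⟨k, rfl⟩
    have := (hu _ (T.equivFin.symm k).2).2
    simp only [mono]
    rw [this]
    exact (T.equivFin.symm k).2

end BernsteinSato
end
theorem mainTheorem1 (n : ℕ) (a : Ideal (MvPolynomial (Fin n) ℂ))
    (ha : BernsteinSato.IsMonomialIdeal a) (ha0 : a ≠ ⊥)
    (r : ℕ) (f : Fin r → MvPolynomial (Fin n) ℂ) (hf0 : ∀ j, f j ≠ 0)
    (hf : Ideal.span (Set.range f) = a) :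
    ∃ b : Polynomial ℂ, BernsteinSato.IsBFunction f b ∧
      {α : ℂ | b.eval (-α) = 0} =
        ⋃ Q ∈ BernsteinSato.faces a, (fun x : ℝ => (x : ℂ)) '' BernsteinSato.faceRoots a Q := by
  obtain ⟨m, A, rfl⟩ := BernsteinSato.exists_mono_of_isMonomialIdeal ha
  have : NeZero m := ⟨by
    rintro rfl
    exact ha0 (by simp)⟩
  -- The sums of test zeros are real because each is minus a face root; this is what the finiteness
  -- argument needs.
  obtain ⟨b, hb, hroots⟩ := BernsteinSato.exists_isBFunction f hf0 A hf fun s hs => by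
    obtain ⟨Q, -, x, -, h⟩ := BernsteinSato.exists_face_of_mem_testZeros hs
    exact ⟨-x, by simpa using h⟩
  refine ⟨b, hb, ?_⟩
  ext α
  rw [← BernsteinSato.exists_testZero_iff]
  exact hroots (-α)
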